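/- **Setting.** A *DLTS* consists of a finite set $S$ of states with an initial state, a finite set $A$ of actions, a transition relation $\Delta\subseteq S\times A\times S$ and a labelling of the states by propositions. The *parallel composition* $E\|M$ of two DLTSs over the same $A$ has the pairs of states as its states, and an action is taken by both components together. Throughout, $A=U\uplus C$ ($U$ uncontrollable, $C$ controllable), and every state of $E$ and of $M$ is labelled by the actions that it enables there. A *transition fluent* is a triple $f=\langle I_f,T_f,\mathit{Init}_f\rangle$ with disjoint $I_f,T_f\subseteq A$ and a truth value $\mathit{Init}_f$. It holds at position $i$ of an infinite execution $s_0,\ell_0,s_1,\ell_1,\dots$ if either $\mathit{Init}_f$ is true and $\ell_j\notin T_f$ for all $j\le i$, or there is $j\le i$ with $\ell_j\in I_f$ and $\ell_l\notin T_f$ for all $j<l\le i$. FLTL formulas are built from fluents and state propositions by Boolean connectives and until; $\Box$ (always) and $\Diamond$ (eventually) are derived as usual. A controller $M$ is *RTC legal* for $E$ if for every reachable state $(e,m)$ of $E\|M$: (i) if $m$ enables some action of $U$, then $m$ enables every action of $U$ enabled in $e$; (ii) if $m$ is the target of some $U$-transition of $M$, then $m$ enables every action of $U$ enabled in $e$;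 (iii) $m$ enables no action of $C$ that is not enabled in $e$. Let $$\psi_e=\Box\Diamond(\text{an action of } C \text{ is taken, or } M \text{ enables no action of } C),\qquad \psi_c=\Box\Diamond(\text{an action of } U \text{ is taken, or } E \text{ enables no action of } U).$$ A *solution* of the RTC control problem $\langle E,\varphi,C\rangle$ is a DLTS $M$ over $A$ (with finitely many states, not necessarily deterministic) such that $M$ is RTC legal for $E$, $E\|M$ has no reachable deadlock, and every infinite execution of $E\|M$ satisfies $\psi_c\wedge(\psi_e\rightarrow\varphi)$. In *RTC control with GR(1) goals* the input is a deterministic DLTS $E$ with state set $S$ (given by its transition table), the set $C$, transition fluents $f_1,\dots,f_k$, and Boolean combinations $\rho,a_1,\dots,a_n,g_1,\dots,g_m$ of these fluents with $n,m\ge1$ (given as formulas over negation and disjunction). The question is whether $\langle E,\varphi,C\rangle$ has a solution for $$\varphi=\Box\rho\wedge\Big(\bigwedge_{i=1}^n\Box\Diamond a_i\rightarrow\bigwedge_{j=1}^m\Box\Diamond g_j\Big).$$ Let $N$ be the number of states of the environment when the values of the fluents are recorded in the states: the number of pairs $(s,v)$ such that some finite run of $E$ from its initial state ends in $s$ with fluent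 values $v$, or $|S|$ if that is larger. Thus $|S|\le N\le 2^k|S|$, and $N=|S|$ if no state is reached with two different fluent valuations. **Corollary (complexity of RTC control with GR(1) goals).** RTC control with GR(1) goals can be decided in time $O(n\cdot m\cdot N^3)$. Precisely, there are a random access machine program (unit-cost addition, truncated subtraction, indirect load and store, and zero tests on natural numbers) and an absolute constant $K$ such that on every input, and for every $L$ that bounds the size of each of $\rho,a_1,\dots,a_n,g_1,\dots,g_m$, the program halts with the correct answer ($1$ or $0$) after at most $$K\cdot(|A|\cdot k+L)\cdot n\cdot m\cdot N^3$$ steps. In particular, for a fixed alphabet, fixed fluents and bounded size of the Boolean combinations, the time is $O(n\cdot m\cdot|S|^3)$. -/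

import Mathlib

namespace RTC

/-! ### Doubly-labelled transition systems -/

/-- A doubly-labelled transition system with state set `S`, state propositions `P` and transition
alphabet `A`. Finiteness of `S` is required where these systems are used. -/
structure DLTS (S P A : Type) where
  /-- the transition relation -/
  trans : S → A → S → Prop
  /-- the state labelling -/
  label : S → Set P
  /-- the initial state -/
  init : S

namespace DLTS

variable {S S' P P' A : Type}

/-- The action `a` is enabled in the state `s`. -/
def Enabled (T : DLTS S P A) (s : S) (a : A) : Prop := ∃ s', T.trans s a s'

/-- Transition-determinism. -/
def Deterministic (T : DLTS S P A) : Prop :=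
  ∀ s a s₁ s₂, T.trans s a s₁ → T.trans s a s₂ → s₁ = s₂

/-- Reachability from the initial state. -/
inductive Reachable (T : DLTS S P A) : S → Prop
  | init : Reachable T T.init
  | step {s : S} {a : A} {s' : S} : Reachable T s → T.trans s a s' → Reachable T s'

/-- No reachable state is a deadlock. -/
def DeadlockFree (T : DLTS S P A) : Prop := ∀ s, T.Reachable s → ∃ a, T.Enabled s a

/-- `s 0, a 0, s 1, a 1, …` is an infinite execution of `T`. -/
def IsExecution (T : DLTS S P A) (s : ℕ → S) (a : ℕ → A) : Prop :=
  s 0 = T.init ∧ ∀ i, T.trans (s i) (a i) (s (i + 1))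

/-- Parallel composition of two systems over the same alphabet: every action belongs to both
alphabets, hence the two components synchronise on all actions. The propositions of the composition
are the disjoint union of those of the components. -/
def par (E : DLTS S P A) (M : DLTS S' P' A) : DLTS (S × S') (P ⊕ P') A where
  trans x a y := E.trans x.1 a y.1 ∧ M.trans x.2 a y.2
  label x := Sum.inl '' E.label x.1 ∪ Sum.inr '' M.label x.2
  init := (E.init, M.init)

/-- The state propositions are the actions, and a state carries the proposition of an action exactly
if it enables that action. -/
def LabelsEnabled (T : DLTS S A A) : Prop := ∀ s a, a ∈ T.label s ↔ T.Enabled s a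

end DLTS

/-! ### Fluent linear temporal logic -/

/-- Transition fluents over the actions `A`. -/
structure TransFluent (A : Type) where
  /-- the initiating actions -/
  initiating : Set A
  /-- the terminating actions -/
  terminating : Set A
  /-- the initial value -/
  initially : Bool
  disjoint : Disjoint initiating terminating

/-- The fluent of a single action. -/
def TransFluent.action {A : Type} (a : A) : TransFluent A where
  initiating := {a}
  terminating := {a}ᶜ
  initially := false
  disjoint := disjoint_compl_right

/-- The transition fluent that always holds. -/
def TransFluent.always (A : Type) : TransFluent A where
  initiating := ∅
  terminating := ∅
  initially := true
  disjoint := disjoint_bot_left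

/-- The transition fluent `f` holds at position `i` of an execution with actions `a 0, a 1, …`. -/
def TransFluent.HoldsAt {A : Type} (f : TransFluent A) (a : ℕ → A) (i : ℕ) : Prop :=
  (f.initially = true ∧ ∀ j ≤ i, a j ∉ f.terminating) ∨
    ∃ j ≤ i, a j ∈ f.initiating ∧ ∀ l, j < l → l ≤ i → a l ∉ f.terminating

/-- Formulas of fluent linear temporal logic over the actions `A` and the propositions `P`. -/
inductive FLTL (A P : Type) where
  | fluent (f : TransFluent A)
  | prop (p : P)
  | neg (φ : FLTL A P)
  | or (φ ψ : FLTL A P)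
  /-- (strong) until -/
  | untl (φ ψ : FLTL A P)

namespace FLTL

variable {A P : Type}

/-- Satisfaction at a position of an infinite execution that performs the actions `a i` and whose
states carry the labels `lab i`. -/
def Sat (lab : ℕ → Set P) (a : ℕ → A) : FLTL A P → ℕ → Prop
  | fluent f, i => f.HoldsAt a i
  | prop p, i => p ∈ lab i
  | neg φ, i => ¬ Sat lab a φ i
  | or φ ψ, i => Sat lab a φ i ∨ Sat lab a ψ i
  | untl φ ψ, i => ∃ j ≥ i, Sat lab a ψ j ∧ ∀ l, i ≤ l → l < j → Sat lab a φ l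

/-- truth -/
def tt : FLTL A P := fluent (TransFluent.always A)

/-- conjunction -/
def and (φ ψ : FLTL A P) : FLTL A P := neg (or (neg φ) (neg ψ))

/-- implication -/
def imp (φ ψ : FLTL A P) : FLTL A P := or (neg φ) ψ

/-- eventually -/
def ev (φ : FLTL A P) : FLTL A P := untl tt φ

/-- always -/
def alw (φ : FLTL A P) : FLTL A P := neg (ev (neg φ))

/-- finite conjunction -/
def conj (l : List (FLTL A P)) : FLTL A P := l.foldr and tt

/-- finite disjunction -/
def disj (l : List (FLTL A P)) : FLTL A P := l.foldr or (neg tt)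

end FLTL

/-! ### Run-to-completion control -/

section Control

variable {S Q P P' A : Type}

/-- Run-to-completion legality of a controller `M` for an environment `E`. The controllable actions
are those in `C`, the uncontrollable ones are the others. -/
def RTCLegal (C : Set A) (E : DLTS S P A) (M : DLTS Q P' A) : Prop :=
  ∀ x, (E.par M).Reachable x →
    ((∃ u ∉ C, M.Enabled x.2 u) → ∀ u ∉ C, E.Enabled x.1 u → M.Enabled x.2 u) ∧
    ((∃ q, ∃ u ∉ C, M.trans q u x.2) → ∀ u ∉ C, E.Enabled x.1 u → M.Enabled x.2 u) ∧
    (∀ c ∈ C, ¬ E.Enabled x.1 c → ¬ M.Enabled x.2 c)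

open Classical in
/-- The list of the actions in a set. -/
noncomputable def actionList [Fintype A] (X : Set A) : List A :=
  (Finset.univ.filter (· ∈ X)).toList

variable [Fintype A]

/-- Some action in `X` is taken. -/
noncomputable def someAction (X : Set A) : FLTL A P :=
  FLTL.disj ((actionList X).map fun a => FLTL.fluent (TransFluent.action a))

/-- The environment enables no uncontrollable action. -/
noncomputable def passE (C : Set A) : FLTL A (A ⊕ A) :=
  FLTL.conj ((actionList Cᶜ).map fun a => FLTL.neg (FLTL.prop (Sum.inl a)))

/-- The controller enables no controllable action. -/
noncomputable def passM (C : Set A) : FLTL A (A ⊕ A) :=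
  FLTL.conj ((actionList C).map fun a => FLTL.neg (FLTL.prop (Sum.inr a)))

/-- Non-Zenoness of the environment. -/
noncomputable def nonZenoE (C : Set A) : FLTL A (A ⊕ A) :=
  FLTL.alw (FLTL.ev (FLTL.or (someAction C) (passM C)))

/-- Non-Zenoness of the controller. -/
noncomputable def nonZenoC (C : Set A) : FLTL A (A ⊕ A) :=
  FLTL.alw (FLTL.ev (FLTL.or (someAction Cᶜ) (passE C)))

/-- `M` solves the run-to-completion control problem for the environment `E`, the goal `φ` and the
set `C` of controllable actions. -/
def IsRTCSolution (E : DLTS S A A) (φ : FLTL A (A ⊕ A)) (C : Set A) (M : DLTS Q A A) : Prop :=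
  M.LabelsEnabled ∧ RTCLegal C E M ∧ (E.par M).DeadlockFree ∧
    ∀ s a, (E.par M).IsExecution s a →
      FLTL.Sat (fun i => (E.par M).label (s i)) a
        (FLTL.and (nonZenoC C) (FLTL.imp (nonZenoE C) φ)) 0

/-- The run-to-completion control problem has a solution (a finite-state controller). -/
def RTCControllable (E : DLTS S A A) (φ : FLTL A (A ⊕ A)) (C : Set A) : Prop :=
  ∃ (Q : Type) (_ : Finite Q) (M : DLTS Q A A), IsRTCSolution E φ C M

end Control

/-! ### GR(1) goals -/

/-- Boolean combinations of `k` fluents. -/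
inductive BoolComb (k : ℕ) where
  | var (f : Fin k)
  | neg (b : BoolComb k)
  | or (b c : BoolComb k)

namespace BoolComb

variable {k : ℕ}

/-- The number of occurrences of fluents and connectives. -/
def size : BoolComb k → ℕ
  | var _ => 1
  | neg b => b.size + 1
  | or b c => b.size + c.size + 1

/-- The corresponding formula, for given fluents. -/
def toFLTL {A P : Type} (fl : Fin k → TransFluent A) : BoolComb k → FLTL A P
  | var f => FLTL.fluent (fl f)
  | neg b => FLTL.neg (b.toFLTL fl)
  | or b c => FLTL.or (b.toFLTL fl) (c.toFLTL fl)

/-- Postfix notation: negation is `1`, disjunction is `2`, the fluent `f` is `f + 3`. -/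
def code : BoolComb k → List ℕ
  | var f => [f.val + 3]
  | neg b => b.code ++ [1]
  | or b c => b.code ++ c.code ++ [2]

end BoolComb

/-- An instance of run-to-completion control with a GR(1) goal: a deterministic environment with
states `0, …, s - 1` and actions `0, …, α - 1`, the set of controllable actions, `k` transition
fluents, and the Boolean combinations of these that make up the goal. -/
structure RTCInstance where
  /-- number of states of the environment -/
  s : ℕ
  /-- number of actions -/
  α : ℕ
  /-- number of fluents -/
  k : ℕ
  /-- number of assumptions -/
  n : ℕ
  /-- number of guarantees -/
  m : ℕ
  /-- the successor of a state under an action, if the action is enabled there -/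
  next : Fin s → Fin α → Option (Fin s)
  /-- the initial state -/
  init : Fin s
  /-- the controllable actions -/
  ctrl : Set (Fin α)
  /-- the fluents -/
  fluents : Fin k → TransFluent (Fin α)
  /-- the safety part of the goal -/
  rho : BoolComb k
  /-- the assumptions -/
  assume : Fin n → BoolComb k
  /-- the guarantees -/
  guar : Fin m → BoolComb k

namespace RTCInstance

/-- The environment. -/
def env (I : RTCInstance) : DLTS (Fin I.s) (Fin I.α) (Fin I.α) where
  trans q a q' := I.next q a = some q'
  label q := {a | ∃ q', I.next q a = some q'}
  init := I.init

/-- The goal `□ ρ ∧ (⋀ i, □ ◇ aᵢ → ⋀ j, □ ◇ gⱼ)`. -/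
def goal (I : RTCInstance) : FLTL (Fin I.α) (Fin I.α ⊕ Fin I.α) :=
  FLTL.and (FLTL.alw (I.rho.toFLTL I.fluents))
    (FLTL.imp
      (FLTL.conj (List.ofFn fun i => FLTL.alw (FLTL.ev ((I.assume i).toFLTL I.fluents))))
      (FLTL.conj (List.ofFn fun j => FLTL.alw (FLTL.ev ((I.guar j).toFLTL I.fluents)))))

/-- The question to be decided. -/
def Controllable (I : RTCInstance) : Prop := RTCControllable I.env I.goal I.ctrl

/-- `L` bounds the size of every Boolean combination in the goal. -/
def SizeLe (I : RTCInstance) (L : ℕ) : Prop :=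
  I.rho.size ≤ L ∧ (∀ i, (I.assume i).size ≤ L) ∧ ∀ j, (I.guar j).size ≤ L

/-- `I.Config q v`: some finite run of the environment ends in the state `q`, with `v` the values
that the fluents have then. -/
inductive Config (I : RTCInstance) : Fin I.s → (Fin I.k → Prop) → Prop
  | init : Config I I.init (fun f => (I.fluents f).initially = true)
  | step {q : Fin I.s} {v : Fin I.k → Prop} {a : Fin I.α} {q' : Fin I.s} :
      Config I q v → I.next q a = some q' →
      Config I q' (fun f => a ∈ (I.fluents f).initiating ∨ (v f ∧ a ∉ (I.fluents f).terminating))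

/-- The number of states of the environment once the values of the fluents are recorded in them:
the number of reachable pairs of a state and a valuation, or `s` if that is larger. It equals `s`
if no state is reached with two different valuations, and it never exceeds `2 ^ k * s`. -/
noncomputable def numStates (I : RTCInstance) : ℕ :=
  max I.s {x : Fin I.s × (Fin I.k → Prop) | I.Config x.1 x.2}.ncard

end RTCInstance

/-! ### Random access machines -/

/-- The store of a random access machine: registers and (infinite) arrays of natural numbers. -/
structure Store where
  /-- the registers -/
  reg : ℕ → ℕ
  /-- the arrays: `mem b i` is the entry number `i` of the array number `b` -/
  mem : ℕ → ℕ → ℕ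

/-- Set a register. -/
def Store.setReg (σ : Store) (x c : ℕ) : Store :=
  { σ with reg := Function.update σ.reg x c }

/-- Set an array entry. -/
def Store.setMem (σ : Store) (b i c : ℕ) : Store :=
  { σ with mem := Function.update σ.mem b (Function.update (σ.mem b) i c) }

/-- Programs of a random access machine, with structured control flow. Registers, arrays and
constants that occur in a program are fixed; only `load` and `store` address indirectly. -/
inductive Prog where
  /-- `x := c` for a constant `c` -/
  | const (x c : ℕ)
  /-- `x := y + z` -/
  | add (x y z : ℕ)
  /-- `x := y - z`, truncated at `0` -/
  | sub (x y z : ℕ)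
  /-- `x := b[y]` -/
  | load (x b y : ℕ)
  /-- `b[y] := x` -/
  | store (b y x : ℕ)
  /-- sequential composition -/
  | seq (p q : Prog)
  /-- if `x ≠ 0` then `p` else `q` -/
  | ite (x : ℕ) (p q : Prog)
  /-- while `x ≠ 0` do `p` -/
  | loop (x : ℕ) (p : Prog)

/-- `Run p σ t σ'`: started in the store `σ`, the program `p` halts after exactly `t` steps in the
store `σ'`. Every elementary operation and every test is one step. -/
inductive Run : Prog → Store → ℕ → Store → Prop
  | const {σ : Store} (x c : ℕ) : Run (.const x c) σ 1 (σ.setReg x c)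
  | add {σ : Store} (x y z : ℕ) : Run (.add x y z) σ 1 (σ.setReg x (σ.reg y + σ.reg z))
  | sub {σ : Store} (x y z : ℕ) : Run (.sub x y z) σ 1 (σ.setReg x (σ.reg y - σ.reg z))
  | load {σ : Store} (x b y : ℕ) : Run (.load x b y) σ 1 (σ.setReg x (σ.mem b (σ.reg y)))
  | store {σ : Store} (b y x : ℕ) : Run (.store b y x) σ 1 (σ.setMem b (σ.reg y) (σ.reg x))
  | seq {p q : Prog} {σ σ' σ'' : Store} {t t' : ℕ} :
      Run p σ t σ' → Run q σ' t' σ'' → Run (.seq p q) σ (t + t') σ''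
  | ite_pos {x : ℕ} {p q : Prog} {σ σ' : Store} {t : ℕ} :
      σ.reg x ≠ 0 → Run p σ t σ' → Run (.ite x p q) σ (t + 1) σ'
  | ite_zero {x : ℕ} {p q : Prog} {σ σ' : Store} {t : ℕ} :
      σ.reg x = 0 → Run q σ t σ' → Run (.ite x p q) σ (t + 1) σ'
  | loop_pos {x : ℕ} {p : Prog} {σ σ' σ'' : Store} {t t' : ℕ} :
      σ.reg x ≠ 0 → Run p σ t σ' → Run (.loop x p) σ' t' σ'' →
      Run (.loop x p) σ (t + t' + 1) σ''
  | loop_zero {x : ℕ} {p : Prog} {σ : Store} : σ.reg x = 0 → Run (.loop x p) σ 1 σ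

/-- A matrix with `r` rows and `c` columns as an array, row by row. -/
def rowMajor {r c : ℕ} (f : Fin r → Fin c → ℕ) (i : ℕ) : ℕ :=
  if h : i / c < r ∧ i % c < c then f ⟨i / c, h.1⟩ ⟨i % c, h.2⟩ else 0

open Classical in
/-- The input store of an instance. The registers `0, …, 5` hold `s`, `α`, `k`, `n`, `m` and the
initial state. The arrays are:
* `0`: the transition table (`0` if the action is not enabled, otherwise the successor plus one);
* `1`: the controllable actions (`1`, otherwise `0`);
* `2`: for each fluent and action, `1` if initiating, `2` if terminating, otherwise `0`;
* `3`: the initial values of the fluents;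
* `4`: the safety condition, the assumptions and the guarantees, in postfix notation, each followed
  by `0`.
Everything else is `0`. -/
noncomputable def RTCInstance.input (I : RTCInstance) : Store where
  reg := fun x => [I.s, I.α, I.k, I.n, I.m, I.init.val].getD x 0
  mem := fun b => match b with
    | 0 => rowMajor fun q a => (I.next q a).elim 0 fun q' => q'.val + 1
    | 1 => fun i => (List.ofFn fun a : Fin I.α => if a ∈ I.ctrl then 1 else 0).getD i 0
    | 2 => rowMajor fun (f : Fin I.k) (a : Fin I.α) =>
        if a ∈ (I.fluents f).initiating then 1
        else if a ∈ (I.fluents f).terminating then 2 else 0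
    | 3 => fun i => (List.ofFn fun f : Fin I.k => if (I.fluents f).initially then 1 else 0).getD i 0
    | 4 => fun i =>
        ([I.rho] ++ List.ofFn I.assume ++ List.ofFn I.guar).flatMap
          (fun b => b.code ++ [0]) |>.getD i 0
    | _ => fun _ => 0

end RTC

/-! ### Timed Hoare-style reasoning for random access machine programs. -/

namespace RTC

/-! ### Reasoning about programs -/

@[simp] theorem Store.reg_setReg (σ : Store) (x c y : ℕ) :
    (σ.setReg x c).reg y = if y = x then c else σ.reg y := by
  simp [Store.setReg, Function.update_apply]

@[simp] theorem Store.mem_setReg (σ : Store) (x c : ℕ) : (σ.setReg x c).mem = σ.mem := rfl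

@[simp] theorem Store.reg_setMem (σ : Store) (b i c : ℕ) : (σ.setMem b i c).reg = σ.reg := rfl

@[simp] theorem Store.mem_setMem (σ : Store) (b i c b' : ℕ) :
    (σ.setMem b i c).mem b' = if b' = b then Function.update (σ.mem b) i c else σ.mem b' := by
  simp [Store.setMem, Function.update_apply]

namespace Prog

/-- The effect of a program without loops. -/
def exec : Prog → Store → Store
  | const x c, σ => σ.setReg x c
  | add x y z, σ => σ.setReg x (σ.reg y + σ.reg z)
  | sub x y z, σ => σ.setReg x (σ.reg y - σ.reg z)
  | load x b y, σ => σ.setReg x (σ.mem b (σ.reg y))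
  | store b y x, σ => σ.setMem b (σ.reg y) (σ.reg x)
  | seq p q, σ => q.exec (p.exec σ)
  | ite x p q, σ => if σ.reg x = 0 then q.exec σ else p.exec σ
  | loop _ _, σ => σ

/-- The program contains no loop. -/
def loopFree : Prog → Bool
  | seq p q => p.loopFree && q.loopFree
  | ite _ p q => p.loopFree && q.loopFree
  | loop _ _ => false
  | _ => true

/-- The maximal number of steps of a program without loops. -/
def cost : Prog → ℕ
  | seq p q => p.cost + q.cost
  | ite _ p q => max p.cost q.cost + 1
  | loop _ _ => 0
  | _ => 1

/-- The program writes to the register `y`. -/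
def modR : Prog → ℕ → Bool
  | const x _, y => x == y
  | add x _ _, y => x == y
  | sub x _ _, y => x == y
  | load x _ _, y => x == y
  | store _ _ _, _ => false
  | seq p q, y => p.modR y || q.modR y
  | ite _ p q, y => p.modR y || q.modR y
  | loop _ p, y => p.modR y

/-- The program writes to the array `b`. -/
def modM : Prog → ℕ → Bool
  | store b' _ _, b => b' == b
  | seq p q, b => p.modM b || q.modM b
  | ite _ p q, b => p.modM b || q.modM b
  | loop _ p, b => p.modM b
  | _, _ => false

/-- The sequential composition of a list of programs. -/
def block : List Prog → Prog
  -- There is no idle instruction; a write to a scratch register takes its place.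
  | [] => const 6 0
  | [p] => p
  | p :: q :: l => seq p (block (q :: l))

end Prog

open Prog

theorem Run.exec {p : Prog} (h : p.loopFree = true) (σ : Store) :
    ∃ t ≤ p.cost, Run p σ t (p.exec σ) := by
  induction p generalizing σ with
  | const x c => exact ⟨1, le_rfl, .const x c⟩
  | add x y z => exact ⟨1, le_rfl, .add x y z⟩
  | sub x y z => exact ⟨1, le_rfl, .sub x y z⟩
  | load x b y => exact ⟨1, le_rfl, .load x b y⟩
  | store b y x => exact ⟨1, le_rfl, .store b y x⟩
  | seq p q hp hq =>
    simp only [loopFree, Bool.and_eq_true] at h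
    obtain ⟨t, ht, h1⟩ := hp h.1 σ
    obtain ⟨t', ht', h2⟩ := hq h.2 (p.exec σ)
    exact ⟨t + t', Nat.add_le_add ht ht', .seq h1 h2⟩
  | ite x p q hp hq =>
    simp only [loopFree, Bool.and_eq_true] at h
    by_cases hx : σ.reg x = 0
    · obtain ⟨t, ht, h1⟩ := hq h.2 σ
      refine ⟨t + 1, by simp only [cost]; omega, ?_⟩
      simpa [Prog.exec, hx] using Run.ite_zero hx h1
    · obtain ⟨t, ht, h1⟩ := hp h.1 σ
      refine ⟨t + 1, by simp only [cost]; omega, ?_⟩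
      simpa [Prog.exec, hx] using Run.ite_pos hx h1
  | loop x p _ => simp [loopFree] at h

/-- What a program leaves alone is read off its text. Later framing obligations therefore reduce to
evaluating a Boolean, by `rfl` or `decide`. -/
theorem Run.frame {p : Prog} {σ σ' : Store} {t : ℕ} (h : Run p σ t σ') :
    (∀ y, p.modR y = false → σ'.reg y = σ.reg y) ∧
      ∀ b, p.modM b = false → σ'.mem b = σ.mem b := by
  induction h with
  | const x c =>
    exact ⟨fun w hw => by simp [Ne.symm (by simpa [modR] using hw)], fun _ _ => rfl⟩
  | add x y z =>
    exact ⟨fun w hw => by simp [Ne.symm (by simpa [modR] using hw)], fun _ _ => rfl⟩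
  | sub x y z =>
    exact ⟨fun w hw => by simp [Ne.symm (by simpa [modR] using hw)], fun _ _ => rfl⟩
  | load x y z =>
    exact ⟨fun w hw => by simp [Ne.symm (by simpa [modR] using hw)], fun _ _ => rfl⟩
  | store x y z =>
    exact ⟨fun _ _ => rfl, fun w hw => by simp [Ne.symm (by simpa [modM] using hw)]⟩
  | seq _ _ h1 h2 =>
    simp only [modR, modM, Bool.or_eq_false_iff]
    exact ⟨fun y hy => (h2.1 y hy.2).trans (h1.1 y hy.1),
      fun y hy => (h2.2 y hy.2).trans (h1.2 y hy.1)⟩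
  | ite_pos _ _ h1 =>
    simp only [modR, modM, Bool.or_eq_false_iff]
    exact ⟨fun y hy => h1.1 y hy.1, fun y hy => h1.2 y hy.1⟩
  | ite_zero _ _ h1 =>
    simp only [modR, modM, Bool.or_eq_false_iff]
    exact ⟨fun y hy => h1.1 y hy.2, fun y hy => h1.2 y hy.2⟩
  | loop_pos _ _ _ h1 h2 =>
    simp only [modR, modM] at h2 ⊢
    exact ⟨fun y hy => (h2.1 y hy).trans (h1.1 y hy), fun y hy => (h2.2 y hy).trans (h1.2 y hy)⟩
  | loop_zero _ => simp

/-- Started in `σ`, the program `p` halts after at most `T` steps in a store that satisfies `Q`. -/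
def Tri (p : Prog) (σ : Store) (T : ℕ) (Q : Store → Prop) : Prop :=
  ∃ t σ', Run p σ t σ' ∧ t ≤ T ∧ Q σ'

/-- `σ'` differs from `σ` only in registers and arrays that `p` writes to. -/
def Framed (p : Prog) (σ σ' : Store) : Prop :=
  (∀ y, p.modR y = false → σ'.reg y = σ.reg y) ∧ ∀ b, p.modM b = false → σ'.mem b = σ.mem b

/-- The new postcondition may use `Framed`, so facts about untouched registers and arrays need not
be part of every specification. -/
theorem Tri.mono {p : Prog} {σ : Store} {T T' : ℕ} {Q Q' : Store → Prop} (h : Tri p σ T Q)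
    (hT : T ≤ T') (hQ : ∀ σ', Framed p σ σ' → Q σ' → Q' σ') : Tri p σ T' Q' := by
  obtain ⟨t, σ', hr, ht, hq⟩ := h
  exact ⟨t, σ', hr, ht.trans hT, hQ _ hr.frame hq⟩

theorem Tri.exec {p : Prog} {σ : Store} {T : ℕ} {Q : Store → Prop} (h : p.loopFree = true)
    (hT : p.cost ≤ T) (hQ : Q (p.exec σ)) : Tri p σ T Q := by
  obtain ⟨t, ht, hr⟩ := Run.exec h σ
  exact ⟨t, _, hr, ht.trans hT, hQ⟩

theorem Tri.seq {p q : Prog} {σ : Store} {T₁ T₂ : ℕ} {Q : Store → Prop}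
    (h : Tri p σ T₁ fun σ' => Tri q σ' T₂ Q) : Tri (.seq p q) σ (T₁ + T₂) Q := by
  obtain ⟨t, σ', hr, ht, t', σ'', hr', ht', hq⟩ := h
  exact ⟨t + t', σ'', .seq hr hr', Nat.add_le_add ht ht', hq⟩

/-- Sequential composition with a loop-free first part. -/
theorem Tri.seq_exec {p q : Prog} {σ : Store} {T T₂ : ℕ} {Q : Store → Prop}
    (h : p.loopFree = true) (hq : Tri q (p.exec σ) T₂ Q) (hT : p.cost + T₂ ≤ T) :
    Tri (.seq p q) σ T Q :=
  (Tri.seq (Tri.exec h le_rfl hq)).mono hT fun _ _ h => h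

theorem Tri.ite {x : ℕ} {p q : Prog} {σ : Store} {T : ℕ} {Q : Store → Prop}
    (h₁ : σ.reg x ≠ 0 → Tri p σ T Q) (h₂ : σ.reg x = 0 → Tri q σ T Q) :
    Tri (.ite x p q) σ (T + 1) Q := by
  by_cases hx : σ.reg x = 0
  · obtain ⟨t, σ', hr, ht, hq⟩ := h₂ hx
    exact ⟨t + 1, σ', .ite_zero hx hr, by omega, hq⟩
  · obtain ⟨t, σ', hr, ht, hq⟩ := h₁ hx
    exact ⟨t + 1, σ', .ite_pos hx hr, by omega, hq⟩

/-- Amortized analysis of a loop: `γ` is a ghost state, `φ` a potential. -/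
theorem run_loop {Γ : Type} {x : ℕ} {p : Prog} (Inv : Γ → Store → Prop) (φ : Γ → ℕ)
    (hstep : ∀ γ σ, Inv γ σ → σ.reg x ≠ 0 →
      ∃ t σ' γ', Run p σ t σ' ∧ Inv γ' σ' ∧ t + 1 + φ γ' ≤ φ γ)
    (γ : Γ) (σ : Store) (h : Inv γ σ) :
    ∃ t σ' γ', Run (.loop x p) σ t σ' ∧ Inv γ' σ' ∧ σ'.reg x = 0 ∧ t + φ γ' ≤ φ γ + 1 := by
  -- Each round lowers the potential by at least its own cost plus one for the test, so the
  -- potential pays for everything but the final test.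
  induction hn : φ γ using Nat.strong_induction_on generalizing γ σ with
  | _ n ih =>
    by_cases hx : σ.reg x = 0
    · exact ⟨1, σ, γ, .loop_zero hx, h, hx, by omega⟩
    · obtain ⟨t, σ', γ', hr, hI, ht⟩ := hstep γ σ h hx
      obtain ⟨t', σ'', γ'', hr', hI', hx', ht'⟩ := ih (φ γ') (by omega) γ' σ' hI rfl
      exact ⟨t + t' + 1, σ'', γ'', .loop_pos hx hr hr', hI', hx', by omega⟩

/-- `for r < n do body`, where `r` and `n` are registers. The registers `6` and `7` are used. -/
def Prog.forLoop (r n : ℕ) (body : Prog) : Prog :=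
  .seq (.const r 0) (.seq (.sub 6 n r)
    (.loop 6 (.seq body (.seq (.const 7 1) (.seq (.add r r 7) (.sub 6 n r))))))

/-- A round costs at most `T` for the body, three steps for the counter and one for the test, whence
`T + 4`; the two initialisations and the last test make up the `3`. Register `6` holds the number of
rounds that remain. -/
theorem Tri.forLoop {r n : ℕ} {body : Prog} {σ : Store} {N T : ℕ} (Inv : ℕ → Store → Prop)
    (hn : σ.reg n = N)
    (hfr : body.modR r = false ∧ body.modR n = false ∧ r ≠ n ∧ r ≠ 6 ∧ r ≠ 7 ∧ n ≠ 6 ∧ n ≠ 7)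
    (h0 : Inv 0 ((σ.setReg r 0).setReg 6 N))
    (hstep : ∀ i σ, i < N → Inv i σ → σ.reg r = i → σ.reg n = N →
      Tri body σ T fun σ' =>
        Inv (i + 1) (((σ'.setReg 7 1).setReg r (i + 1)).setReg 6 (N - (i + 1)))) :
    Tri (.forLoop r n body) σ (N * (T + 4) + 3) (Inv N) := by
  obtain ⟨hb1, hb2, hrn, hr6, hr7, hn6, hn7⟩ := hfr
  have key := run_loop (Γ := ℕ) (x := 6)
    (p := .seq body (.seq (.const 7 1) (.seq (.add r r 7) (.sub 6 n r))))
    (fun i σ => i ≤ N ∧ Inv i σ ∧ σ.reg r = i ∧ σ.reg n = N ∧ σ.reg 6 = N - i)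
    (fun i => (N - i) * (T + 4)) (by
      rintro i σ ⟨hi, hI, hr, hn, h6⟩ hx
      have hi' : i < N := by omega
      obtain ⟨t, σ', hrun, ht, hQ⟩ := hstep i σ hi' hI hr hn
      have f1 := hrun.frame.1 r hb1
      have f2 := hrun.frame.1 n hb2
      refine ⟨t + (1 + (1 + 1)), _, i + 1, .seq hrun (.seq (.const 7 1) (.seq (.add r r 7)
        (.sub 6 n r))), ⟨hi', ?_, ?_, ?_, ?_⟩, ?_⟩
      · simpa [hrn.symm, hr7, hr6.symm, hn7, f1, f2, hr, hn] using hQ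
      · simp [hr6, hr7, f1, hr]
      · simp [hn6, hn7, hrn.symm, f2, hn]
      · simp [hn7, hrn.symm, f2, hn, hr7, f1, hr]
      · have : (N - i) * (T + 4) = (N - (i + 1)) * (T + 4) + (T + 4) := by
          rw [← Nat.succ_mul]; congr 1; omega
        omega) 0 ((σ.setReg r 0).setReg 6 N)
      (by simp [h0, hr6, hrn.symm, hn6, hn])
  obtain ⟨t, σ', i, hrun, ⟨hi, hI, _, _, h6⟩, hx, ht⟩ := key
  have hiN : i = N := by omega
  subst hiN
  refine ⟨1 + (1 + t), σ', .seq (.const r 0) (.seq ?_ hrun), ?_, hI⟩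
  · have := Run.sub (σ := σ.setReg r 0) 6 n r
    simpa [hrn.symm, hn] using this
  · simp only [Nat.sub_zero] at ht
    simp at ht
    omega

end RTC

/-! ### The game on configurations; ranks yield a controller. -/

namespace RTC

/-! ### The game of run-to-completion control -/

/-- Finite paths along `step` whose last transition satisfies `ev`. -/
inductive HitsIn {D A : Type} (step ev : D → A → D → Prop) : ℕ → D → Prop
  | now {d : D} {a : A} {d' : D} : step d a d' → ev d a d' → HitsIn step ev 0 d
  | later {d : D} {a : A} {d' : D} {k : ℕ} :
      step d a d' → HitsIn step ev k d' → HitsIn step ev (k + 1) d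

/-- If every one of finitely many events can always be brought about, then some infinite path
shows all of them infinitely often. -/
theorem exists_run_infinitely_often {D A : Type} {step : D → A → D → Prop}
    {ev : ℕ → D → A → D → Prop} {K : ℕ} (hK : 0 < K) {S : D → Prop}
    (hS : ∀ d a d', step d a d' → S d')
    (h : ∀ d, S d → ∀ o < K, ∃ k, HitsIn step (ev o) k d) {d₀ : D} (h₀ : S d₀) :
    ∃ (d : ℕ → D) (a : ℕ → A), d 0 = d₀ ∧ (∀ t, step (d t) (a t) (d (t + 1))) ∧
      ∀ o < K, ∀ t, ∃ t' ≥ t, ev o (d t') (a t') (d (t' + 1)) := by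
  -- A state carries the number of the event being pursued and the length of a path to it. The path
  -- is followed to its end, then the next event modulo `K` is taken up.
  let Z := {z : D × ℕ × ℕ // S z.1 ∧ z.2.1 < K ∧ HitsIn step (ev z.2.1) z.2.2 z.1}
  have next : ∀ z : Z, ∃ (a : A) (z' : Z), step z.1.1 a z'.1.1 ∧
      ((ev z.1.2.1 z.1.1 a z'.1.1 ∧ z'.1.2.1 = (z.1.2.1 + 1) % K) ∨
        (z.1.2.2 = z'.1.2.2 + 1 ∧ z'.1.2.1 = z.1.2.1)) := by
    rintro ⟨⟨d, o, k⟩, hd, ho, hk⟩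
    cases hk with
    | now hs he =>
      rename_i a d'
      have hlt : (o + 1) % K < K := Nat.mod_lt _ hK
      obtain ⟨k', hk'⟩ := h d' (hS _ _ _ hs) _ hlt
      exact ⟨a, ⟨(d', (o + 1) % K, k'), hS _ _ _ hs, hlt, hk'⟩, hs, Or.inl ⟨he, rfl⟩⟩
    | later hs hk' =>
      rename_i a d' k'
      exact ⟨a, ⟨(d', o, k'), hS _ _ _ hs, ho, hk'⟩, hs, Or.inr ⟨rfl, rfl⟩⟩
  choose act nxt hstep hnext using next
  obtain ⟨k₀, hk₀⟩ := h d₀ h₀ 0 hK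
  let z : ℕ → Z := fun t => nxt^[t] ⟨(d₀, 0, k₀), h₀, hK, hk₀⟩
  have hz : ∀ t, z (t + 1) = nxt (z t) := fun t => Function.iterate_succ_apply' _ _ _
  have c1 : ∀ k t, (z t).1.2.2 = k → ∃ t' ≥ t, (z t').1.2.1 = (z t).1.2.1 ∧
      ev (z t).1.2.1 (z t').1.1 (act (z t')) (z (t' + 1)).1.1 ∧
      (z (t' + 1)).1.2.1 = ((z t).1.2.1 + 1) % K := by
    intro k
    induction k with
    | zero =>
      intro t hk
      rcases hnext (z t) with ⟨h1, h2⟩ | ⟨h1, -⟩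
      · exact ⟨t, le_rfl, rfl, by rw [hz]; exact h1, by rw [hz]; exact h2⟩
      · omega
    | succ k ih =>
      intro t hk
      rcases hnext (z t) with ⟨h1, h2⟩ | ⟨h1, h2⟩
      · exact ⟨t, le_rfl, rfl, by rw [hz]; exact h1, by rw [hz]; exact h2⟩
      · rw [← hz] at h1 h2
        obtain ⟨t', ht', e1, e2, e3⟩ := ih (t + 1) (by omega)
        rw [h2] at e1 e2 e3
        exact ⟨t', by omega, e1, e2, e3⟩
  have c2 : ∀ r t, ∃ t' ≥ t, (z t').1.2.1 = ((z t).1.2.1 + r) % K := by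
    intro r
    induction r with
    | zero => exact fun t => ⟨t, le_rfl, (Nat.mod_eq_of_lt (z t).2.2.1).symm⟩
    | succ r ih =>
      intro t
      obtain ⟨t', ht', e⟩ := ih t
      obtain ⟨t'', ht'', -, -, e'⟩ := c1 _ t' rfl
      exact ⟨t'' + 1, by omega, by rw [e', e, Nat.mod_add_mod, Nat.add_assoc]⟩
  refine ⟨fun t => (z t).1.1, fun t => act (z t), rfl, fun t => ?_, fun o ho t => ?_⟩
  · simp only [hz]; exact hstep _
  · obtain ⟨t', ht', e⟩ := c2 (o + K - (z t).1.2.1) t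
    have hlt := (z t).2.2.1
    rw [show (z t).1.2.1 + (o + K - (z t).1.2.1) = o + K by omega, Nat.add_mod_right,
      Nat.mod_eq_of_lt ho] at e
    obtain ⟨t'', ht'', -, e', -⟩ := c1 _ t' rfl
    rw [e] at e'
    exact ⟨t'', by omega, e'⟩

/-- A deterministic arena with a GR(1) condition. -/
structure Arena (X A : Type) where
  /-- the transitions -/
  step : X → A → Option X
  /-- the controllable actions -/
  ctrl : A → Prop
  /-- number of assumptions -/
  n : ℕ
  /-- number of guarantees -/
  m : ℕ
  /-- safety -/
  rho : X → Prop
  /-- assumptions -/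
  as : ℕ → X → Prop
  /-- guarantees -/
  gs : ℕ → X → Prop

namespace Arena

variable {X A : Type} (G : Arena X A)

/-- No uncontrollable action is enabled. -/
def Quiet (x : X) : Prop := ∀ u y, ¬ G.ctrl u → G.step x u ≠ some y

/-- The phase after `j`. -/
def nxt (j : ℕ) : ℕ := if j < G.m then j + 1 else 0

/-- The goal of phase `j` is reached by entering `x`: a guarantee or, in the last phase, an
uncontrollable action (`b = false`) or an action from a quiet state (`pr`). -/
def GoalHit (j : ℕ) (pr : Prop) (b : Bool) (x : X) : Prop :=
  if j < G.m then G.gs j x else b = false ∨ pr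

/-- Admissible targets of a transition in phase `j` and stage `i`. -/
def Tgt (Yn Yl K : Bool → X → Prop) (j i : ℕ) (pr : Prop) (b : Bool) (x : X) : Prop :=
  G.rho x ∧ ((G.GoalHit j pr b x ∧ Yn b x) ∨ Yl b x ∨ ((i < G.n → ¬ G.as i x) ∧ K b x))

/-- The controller can wait for an uncontrollable action. -/
def Wait (T : Bool → X → Prop) (x : X) : Prop :=
  ¬ G.Quiet x ∧ ∀ u y, ¬ G.ctrl u → G.step x u = some y → T false y

/-- Ranked winning conditions: `Y j s` are the positions of rank at most `s` in phase `j`, and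
`B j s i v` those of rank `s + 1` by stage `i` that allow for fewer than `v` controllable actions
in a row. The Boolean is `false` after an uncontrollable action. -/
structure Family (P : ℕ) (Y : ℕ → ℕ → Bool → X → Prop)
    (B : ℕ → ℕ → ℕ → ℕ → Bool → X → Prop) : Prop where
  Y_zero : ∀ j ≤ G.m, ∀ b x, ¬ Y j 0 b x
  Y_succ : ∀ j ≤ G.m, ∀ s < P, ∀ b x, Y j (s + 1) b x →
    Y j s b x ∨ ∃ i ≤ G.n, B j s i P b x
  B_zero : ∀ j ≤ G.m, ∀ s < P, ∀ i ≤ G.n, ∀ b x, ¬ B j s i 0 b x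
  B_succ : ∀ j ≤ G.m, ∀ s < P, ∀ i < G.n, ∀ v < P, ∀ b x, B j s i (v + 1) b x →
    G.Wait (G.Tgt (Y (G.nxt j) P) (Y j s) (B j s i P) j i True) x ∨
    ∃ c y, G.ctrl c ∧ G.step x c = some y ∧
      ((G.Quiet x ∧ G.Tgt (Y (G.nxt j) P) (Y j s) (B j s i P) j i True true y) ∨
        (¬ G.Quiet x ∧ b = true ∧ G.Tgt (Y (G.nxt j) P) (Y j s) (B j s i v) j i False true y))
  -- The last stage stands for the assumption ψ_e. The controller waits and also offers a
  -- controllable action; taking it fulfils the event of ψ_e, so the move must make progress and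
  -- cannot stay in the stage.
  B_last : ∀ j ≤ G.m, ∀ s < P, ∀ v < P, ∀ b x, B j s G.n (v + 1) b x →
    G.Wait (G.Tgt (Y (G.nxt j) P) (Y j s) (B j s G.n P) j G.n True) x ∧
    ∃ c y, G.ctrl c ∧ G.step x c = some y ∧
      G.Tgt (Y (G.nxt j) P) (Y j s) (fun _ _ => False) j G.n False true y

variable {G}

theorem Tgt.mono {Yn Yl K Yn' Yl' K' : Bool → X → Prop} {j i : ℕ} {pr pr' : Prop} {b : Bool}
    {x : X} (h : G.Tgt Yn Yl K j i pr b x) (h1 : ∀ b x, Yn b x → Yn' b x)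
    (h2 : ∀ b x, Yl b x → Yl' b x) (h3 : ∀ b x, K b x → K' b x) (h4 : pr → pr') :
    G.Tgt Yn' Yl' K' j i pr' b x := by
  refine ⟨h.1, ?_⟩
  rcases h.2 with ⟨hg, h⟩ | h | ⟨ha, h⟩
  · refine Or.inl ⟨?_, h1 _ _ h⟩
    unfold GoalHit at hg ⊢
    split_ifs at hg ⊢ with hj
    · exact hg
    · exact hg.imp id h4
  · exact Or.inr (Or.inl (h2 _ _ h))
  · exact Or.inr (Or.inr ⟨ha, h3 _ _ h⟩)

theorem Wait.mono {T T' : Bool → X → Prop} {x : X} (h : G.Wait T x)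
    (h' : ∀ b x, T b x → T' b x) : G.Wait T' x :=
  ⟨h.1, fun u y hu hy => h' _ _ (h.2 u y hu hy)⟩

/-- The infinite sequence of positions `x` and actions `a` satisfies the winning condition, where
`off t` says that the controller offers a controllable action at time `t`. -/
def WinningRun (G : Arena X A) (x : ℕ → X) (a : ℕ → A) (off : ℕ → Prop) : Prop :=
  (∀ t, ∃ t' ≥ t, ¬ G.ctrl (a t') ∨ G.Quiet (x t')) ∧
    ((∀ t, ∃ t' ≥ t, G.ctrl (a t') ∨ ¬ off t') →
      (∀ t, G.rho (x (t + 1))) ∧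
        ((∀ i < G.n, ∀ t, ∃ t' ≥ t, G.as i (x (t' + 1))) →
          ∀ j < G.m, ∀ t, ∃ t' ≥ t, G.gs j (x (t' + 1))))

/-! #### From ranks to a controller -/

section Strategy

variable {P : ℕ} {Y : ℕ → ℕ → Bool → X → Prop} {B : ℕ → ℕ → ℕ → ℕ → Bool → X → Prop}

/-- The states of the controller that plays according to the ranks. -/
@[ext]
structure Mem (G : Arena X A) (P : ℕ) (B : ℕ → ℕ → ℕ → ℕ → Bool → X → Prop) where
  x : X
  b : Bool
  j : ℕ
  s : ℕ
  i : ℕ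
  v : ℕ
  hj : j ≤ G.m
  hs : s < P
  hi : i ≤ G.n
  hv : v ≤ P
  hB : B j s i v b x

theorem finite_mem [Finite X] : Finite (Mem G P B) := by
  let f : Mem G P B → X × Bool × Fin (G.m + 1) × Fin P × Fin (G.n + 1) × Fin (P + 1) :=
    fun q => (q.x, q.b, ⟨q.j, Nat.lt_succ_of_le q.hj⟩, ⟨q.s, q.hs⟩,
      ⟨q.i, Nat.lt_succ_of_le q.hi⟩, ⟨q.v, Nat.lt_succ_of_le q.hv⟩)
  refine Finite.of_injective f fun q q' h => ?_
  simp only [f, Prod.mk.injEq, Fin.mk.injEq] at h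
  exact Mem.ext h.1 h.2.1 h.2.2.1 h.2.2.2.1 h.2.2.2.2.1 h.2.2.2.2.2

/-- The moves to `q'` that are in accordance with the ranks. -/
def Res (G : Arena X A) (P : ℕ) (B : ℕ → ℕ → ℕ → ℕ → Bool → X → Prop)
    (j s i v : ℕ) (pr : Prop) (q' : Mem G P B) : Prop :=
  G.rho q'.x ∧ ((G.GoalHit j pr q'.b q'.x ∧ q'.j = G.nxt j) ∨ (q'.j = j ∧ q'.s < s) ∨
    ((i < G.n → ¬ G.as i q'.x) ∧ q'.j = j ∧ q'.s = s ∧ q'.i = i ∧ q'.v = v))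

/-- The controller waits in the state `q`. -/
def WaitAt (Y : ℕ → ℕ → Bool → X → Prop) (q : Mem G P B) : Prop :=
  G.Wait (G.Tgt (Y (G.nxt q.j) P) (Y q.j q.s) (B q.j q.s q.i P) q.j q.i True) q.x

/-- The transitions of the controller. -/
def tr (Y : ℕ → ℕ → Bool → X → Prop) (q : Mem G P B) (a : A) (q' : Mem G P B) : Prop :=
  G.step q.x a = some q'.x ∧
    ((¬ G.ctrl a ∧ q'.b = false ∧ WaitAt Y q ∧ Res G P B q.j q.s q.i P True q') ∨
      (G.ctrl a ∧ q'.b = true ∧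
        ((q.i = G.n ∧ Res G P B q.j q.s q.i 0 False q') ∨
          (q.i < G.n ∧ ¬ WaitAt Y q ∧
            ((G.Quiet q.x ∧ Res G P B q.j q.s q.i P True q') ∨
              (¬ G.Quiet q.x ∧ q.b = true ∧ Res G P B q.j q.s q.i (q.v - 1) False q'))))))

theorem nxt_le {j : ℕ} : G.nxt j ≤ G.m := by
  unfold nxt; split_ifs <;> omega

/-- Descending from rank `s`, the position must leave the family before rank `0`, and there it has
been won by a stage. -/
theorem Family.exists_rank (F : G.Family P Y B) {j s : ℕ} (hj : j ≤ G.m) (hs : s ≤ P) {b : Bool}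
    {x : X} (h : Y j s b x) : ∃ s' < s, ∃ i ≤ G.n, B j s' i P b x := by
  induction s with
  | zero => exact absurd h (F.Y_zero j hj b x)
  | succ s ih =>
    rcases F.Y_succ j hj s (by omega) b x h with h | ⟨i, hi, h⟩
    · obtain ⟨s', h1, h2⟩ := ih (by omega) h
      exact ⟨s', by omega, h2⟩
    · exact ⟨s, by omega, i, hi, h⟩

/-- The three kinds of admissible targets become updates of the memory: the next phase, a lower
rank, or the same stage. The counter is refilled to `P` in the first two cases and set to `v` in the
third. -/
theorem Family.exists_res (F : G.Family P Y B) {j s i v : ℕ} (hj : j ≤ G.m) (hs : s < P)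
    (hi : i ≤ G.n) (hv : v ≤ P) {K : Bool → X → Prop} (hK : ∀ b x, K b x → B j s i v b x)
    {b : Bool} {x : X} {pr : Prop}
    (h : G.Tgt (Y (G.nxt j) P) (Y j s) K j i pr b x) :
    ∃ q' : Mem G P B, q'.x = x ∧ q'.b = b ∧ Res G P B j s i v pr q' := by
  obtain ⟨hr, ⟨hg, h⟩ | h | ⟨ha, h⟩⟩ := h
  · obtain ⟨s', hs', i', hi', h⟩ := F.exists_rank nxt_le le_rfl h
    exact ⟨⟨x, b, G.nxt j, s', i', P, nxt_le, hs', hi', le_rfl, h⟩, rfl, rfl, hr,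
      Or.inl ⟨hg, rfl⟩⟩
  · obtain ⟨s', hs', i', hi', h⟩ := F.exists_rank hj hs.le h
    exact ⟨⟨x, b, j, s', i', P, hj, hs'.trans hs, hi', le_rfl, h⟩, rfl, rfl, hr,
      Or.inr (Or.inl ⟨rfl, hs'⟩)⟩
  · exact ⟨⟨x, b, j, s, i, v, hj, hs, hi, hv, hK _ _ h⟩, rfl, rfl, hr,
      Or.inr (Or.inr ⟨ha, rfl, rfl, rfl, rfl⟩)⟩

theorem Family.v_pos (F : G.Family P Y B) (q : Mem G P B) : 0 < q.v := by
  rcases Nat.eq_zero_or_pos q.v with h | h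
  · exact absurd (h ▸ q.hB) (F.B_zero _ q.hj _ q.hs _ q.hi _ _)
  · exact h

/-- In the last stage a controllable action is always on offer. This refutes the alternative of ψ_e
that nothing is offered. -/
theorem Family.waitAt_of_last (F : G.Family P Y B) (q : Mem G P B) (h : q.i = G.n) :
    WaitAt Y q ∧ ∃ c q', G.ctrl c ∧ tr Y q c q' := by
  obtain ⟨v, hv⟩ : ∃ v, q.v = v + 1 := ⟨q.v - 1, by have := F.v_pos q; omega⟩
  have hB := q.hB
  rw [hv, h] at hB
  obtain ⟨hw, c, y, hc, hy, ht⟩ := F.B_last _ q.hj _ q.hs v (by have := q.hv; omega) _ _ hB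
  refine ⟨by unfold WaitAt; rw [h]; exact hw, c, ?_⟩
  obtain ⟨q', rfl, hb, hr⟩ := F.exists_res (v := 0) q.hj q.hs le_rfl (Nat.zero_le _)
    (fun _ _ h => h.elim) ht
  exact ⟨q', hc, hy, Or.inr ⟨hc, hb, Or.inl ⟨h, h ▸ hr⟩⟩⟩

theorem Family.tr_of_waitAt (F : G.Family P Y B) {q : Mem G P B} (h : WaitAt Y q) {u : A} {y : X}
    (hu : ¬ G.ctrl u) (hy : G.step q.x u = some y) : ∃ q', tr Y q u q' := by
  obtain ⟨q', rfl, hb, hr⟩ := F.exists_res (v := P) q.hj q.hs q.hi le_rfl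
    (fun _ _ h => h) (h.2 u y hu hy)
  exact ⟨q', hy, Or.inl ⟨hu, hb, h, hr⟩⟩

/-- The first conjunct is what legality needs: a controller that refuses enabled uncontrollable
actions was not entered by an uncontrollable one. -/
theorem Family.exists_tr_of_not_waitAt (F : G.Family P Y B) {q : Mem G P B} (h : ¬ WaitAt Y q) :
    (G.Quiet q.x ∨ q.b = true) ∧ ∃ c q', tr Y q c q' := by
  have hi : q.i < G.n := lt_of_le_of_ne q.hi fun e => h (F.waitAt_of_last q e).1
  obtain ⟨v, hv⟩ : ∃ v, q.v = v + 1 := ⟨q.v - 1, by have := F.v_pos q; omega⟩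
  have hvP : v < P := by have := q.hv; omega
  have hB := q.hB
  rw [hv] at hB
  rcases F.B_succ _ q.hj _ q.hs _ hi v hvP _ _ hB with hw | ⟨c, y, hc, hy, ⟨hq, ht⟩ | ⟨hq, hb, ht⟩⟩
  · exact absurd hw h
  · obtain ⟨q', rfl, hb, hr⟩ := F.exists_res (v := P) q.hj q.hs q.hi le_rfl
      (fun _ _ h => h) ht
    exact ⟨Or.inl hq, c, q', hy, Or.inr ⟨hc, hb, Or.inr ⟨hi, h, Or.inl ⟨hq, hr⟩⟩⟩⟩
  · obtain ⟨q', rfl, hb', hr⟩ := F.exists_res (v := v) q.hj q.hs q.hi hvP.le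
      (fun _ _ h => h) ht
    refine ⟨Or.inr hb, c, q', hy, Or.inr ⟨hc, hb', Or.inr ⟨hi, h, Or.inr ⟨hq, hb, ?_⟩⟩⟩⟩
    rwa [hv, Nat.add_sub_cancel]

theorem Family.exists_tr (F : G.Family P Y B) (q : Mem G P B) : ∃ a q', tr Y q a q' := by
  by_cases h : WaitAt Y q
  · obtain ⟨u, y, hu, hy⟩ : ∃ u y, ¬ G.ctrl u ∧ G.step q.x u = some y := by
      have := h.1
      simp only [Quiet] at this
      push Not at this
      exact this
    obtain ⟨q', h⟩ := F.tr_of_waitAt h hu hy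
    exact ⟨u, q', h⟩
  · exact (F.exists_tr_of_not_waitAt h).2

theorem tr.rho {q : Mem G P B} {a : A} {q' : Mem G P B} (h : tr Y q a q') : G.rho q'.x := by
  rcases h.2 with ⟨-, -, -, h⟩ | ⟨-, -, ⟨-, h⟩ | ⟨-, -, ⟨-, h⟩ | ⟨-, -, h⟩⟩⟩ <;> exact h.1

/-- A sequence of natural numbers that never increases is eventually constant. -/
theorem eventually_const_of_antitone {f : ℕ → ℕ} {t₀ : ℕ} (h : ∀ t ≥ t₀, f (t + 1) ≤ f t) :
    ∃ t₁ ≥ t₀, ∀ t ≥ t₁, f t = f t₁ := by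
  obtain ⟨t₁, h1, h2⟩ : ∃ t₁ ≥ t₀, ∀ t ≥ t₀, f t₁ ≤ f t := by
    have hne : ∃ k, ∃ t ≥ t₀, f t = k := ⟨_, t₀, le_rfl, rfl⟩
    classical
    obtain ⟨t₁, h1, h2⟩ := Nat.find_spec hne
    exact ⟨t₁, h1, fun t ht => h2 ▸ Nat.find_min' hne ⟨t, ht, rfl⟩⟩
  refine ⟨t₁, h1, fun t ht => ?_⟩
  induction t, ht using Nat.le_induction with
  | base => rfl
  | succ t ht ih => exact le_antisymm ((h t (by omega)).trans ih.le) (h2 _ (by omega))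

/-- Both halves are descent arguments. If ψ_c failed, eventually every action would be controllable
and taken at a state that is not quiet, and then phase, rank and counter cannot all go on changing.
If a guarantee is missed from some time on, the cyclic distance to its phase never grows, hence it
freezes, then the rank, then the stage; the stage that remains contradicts an assumption or ψ_e. -/
theorem Family.winningRun (F : G.Family P Y B) {q : ℕ → Mem G P B} {a : ℕ → A}
    (h : ∀ t, tr Y (q t) (a t) (q (t + 1))) :
    G.WinningRun (fun t => (q t).x) a (fun t => ∃ c q', G.ctrl c ∧ tr Y (q t) c q') := by
  constructor
  · by_contra hcon
    push Not at hcon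
    obtain ⟨t₀, ht₀⟩ := hcon
    -- After `t₀` the goal of the last phase is out of reach, so the phase never wraps around. It
    -- grows, or the pair of rank and counter drops lexicographically.
    have key : ∀ t ≥ t₀, (q (t + 1)).j = (q t).j + 1 ∨
        ((q (t + 1)).j = (q t).j ∧ ((q (t + 1)).s < (q t).s ∨
          ((q (t + 1)).s = (q t).s ∧ (q (t + 1)).v < (q t).v))) := by
      intro t ht
      obtain ⟨hc, hq⟩ := ht₀ t ht
      have res : ∃ v < (q t).v, Res G P B (q t).j (q t).s (q t).i v False (q (t + 1)) := by
        have hv := F.v_pos (q t)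
        rcases (h t).2 with ⟨hu, -⟩ | ⟨-, -, ⟨-, h⟩ | ⟨-, -, ⟨hq', -⟩ | ⟨-, -, h⟩⟩⟩
        · exact absurd hc hu
        · exact ⟨0, hv, h⟩
        · exact absurd hq' hq
        · exact ⟨_, Nat.sub_lt hv Nat.one_pos, h⟩
      have hb : (q (t + 1)).b = true := by
        rcases (h t).2 with ⟨hu, -⟩ | ⟨-, hb, -⟩
        · exact absurd hc hu
        · exact hb
      obtain ⟨v, hv, -, ⟨hg, hj⟩ | h | ⟨-, hj, hs, -, hv'⟩⟩ := res
      · unfold GoalHit at hg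
        unfold nxt at hj
        split_ifs at hg hj with hm
        · exact Or.inl hj
        · simp [hb] at hg
      · exact Or.inr ⟨h.1, Or.inl h.2⟩
      · exact Or.inr ⟨hj, Or.inr ⟨hs, by omega⟩⟩
    obtain ⟨t₁, h1, c1⟩ := eventually_const_of_antitone (f := fun t => G.m - (q t).j) (t₀ := t₀)
      (fun t ht => by rcases key t ht with h | ⟨h, -⟩ <;> omega)
    have j1 : ∀ t ≥ t₁, (q (t + 1)).j = (q t).j := by
      intro t ht
      have e1 := c1 t ht
      have e2 := c1 (t + 1) (by omega)
      have := (q t).hj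
      have := (q (t + 1)).hj
      rcases key t (by omega) with h | ⟨h, -⟩ <;> omega
    obtain ⟨t₂, h2, c2⟩ := eventually_const_of_antitone (f := fun t => (q t).s) (t₀ := t₁)
      (fun t ht => by have := j1 t ht; rcases key t (by omega) with h | ⟨-, h | h⟩ <;> omega)
    obtain ⟨t₃, h3, c3⟩ := eventually_const_of_antitone (f := fun t => (q t).v) (t₀ := t₂)
      (fun t ht => by
        have := j1 t (by omega)
        have e1 := c2 t ht
        have e2 := c2 (t + 1) (by omega)
        rcases key t (by omega) with h | ⟨-, h | h⟩ <;> omega)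
    have := j1 t₃ (by omega)
    have e1 := c2 t₃ h3
    have e2 := c2 (t₃ + 1) (by omega)
    have e3 := c3 (t₃ + 1) (by omega)
    rcases key t₃ (by omega) with h | ⟨-, h | h⟩ <;> omega
  · refine fun hE => ⟨fun t => (h t).rho, fun hA J hJ => ?_⟩
    by_contra hcon
    push Not at hcon
    obtain ⟨t₀, ht₀⟩ := hcon
    -- The number of phase changes until phase `J`, cyclically among `m + 1` phases.
    let dist : ℕ → ℕ := fun j => if j ≤ J then J - j else G.m + 1 + J - j
    have key : ∀ t ≥ t₀, dist (q (t + 1)).j < dist (q t).j ∨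
        ((q (t + 1)).j = (q t).j ∧ ((q (t + 1)).s < (q t).s ∨
          ((q (t + 1)).s = (q t).s ∧ (q (t + 1)).i = (q t).i ∧
            ((q t).i < G.n → ¬ G.as (q t).i (q (t + 1)).x) ∧
            ((q t).i = G.n → ¬ G.ctrl (a t))))) := by
      intro t ht
      have res : ∃ v pr, Res G P B (q t).j (q t).s (q t).i v pr (q (t + 1)) ∧
          ((q t).i = G.n → G.ctrl (a t) → v = 0) := by
        rcases (h t).2 with ⟨hu, -, -, h⟩ | ⟨-, -, ⟨-, h⟩ | ⟨hi, -, ⟨hq', h⟩ | ⟨-, -, h⟩⟩⟩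
        · exact ⟨_, _, h, fun _ hc => absurd hc hu⟩
        · exact ⟨_, _, h, fun _ _ => rfl⟩
        · exact ⟨_, _, h, fun e _ => absurd e hi.ne⟩
        · exact ⟨_, _, h, fun e _ => absurd e hi.ne⟩
      obtain ⟨v, pr, ⟨-, ⟨hg, hj⟩ | h | ⟨ha, hj, hs, hi, hv⟩⟩, hv0⟩ := res
      · left
        have hne : (q t).j ≠ J := by
          intro e
          rw [GoalHit, e, if_pos hJ] at hg
          exact ht₀ t ht hg
        have := (q t).hj
        unfold nxt at hj
        simp only [dist, hj]
        split_ifs <;> omega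
      · exact Or.inr ⟨h.1, Or.inl h.2⟩
      -- A controllable move that stays in the last stage would leave the counter at `0`, and no
      -- memory state has an empty counter.
      · refine Or.inr ⟨hj, Or.inr ⟨hs, hi, ha, fun e hc => ?_⟩⟩
        have := F.v_pos (q (t + 1))
        have := hv0 e hc
        omega
    obtain ⟨t₁, h1, c1⟩ := eventually_const_of_antitone (f := fun t => dist (q t).j) (t₀ := t₀)
      (fun t ht => by
        rcases key t ht with h | ⟨h, -⟩
        · exact h.le
        · simp only [h]; exact le_rfl)
    have k1 : ∀ t ≥ t₁, _ := fun t ht => (key t (by omega)).resolve_left (by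
      have e1 := c1 t ht
      have e2 := c1 (t + 1) (by omega)
      omega)
    obtain ⟨t₂, h2, c2⟩ := eventually_const_of_antitone (f := fun t => (q t).s) (t₀ := t₁)
      (fun t ht => by rcases k1 t ht with ⟨-, h | h⟩ <;> omega)
    have k2 : ∀ t ≥ t₂, _ := fun t ht => (k1 t (by omega)).2.resolve_left (by
      have e1 := c2 t ht
      have e2 := c2 (t + 1) (by omega)
      omega)
    have hi : ∀ t ≥ t₂, (q t).i = (q t₂).i := by
      intro t ht
      induction t, ht using Nat.le_induction with
      | base => rfl
      | succ t ht ih => rw [(k2 t ht).2.1, ih]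
    -- With the stage fixed at `i < n`, assumption `i` never holds again. With `i = n`, no
    -- controllable action is ever taken although one is always offered.
    rcases lt_or_eq_of_le (q t₂).hi with hn | hn
    · obtain ⟨t, ht, ha⟩ := hA _ hn t₂
      have := (k2 t ht).2.2.1
      rw [hi t ht] at this
      exact this hn ha
    · obtain ⟨t, ht, ha⟩ := hE t₂
      have hit : (q t).i = G.n := (hi t ht).trans hn
      rcases ha with ha | ha
      · exact (k2 t ht).2.2.2 hit ha
      · exact ha (F.waitAt_of_last _ hit).2

/-- Ranked winning conditions provide a finite-state controller. -/
theorem Family.exists_controller [Finite X] (F : G.Family P Y B) {x₀ : X}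
    (h₀ : Y 0 P true x₀) :
    ∃ (Q : Type) (_ : Finite Q) (st : Q → X) (tr : Q → A → Q → Prop) (q₀ : Q),
      st q₀ = x₀ ∧ (∀ q a q', tr q a q' → G.step (st q) a = some (st q')) ∧
      (∀ q, ((∃ u q', ¬ G.ctrl u ∧ tr q u q') ∨ (∃ u q', ¬ G.ctrl u ∧ tr q' u q)) →
        ∀ u y, ¬ G.ctrl u → G.step (st q) u = some y → ∃ q', tr q u q') ∧
      (∀ q, ∃ a q', tr q a q') ∧
      ∀ (q : ℕ → Q) (a : ℕ → A), (∀ t, tr (q t) (a t) (q (t + 1))) →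
        G.WinningRun (fun t => st (q t)) a (fun t => ∃ c q', G.ctrl c ∧ tr (q t) c q') := by
  obtain ⟨s, hs, i, hi, hB⟩ := F.exists_rank (Nat.zero_le _) le_rfl h₀
  refine ⟨Mem G P B, finite_mem, Mem.x, tr Y,
    ⟨x₀, true, 0, s, i, P, Nat.zero_le _, hs, hi, le_rfl, hB⟩, rfl, fun q a q' h => h.1, ?_,
    F.exists_tr, fun q a h => F.winningRun h⟩
  intro q hq u y hu hy
  -- The controller waits either because it admits an uncontrollable action, or because it was
  -- entered by one: then `b = false`, which is only compatible with not waiting in a quiet state.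
  have hw : WaitAt Y q := by
    rcases hq with ⟨u', q', hu', h⟩ | ⟨u', q', hu', h⟩
    · rcases h.2 with ⟨-, -, hw, -⟩ | ⟨hc, -⟩
      · exact hw
      · exact absurd hc hu'
    · by_contra hw
      have hb : q.b = false := by
        rcases h.2 with ⟨-, hb, -⟩ | ⟨hc, -⟩
        · exact hb
        · exact absurd hc hu'
      rcases (F.exists_tr_of_not_waitAt hw).1 with h | h
      · exact h u y hu hy
      · simp [hb] at h
  exact F.tr_of_waitAt hw hu hy

end Strategy

end Arena

end RTC

/-! ### A winning controller yields ranks. -/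

namespace RTC

namespace Arena

/-! #### From a controller to ranks -/

/-- An increasing iteration on a finite type of cardinality `k` is stationary after `k` steps. -/
theorem iterate_card_stationary {α : Type} [Finite α] {f : Set α → Set α} {u : ℕ → Set α}
    (hu : ∀ k, u (k + 1) = f (u k)) (hm : ∀ k, u k ⊆ u (k + 1)) :
    f (u (Nat.card α)) = u (Nat.card α) := by
  have hst : ∀ k, u (k + 1) = u k → ∀ l ≥ k, u (l + 1) = u l := by
    intro k hk l hl
    induction l, hl using Nat.le_induction with
    | base => exact hk
    | succ l _ ih =>
      calc u (l + 1 + 1) = f (u (l + 1)) := hu _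
        _ = f (u l) := by rw [ih]
        _ = u (l + 1) := (hu l).symm
  by_contra hcon
  have hne : ∀ k ≤ Nat.card α, u (k + 1) ≠ u k := by
    intro k hk h
    exact hcon ((hu _).symm.trans (hst k h _ hk))
  have hcard : ∀ k ≤ Nat.card α + 1, k ≤ (u k).ncard := by
    intro k
    induction k with
    | zero => simp
    | succ k ih =>
      intro hk
      have h1 := ih (by omega)
      have h2 : (u k).ncard < (u (k + 1)).ncard :=
        Set.ncard_lt_ncard ((hm k).ssubset_of_ne (hne k (by omega)).symm) (Set.toFinite _)
      omega
  have h1 := hcard _ le_rfl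
  have h2 := Set.ncard_le_ncard (Set.subset_univ (u (Nat.card α + 1))) (Set.toFinite _)
  rw [Set.ncard_univ] at h2
  omega

variable {X A : Type} (G : Arena X A)

/-- The positions from which the controller can, in phase `j` and stage `i`, move to `R` by
reaching the goal, to `Y`, to `K`, or by a controllable action to `V`. -/
def Psi (R : Set (Bool × X)) (j i : ℕ) (Y K V : Set (Bool × X)) : Set (Bool × X) :=
  {p | (i < G.n ∧
      (G.Wait (G.Tgt (fun b x => (b, x) ∈ R) (fun b x => (b, x) ∈ Y) (fun b x => (b, x) ∈ K)
        j i True) p.2 ∨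
      ∃ c y, G.ctrl c ∧ G.step p.2 c = some y ∧
        ((G.Quiet p.2 ∧ G.Tgt (fun b x => (b, x) ∈ R) (fun b x => (b, x) ∈ Y)
            (fun b x => (b, x) ∈ K) j i True true y) ∨
          (¬ G.Quiet p.2 ∧ p.1 = true ∧ G.Tgt (fun b x => (b, x) ∈ R) (fun b x => (b, x) ∈ Y)
            (fun b x => (b, x) ∈ V) j i False true y)))) ∨
    (i = G.n ∧
      G.Wait (G.Tgt (fun b x => (b, x) ∈ R) (fun b x => (b, x) ∈ Y) (fun b x => (b, x) ∈ K)
        j i True) p.2 ∧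
      ∃ c y, G.ctrl c ∧ G.step p.2 c = some y ∧
        G.Tgt (fun b x => (b, x) ∈ R) (fun b x => (b, x) ∈ Y) (fun _ _ => False)
          j i False true y)}

variable {G}

theorem Psi.mono {R : Set (Bool × X)} {j i : ℕ} {Y K V K' V' : Set (Bool × X)}
    (hK : K ⊆ K') (hV : V ⊆ V') : G.Psi R j i Y K V ⊆ G.Psi R j i Y K' V' := by
  have hK' : ∀ b x, (b, x) ∈ K → (b, x) ∈ K' := fun b x h => hK h
  have hV' : ∀ b x, (b, x) ∈ V → (b, x) ∈ V' := fun b x h => hV h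
  have m1 : ∀ pr b x, G.Tgt (fun b x => (b, x) ∈ R) (fun b x => (b, x) ∈ Y)
      (fun b x => (b, x) ∈ K) j i pr b x → G.Tgt (fun b x => (b, x) ∈ R)
      (fun b x => (b, x) ∈ Y) (fun b x => (b, x) ∈ K') j i pr b x :=
    fun pr b x h => h.mono (fun _ _ h => h) (fun _ _ h => h) hK' id
  rintro p (⟨hi, h | ⟨c, y, hc, hy, ⟨hq, h⟩ | ⟨hq, hb, h⟩⟩⟩ | ⟨hi, hw, h⟩)
  · exact Or.inl ⟨hi, Or.inl (h.mono (m1 _))⟩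
  · exact Or.inl ⟨hi, Or.inr ⟨c, y, hc, hy, Or.inl ⟨hq, m1 _ _ _ h⟩⟩⟩
  · exact Or.inl ⟨hi, Or.inr ⟨c, y, hc, hy, Or.inr ⟨hq, hb,
      h.mono (fun _ _ h => h) (fun _ _ h => h) hV' id⟩⟩⟩
  · exact Or.inr ⟨hi, hw.mono (m1 _), h⟩

/-- Iteration of `Psi` in its last argument. -/
def psiIter (G : Arena X A) (R : Set (Bool × X)) (j i : ℕ) (Y K : Set (Bool × X)) (v : ℕ) :
    Set (Bool × X) :=
  (G.Psi R j i Y K)^[v] ∅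

theorem psiIter_succ (R : Set (Bool × X)) (j i : ℕ) (Y K : Set (Bool × X)) (v : ℕ) :
    psiIter G R j i Y K (v + 1) = G.Psi R j i Y K (psiIter G R j i Y K v) :=
  Function.iterate_succ_apply' _ _ _

theorem psiIter_mono (R : Set (Bool × X)) (j i : ℕ) (Y : Set (Bool × X)) {K K' : Set (Bool × X)}
    (h : K ⊆ K') (v : ℕ) : psiIter G R j i Y K v ⊆ psiIter G R j i Y K' v := by
  induction v with
  | zero => exact subset_rfl
  | succ v ih => rw [psiIter_succ, psiIter_succ]; exact Psi.mono h ih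

theorem psiIter_subset_succ (R : Set (Bool × X)) (j i : ℕ) (Y K : Set (Bool × X)) (v : ℕ) :
    psiIter G R j i Y K v ⊆ psiIter G R j i Y K (v + 1) := by
  induction v with
  | zero => exact Set.empty_subset _
  | succ v ih =>
    calc psiIter G R j i Y K (v + 1) = G.Psi R j i Y K (psiIter G R j i Y K v) := psiIter_succ ..
      _ ⊆ G.Psi R j i Y K (psiIter G R j i Y K (v + 1)) := Psi.mono subset_rfl ih
      _ = _ := (psiIter_succ ..).symm

/-- The positions won by stage `i` in phase `j`. -/
def stage (G : Arena X A) (R : Set (Bool × X)) (j i : ℕ) (Y : Set (Bool × X)) :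
    Set (Bool × X) :=
  ⋃₀ {K | K ⊆ psiIter G R j i Y K (Nat.card (Bool × X))}

/-- The Knaster–Tarski argument: a union of post-fixed points of a monotone operator is a post-fixed
point. -/
theorem stage_subset (R : Set (Bool × X)) (j i : ℕ) (Y : Set (Bool × X)) :
    stage G R j i Y ⊆ psiIter G R j i Y (stage G R j i Y) (Nat.card (Bool × X)) :=
  Set.sUnion_subset fun K hK => (show K ⊆ _ from hK).trans
    (psiIter_mono R j i Y (Set.subset_sUnion_of_mem hK) _)

/-- The positions of rank at most `s` in phase `j`. -/
def ranked (G : Arena X A) (R : Set (Bool × X)) (j : ℕ) : ℕ → Set (Bool × X)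
  | 0 => ∅
  | s + 1 => ranked G R j s ∪ ⋃ i ≤ G.n, stage G R j i (ranked G R j s)

/-- After as many steps as there are positions the ranks are stationary, so a further stage adds
nothing to the top rank. -/
theorem stage_ranked_subset [Finite X] (R : Set (Bool × X)) (j i : ℕ) (hi : i ≤ G.n) :
    stage G R j i (ranked G R j (Nat.card (Bool × X))) ⊆ ranked G R j (Nat.card (Bool × X)) := by
  have h := iterate_card_stationary (u := ranked G R j)
    (f := fun Y => Y ∪ ⋃ i ≤ G.n, stage G R j i Y) (fun _ => rfl)
    (fun _ => Set.subset_union_left)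
  intro p hp
  rw [← h]
  exact Or.inr (Set.mem_biUnion (s := {i | i ≤ G.n}) (t := fun i => stage G R j i _) hi hp)

theorem psiIter_stationary [Finite X] (R : Set (Bool × X)) (j i : ℕ) (Y K : Set (Bool × X)) :
    G.Psi R j i Y K (psiIter G R j i Y K (Nat.card (Bool × X))) =
      psiIter G R j i Y K (Nat.card (Bool × X)) :=
  iterate_card_stationary (psiIter_succ R j i Y K) (psiIter_subset_succ R j i Y K)

/-- In the last stage a controllable move cannot stay, so the inner iteration needs just one step.
-/
theorem subset_stage_of_last [Finite X] {R : Set (Bool × X)} {j : ℕ} {Y K : Set (Bool × X)}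
    (h : K ⊆ G.Psi R j G.n Y K ∅) : K ⊆ stage G R j G.n Y := by
  refine Set.subset_sUnion_of_mem ?_
  change K ⊆ _
  rw [← psiIter_stationary]
  exact h.trans (Psi.mono subset_rfl (Set.empty_subset _))

/-- The proof rule for stages: coinduction in `K`, and induction over the counter in the form of an
arbitrary closed set `V`. -/
theorem subset_stage [Finite X] {R : Set (Bool × X)} {j i : ℕ} {Y K : Set (Bool × X)}
    (h : ∀ V, G.Psi R j i Y K V ⊆ V → K ⊆ V) : K ⊆ stage G R j i Y :=
  Set.subset_sUnion_of_mem (h _ (psiIter_stationary R j i Y K).subset)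

/-- The set `R` plays the part of the outer greatest fixed point. Being contained in the top rank of
every phase makes it a legitimate guess, and it may then be replaced by the top rank of the next
phase. -/
theorem family_of_subset [Finite X] [Nonempty X] {R : Set (Bool × X)}
    (h : ∀ j ≤ G.m, R ⊆ ranked G R j (Nat.card (Bool × X))) :
    G.Family (Nat.card (Bool × X)) (fun j s b x => (b, x) ∈ ranked G R j s)
      (fun j s i v b x => (b, x) ∈
        psiIter G R j i (ranked G R j s) (stage G R j i (ranked G R j s)) v) := by
  have m1 : ∀ (j s i : ℕ) b x,
      G.Tgt (fun b x => (b, x) ∈ R) (fun b x => (b, x) ∈ ranked G R j s)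
        (fun b x => (b, x) ∈ stage G R j i (ranked G R j s)) j i True b x →
      G.Tgt (fun b x => (b, x) ∈ ranked G R (G.nxt j) (Nat.card (Bool × X)))
        (fun b x => (b, x) ∈ ranked G R j s)
        (fun b x => (b, x) ∈ psiIter G R j i (ranked G R j s)
          (stage G R j i (ranked G R j s)) (Nat.card (Bool × X))) j i True b x :=
    fun j s i b x hx => hx.mono (fun _ _ hb => h _ nxt_le hb) (fun _ _ h => h)
      (fun _ _ hb => stage_subset _ _ _ _ hb) id
  constructor
  · intro j _ b x h
    exact h
  · rintro j _ s _ b x (h | h)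
    · exact Or.inl h
    · simp only [Set.mem_iUnion] at h
      obtain ⟨i, hi, h⟩ := h
      exact Or.inr ⟨i, hi, stage_subset _ _ _ _ h⟩
  · intro j _ s _ i _ b x h
    exact h
  · intro j hj s _ i hi v _ b x hx
    rw [psiIter_succ] at hx
    rcases hx with ⟨_, hx | ⟨c, y, hc, hy, ⟨hq, ht⟩ | ⟨hq, hb, ht⟩⟩⟩ | ⟨e, _⟩
    · exact Or.inl (hx.mono (m1 _ _ _))
    · exact Or.inr ⟨c, y, hc, hy, Or.inl ⟨hq, m1 _ _ _ _ _ ht⟩⟩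
    · exact Or.inr ⟨c, y, hc, hy, Or.inr ⟨hq, hb, ht.mono (fun _ _ hb => h _ nxt_le hb)
        (fun _ _ h => h) (fun _ _ h => h) id⟩⟩
    · exact absurd e hi.ne
  · intro j hj s _ v _ b x hx
    rw [psiIter_succ] at hx
    rcases hx with ⟨e, _⟩ | ⟨_, hw, c, y, hc, hy, ht⟩
    · exact absurd e (lt_irrefl _)
    · exact ⟨hw.mono (m1 _ _ _), c, y, hc, hy, ht.mono (fun _ _ hb => h _ nxt_le hb)
        (fun _ _ h => h) (fun _ _ h => h) id⟩

/-- The product of an arena with a winning controller. -/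
structure Product (G : Arena X A) (D : Type) where
  /-- the state of the arena -/
  st : D → X
  /-- the transitions -/
  tr : D → A → D → Prop
  /-- the controller state is the target of an uncontrollable transition -/
  afterU : D → Prop
  step_eq : ∀ d a d', tr d a d' → G.step (st d) a = some (st d')
  rho : ∀ d a d', tr d a d' → G.rho (st d')
  legal : ∀ d, (∀ u y, ¬ G.ctrl u → G.step (st d) u = some y → ∃ d', tr d u d') ∨
    ((∀ u d', ¬ G.ctrl u → ¬ tr d u d') ∧ ¬ afterU d)
  afterU_of_tr : ∀ d u d', ¬ G.ctrl u → tr d u d' → afterU d'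
  total : ∀ d, ∃ a d', tr d a d'
  winning : ∀ (d : ℕ → D) (a : ℕ → A), (∀ t, tr (d t) (a t) (d (t + 1))) →
    G.WinningRun (fun t => st (d t)) a (fun t => ∃ c d', G.ctrl c ∧ tr (d t) c d')

namespace Product

variable {D : Type} (H : Product G D)

/-- The positions of a node of the product. -/
def pos (d : D) : Set (Bool × X) := {p | p.2 = H.st d ∧ (p.1 = true ∨ H.afterU d)}

/-- All positions of the product. -/
def posns : Set (Bool × X) := ⋃ d, H.pos d

variable {H}

theorem mem_pos_of_tr {d : D} {a : A} {d' : D} (h : H.tr d a d') :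
    (true, H.st d') ∈ H.pos d' ∧ (¬ G.ctrl a → (false, H.st d') ∈ H.pos d') :=
  ⟨⟨rfl, Or.inl rfl⟩, fun ha => ⟨rfl, Or.inr (H.afterU_of_tr _ _ _ ha h)⟩⟩

/-- The transition reaches the goal of phase `j`. -/
def Goal (H : Product G D) (j : ℕ) (d : D) (a : A) (d' : D) : Prop :=
  if j < G.m then G.gs j (H.st d') else ¬ G.ctrl a ∨ G.Quiet (H.st d)

/-- Transitions that reach neither the goal of phase `j` nor `Y`. -/
def Avoid (H : Product G D) (j : ℕ) (Y : Set (Bool × X)) (d : D) (a : A) (d' : D) : Prop :=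
  H.tr d a d' ∧ ¬ H.pos d' ⊆ Y ∧ ¬ H.Goal j d a d'

/-- The events that a spoiler brings about: the assumptions, and the fairness of the environment
towards the controller. -/
def Ev (H : Product G D) (o : ℕ) (d : D) (a : A) (d' : D) : Prop :=
  if o < G.n then G.as o (H.st d') else G.ctrl a ∨ ¬ ∃ c d', G.ctrl c ∧ H.tr d c d'

/-- A transition of the product reaches the goal, enters `Y`, or belongs to `Avoid`; only the last
case needs the hypothesis about `K`. Safety holds along every transition of the product. -/
theorem tgt_of_not_avoid {j i : ℕ} {Y : Set (Bool × X)} {K : Bool → X → Prop} {d : D} {a : A}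
    {d' : D} (htr : H.tr d a d') {b : Bool} (hb : b = true ∨ ¬ G.ctrl a) {pr : Prop}
    (hpr : G.Quiet (H.st d) → b = true → pr) (hbc : ¬ G.ctrl a → b = false)
    (h : H.Avoid j Y d a d' → (i < G.n → ¬ G.as i (H.st d')) ∧ K b (H.st d')) :
    G.Tgt (fun b x => (b, x) ∈ H.posns) (fun b x => (b, x) ∈ Y) K j i pr b (H.st d') := by
  have hp : (b, H.st d') ∈ H.pos d' := by
    rcases hb with rfl | hb
    · exact (mem_pos_of_tr htr).1
    · rw [hbc hb]; exact (mem_pos_of_tr htr).2 hb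
  refine ⟨H.rho _ _ _ htr, ?_⟩
  by_cases hg : H.Goal j d a d'
  · refine Or.inl ⟨?_, Set.mem_iUnion.2 ⟨d', hp⟩⟩
    unfold Goal at hg
    unfold GoalHit
    split_ifs at hg ⊢ with hj
    · exact hg
    · rcases hg with hg | hg
      · exact Or.inl (hbc hg)
      · rcases Bool.eq_false_or_eq_true b with hb' | hb'
        · exact Or.inr (hpr hg hb')
        · exact Or.inl hb'
  · by_cases hY : H.pos d' ⊆ Y
    · exact Or.inr (Or.inl (hY hp))
    · exact Or.inr (Or.inr (h ⟨htr, hY, hg⟩))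

theorem wait_of_forall {j i : ℕ} {Y : Set (Bool × X)} {K : Bool → X → Prop} {d : D}
    (hq : ¬ G.Quiet (H.st d))
    (hu : ∀ u y, ¬ G.ctrl u → G.step (H.st d) u = some y → ∃ d', H.tr d u d')
    (h : ∀ u d', ¬ G.ctrl u → H.Avoid j Y d u d' →
      (i < G.n → ¬ G.as i (H.st d')) ∧ K false (H.st d')) :
    G.Wait (G.Tgt (fun b x => (b, x) ∈ H.posns) (fun b x => (b, x) ∈ Y) K j i True)
      (H.st d) := by
  refine ⟨hq, fun u y hcu hy => ?_⟩
  obtain ⟨d', hd'⟩ := hu u y hcu hy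
  obtain rfl : H.st d' = y := Option.some_injective _ ((H.step_eq _ _ _ hd').symm.trans hy)
  exact tgt_of_not_avoid hd' (Or.inr hcu) (fun _ _ => trivial) (fun _ => rfl) (h u d' hcu)

theorem exists_ctrl_of_not {d : D} (hu : G.Quiet (H.st d) ∨ ∀ u d', ¬ G.ctrl u → ¬ H.tr d u d') :
    ∃ c d', G.ctrl c ∧ H.tr d c d' := by
  obtain ⟨a, d', h⟩ := H.total d
  by_cases ha : G.ctrl a
  · exact ⟨a, d', ha, h⟩
  · rcases hu with hu | hu
    · exact absurd (H.step_eq _ _ _ h) (hu a _ ha)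
    · exact absurd h (hu a d' ha)

/-- In a product with a winning controller every position is ranked: otherwise there would be an
infinite path that violates the winning condition. -/
theorem posns_subset [Finite X] (hn : 0 < G.n) {j : ℕ} (hj : j ≤ G.m) :
    H.posns ⊆ ranked G H.posns j (Nat.card (Bool × X)) := by
  set Y := ranked G H.posns j (Nat.card (Bool × X)) with hYdef
  have hY : ∀ i ≤ G.n, stage G H.posns j i Y ⊆ Y :=
    fun i hi => stage_ranked_subset H.posns j i hi
  refine Set.iUnion_subset fun d₀ => ?_
  by_contra hd₀
  -- From an unranked node every spoiling event can be brought about without leaving the unranked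
  -- nodes or meeting the goal. Otherwise the nodes `Bd` from which event `o` is unreachable would
  -- span a post-fixed point of stage `o` and be ranked after all.
  have hits : ∀ d, ¬ H.pos d ⊆ Y → ∀ o < G.n + 1, ∃ k, HitsIn (H.Avoid j Y) (H.Ev o) k d := by
    by_contra hcon
    push Not at hcon
    obtain ⟨d₁, hd₁, o, ho, hno⟩ := hcon
    let Bd : D → Prop := fun d => ¬ H.pos d ⊆ Y ∧ ∀ k, ¬ HitsIn (H.Avoid j Y) (H.Ev o) k d
    let K : Set (Bool × X) := {p | ∃ d, Bd d ∧ p ∈ H.pos d}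
    have succ : ∀ d a d', Bd d → H.Avoid j Y d a d' → ¬ H.Ev o d a d' ∧ Bd d' :=
      fun d a d' hd h => ⟨fun he => hd.2 0 (.now h he), h.2.1, fun k hk => hd.2 _ (.later h hk)⟩
    suffices hK : K ⊆ stage G H.posns j o Y by
      exact hd₁ (fun p hp => hY o (by omega) (hK ⟨d₁, ⟨hd₁, hno⟩, hp⟩))
    rcases lt_or_eq_of_le (Nat.le_of_lt_succ ho) with ho' | rfl
    · have succ' : ∀ d a d' b, Bd d → (b = true ∨ ¬ G.ctrl a) → H.Avoid j Y d a d' →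
          (o < G.n → ¬ G.as o (H.st d')) ∧ (b, H.st d') ∈ K := by
        intro d a d' b hd hb h
        obtain ⟨h1, h2⟩ := succ d a d' hd h
        refine ⟨fun _ => by simpa [Ev, ho'] using h1, d', h2, rfl, ?_⟩
        exact hb.imp id fun hb => H.afterU_of_tr _ _ _ hb h.1
      refine subset_stage fun V hV => ?_
      rintro p ⟨d, hd, hp⟩
      by_contra hpV
      have chain : ∀ d, Bd d → (true, H.st d) ∉ V ∨ (false, H.st d) ∉ V ∧ H.afterU d →
          ∃ a d', H.tr d a d' ∧ (G.ctrl a ∧ ¬ G.Quiet (H.st d)) ∧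
            Bd d' ∧ ((true, H.st d') ∉ V ∨ (false, H.st d') ∉ V ∧ H.afterU d') := by
        intro d hd hdV
        obtain ⟨b, hb, hbV⟩ : ∃ b, (b = true ∨ H.afterU d) ∧ (b, H.st d) ∉ V := by
          rcases hdV with h | ⟨h, h'⟩
          · exact ⟨true, Or.inl rfl, h⟩
          · exact ⟨false, Or.inr h', h⟩
        by_cases hq : G.Quiet (H.st d)
        · obtain ⟨c, d', hc, hd'⟩ := exists_ctrl_of_not (Or.inl hq)
          refine absurd (hV (Or.inl ⟨ho', Or.inr ⟨c, H.st d', hc, H.step_eq _ _ _ hd',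
            Or.inl ⟨hq, ?_⟩⟩⟩)) hbV
          exact tgt_of_not_avoid hd' (Or.inl rfl) (fun _ _ => trivial) (fun h => absurd hc h)
            (succ' d c d' true hd (Or.inl rfl))
        · rcases H.legal d with hu | ⟨hu, haU⟩
          · exact absurd (hV (Or.inl ⟨ho', Or.inl (wait_of_forall hq hu
              fun u d' hcu => succ' d u d' false hd (Or.inr hcu))⟩)) hbV
          · have hb' : b = true := hb.resolve_right haU
            subst hb'
            obtain ⟨c, d', hc, hd'⟩ := exists_ctrl_of_not (Or.inr hu)
            refine ⟨c, d', hd', ⟨hc, hq⟩, ?_⟩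
            by_contra hcon
            refine hbV (hV (Or.inl ⟨ho', Or.inr ⟨c, H.st d', hc, H.step_eq _ _ _ hd',
              Or.inr ⟨hq, rfl, ?_⟩⟩⟩))
            refine tgt_of_not_avoid hd' (Or.inl rfl) (fun h => absurd h hq)
              (fun h => absurd hc h) fun hav => ?_
            refine ⟨(succ' d c d' true hd (Or.inl rfl) hav).1, ?_⟩
            by_contra hV'
            exact hcon ⟨(succ d c d' hd hav).2, Or.inl hV'⟩
      let Z := {d : D // Bd d ∧ ((true, H.st d) ∉ V ∨ (false, H.st d) ∉ V ∧ H.afterU d)}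
      have hchain : ∀ z : Z, ∃ (a : A) (z' : Z), H.tr z.1 a z'.1 ∧ G.ctrl a ∧
          ¬ G.Quiet (H.st z.1) := by
        rintro ⟨d, hd, hdV⟩
        obtain ⟨a, d', h1, h2, h3, h4⟩ := chain d hd hdV
        exact ⟨a, ⟨d', h3, h4⟩, h1, h2⟩
      choose act nx hnx using hchain
      let z₀ : Z := ⟨d, hd, by
        obtain ⟨b, x⟩ := p
        obtain ⟨rfl, hp⟩ := hp
        rcases Bool.eq_false_or_eq_true b with rfl | rfl
        · exact Or.inl hpV
        · exact Or.inr ⟨hpV, by simpa using hp⟩⟩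
      have hrun := (H.winning (fun t => (nx^[t] z₀).1) (fun t => act (nx^[t] z₀)) (fun t => by
        rw [Function.iterate_succ_apply']; exact (hnx _).1)).1 0
      obtain ⟨t, -, h⟩ := hrun
      exact h.elim (fun h => h (hnx _).2.1) (hnx _).2.2
    -- A node all of whose positions win in one step, without staying anywhere, already belongs to
    -- stage `0`. That stage exists apart from the last one because `n` is positive, so such nodes
    -- are excluded from `Bd`.
    · have low : ∀ d, Bd d → ¬ ∀ b, (b = true ∨ H.afterU d) →
          (b, H.st d) ∈ G.Psi H.posns j 0 Y ∅ ∅ := by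
        intro d hd h
        refine hd.1 fun p hp => hY 0 (Nat.zero_le _) (subset_stage (K := H.pos d) ?_ hp)
        rintro V hV ⟨b, x⟩ ⟨rfl, hb⟩
        exact hV (Psi.mono (Set.empty_subset _) (Set.empty_subset _) (h b hb))
      -- The last event is ψ_e: as it cannot be brought about, every avoiding move is uncontrollable
      -- and made while a controllable action is offered. In particular an offered controllable
      -- action leads to the goal or into `Y`.
      have noEv : ∀ d a d', Bd d → H.Avoid j Y d a d' →
          ¬ G.ctrl a ∧ ∃ c d', G.ctrl c ∧ H.tr d c d' := by
        intro d a d' hd h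
        have := (succ d a d' hd h).1
        simp only [Ev, lt_irrefl, if_false, not_or, not_not] at this
        exact this
      refine subset_stage_of_last ?_
      rintro ⟨b, x⟩ ⟨d, hd, rfl, hb⟩
      by_cases hoff : ∃ c d', G.ctrl c ∧ H.tr d c d'
      · obtain ⟨c, d', hc, hd'⟩ := hoff
        have ht : ∀ (i : ℕ) (K : Bool → X → Prop) (pr : Prop), (G.Quiet (H.st d) → pr) →
            G.Tgt (fun b x => (b, x) ∈ H.posns) (fun b x => (b, x) ∈ Y) K j i pr true
              (H.st d') := fun i K pr hpr =>
          tgt_of_not_avoid hd' (Or.inl rfl) (fun h _ => hpr h) (fun h => absurd hc h)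
            fun hav => absurd hc (noEv d c d' hd hav).1
        by_cases hq : G.Quiet (H.st d)
        · exact absurd (fun b hb => Or.inl ⟨hn, Or.inr ⟨c, H.st d', hc, H.step_eq _ _ _ hd',
            Or.inl ⟨hq, ht _ _ _ fun _ => trivial⟩⟩⟩) (low d hd)
        · rcases H.legal d with hu | ⟨hu, haU⟩
          · refine Or.inr ⟨rfl, wait_of_forall hq hu fun u d'' hcu hav => ?_, c, H.st d', hc,
              H.step_eq _ _ _ hd', ht _ _ _ fun h => absurd h hq⟩
            exact ⟨fun h => absurd h (lt_irrefl _), d'', (succ d u d'' hd hav).2, rfl,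
              Or.inr (H.afterU_of_tr _ _ _ hcu hav.1)⟩
          · exact absurd (fun b hb => Or.inl ⟨hn, Or.inr ⟨c, H.st d', hc, H.step_eq _ _ _ hd',
              Or.inr ⟨hq, hb.resolve_right haU, ht _ _ _ fun h => absurd h hq⟩⟩⟩) (low d hd)
      -- Without an offer there is no avoiding move at all, so mere waiting wins in one step,
      -- contrary to `low`.
      · have hq : ¬ G.Quiet (H.st d) := fun h => hoff (exists_ctrl_of_not (Or.inl h))
        have hu := (H.legal d).resolve_right fun h => hoff (exists_ctrl_of_not (Or.inr h.1))
        exact absurd (fun b hb => Or.inl ⟨hn, Or.inl (wait_of_forall hq hu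
          fun u d'' _ hav => absurd (noEv d u d'' hd hav).2 hoff)⟩) (low d hd)
  -- The spoiler resolves the nondeterminism of the controller as well; every path of the product is
  -- supposed to be winning.
  obtain ⟨d, a, -, hrun, hev⟩ := exists_run_infinitely_often (Nat.succ_pos _)
    (S := fun d => ¬ H.pos d ⊆ Y) (fun d a d' h => h.2.1) hits hd₀
  have hw := H.winning d a fun t => (hrun t).1
  rcases lt_or_eq_of_le hj with hj | rfl
  · obtain ⟨t, -, h⟩ := (hw.2 fun t => by simpa [Ev] using hev G.n (Nat.lt_succ_self _) t).2
      (fun i hi t => by simpa [Ev, hi] using hev i (by omega) t) j hj 0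
    exact (hrun t).2.2 (by simpa [Goal, hj] using h)
  · obtain ⟨t, -, h⟩ := hw.1 0
    exact (hrun t).2.2 (by simpa [Goal] using h)

end Product

end Arena

end RTC

/-! ### From temporal formulas to the winning condition of the game. -/

namespace RTC

/-! ### Semantics of the formulas -/

namespace FLTL

variable {A P : Type} {lab : ℕ → Set P} {a : ℕ → A}

theorem sat_tt {i : ℕ} : Sat lab a tt i := Or.inl ⟨rfl, fun _ _ => id⟩

theorem sat_and {φ ψ : FLTL A P} {i : ℕ} :
    Sat lab a (φ.and ψ) i ↔ Sat lab a φ i ∧ Sat lab a ψ i := by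
  simp [FLTL.and, Sat]

theorem sat_imp {φ ψ : FLTL A P} {i : ℕ} :
    Sat lab a (φ.imp ψ) i ↔ (Sat lab a φ i → Sat lab a ψ i) := by
  simp [FLTL.imp, Sat, imp_iff_not_or]

theorem sat_ev {φ : FLTL A P} {i : ℕ} : Sat lab a φ.ev i ↔ ∃ j ≥ i, Sat lab a φ j := by
  simp [FLTL.ev, Sat, sat_tt]

theorem sat_alw {φ : FLTL A P} {i : ℕ} : Sat lab a φ.alw i ↔ ∀ j ≥ i, Sat lab a φ j := by
  have : Sat lab a φ.alw i ↔ ¬ Sat lab a φ.neg.ev i := Iff.rfl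
  rw [this, sat_ev]
  simp [Sat]

theorem sat_conj {l : List (FLTL A P)} {i : ℕ} :
    Sat lab a (conj l) i ↔ ∀ φ ∈ l, Sat lab a φ i := by
  induction l with
  | nil => simpa [conj] using sat_tt
  | cons φ l ih =>
    rw [show conj (φ :: l) = φ.and (conj l) from rfl, sat_and, ih]
    simp

theorem sat_disj {l : List (FLTL A P)} {i : ℕ} :
    Sat lab a (disj l) i ↔ ∃ φ ∈ l, Sat lab a φ i := by
  induction l with
  | nil => simpa [disj, Sat] using sat_tt
  | cons φ l ih =>
    have : Sat lab a (disj (φ :: l)) i ↔ Sat lab a φ i ∨ Sat lab a (disj l) i := Iff.rfl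
    rw [this, ih]
    simp

/-- All other actions terminate this fluent, so it holds only at the moment of its action. -/
theorem sat_action {b : A} {i : ℕ} : Sat lab a (fluent (TransFluent.action b)) i ↔ a i = b := by
  constructor
  · rintro (⟨h, -⟩ | ⟨j, hj, h, h'⟩)
    · simp [TransFluent.action] at h
    · rcases hj.lt_or_eq with hj | rfl
      · simpa [TransFluent.action] using h' i hj le_rfl
      · exact h
  · exact fun h => Or.inr ⟨i, le_rfl, h, fun l h1 h2 => by omega⟩

end FLTL

theorem TransFluent.holdsAt_zero {A : Type} (f : TransFluent A) (a : ℕ → A) :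
    f.HoldsAt a 0 ↔ a 0 ∈ f.initiating ∨ (f.initially = true ∧ a 0 ∉ f.terminating) := by
  constructor
  · rintro (⟨h, h'⟩ | ⟨j, hj, h, -⟩)
    · exact Or.inr ⟨h, h' 0 le_rfl⟩
    · obtain rfl : j = 0 := by omega
      exact Or.inl h
  · rintro (h | ⟨h, h'⟩)
    · exact Or.inr ⟨0, le_rfl, h, fun l h1 h2 => by omega⟩
    · refine Or.inl ⟨h, fun j hj => ?_⟩
      obtain rfl : j = 0 := by omega
      exact h'

/-- The value after an action depends only on the value before it and the action. This is why
fluents can be recorded in states. -/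
theorem TransFluent.holdsAt_succ {A : Type} (f : TransFluent A) (a : ℕ → A) (i : ℕ) :
    f.HoldsAt a (i + 1) ↔
      a (i + 1) ∈ f.initiating ∨ (f.HoldsAt a i ∧ a (i + 1) ∉ f.terminating) := by
  constructor
  · rintro (⟨h, h'⟩ | ⟨j, hj, h, h'⟩)
    · exact Or.inr ⟨Or.inl ⟨h, fun j hj => h' j (by omega)⟩, h' _ le_rfl⟩
    · rcases hj.lt_or_eq with hj | rfl
      · exact Or.inr ⟨Or.inr ⟨j, by omega, h, fun l h1 h2 => h' l h1 (by omega)⟩,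
          h' _ hj le_rfl⟩
      · exact Or.inl h
  · rintro (h | ⟨⟨h, h'⟩ | ⟨j, hj, h, h'⟩, ht⟩)
    · exact Or.inr ⟨_, le_rfl, h, fun l h1 h2 => by omega⟩
    · refine Or.inl ⟨h, fun j hj => ?_⟩
      rcases hj.lt_or_eq with hj | rfl
      · exact h' j (by omega)
      · exact ht
    · refine Or.inr ⟨j, by omega, h, fun l h1 h2 => ?_⟩
      rcases h2.lt_or_eq with h2 | rfl
      · exact h' l h1 (by omega)
      · exact ht

section Control

variable {A P : Type} [Fintype A] {lab : ℕ → Set P} {a : ℕ → A}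

theorem mem_actionList {X : Set A} {b : A} : b ∈ actionList X ↔ b ∈ X := by
  simp [actionList]

theorem sat_someAction {X : Set A} {i : ℕ} :
    FLTL.Sat lab a (someAction X) i ↔ a i ∈ X := by
  simp [someAction, FLTL.sat_disj, FLTL.sat_action, mem_actionList]

theorem sat_passE {lab : ℕ → Set (A ⊕ A)} {C : Set A} {i : ℕ} :
    FLTL.Sat lab a (passE C) i ↔ ∀ u ∉ C, Sum.inl u ∉ lab i := by
  simp [passE, FLTL.sat_conj, FLTL.Sat, mem_actionList]

theorem sat_passM {lab : ℕ → Set (A ⊕ A)} {C : Set A} {i : ℕ} :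
    FLTL.Sat lab a (passM C) i ↔ ∀ c ∈ C, Sum.inr c ∉ lab i := by
  simp [passM, FLTL.sat_conj, FLTL.Sat, mem_actionList]

end Control

/-- Specifications speak of executions from the initial state; prefixing a path to `s` makes them
applicable to runs that start anywhere. -/
theorem DLTS.Reachable.exists_run {S P A : Type} {T : DLTS S P A} {s : S} (h : T.Reachable s)
    (d : ℕ → S) (a : ℕ → A) (hd : d 0 = s) (hr : ∀ t, T.trans (d t) (a t) (d (t + 1))) :
    ∃ d' a' t₀, T.IsExecution d' a' ∧ ∀ t, d' (t₀ + t) = d t ∧ a' (t₀ + t) = a t := by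
  induction h generalizing d a with
  | init => exact ⟨d, a, 0, ⟨hd, hr⟩, fun t => by simp⟩
  | @step s b s' _ hs ih =>
    obtain ⟨d', a', t₀, he, h'⟩ := ih (fun t => Nat.casesOn t s d) (fun t => Nat.casesOn t b a) rfl
      (by
        rintro (_ | t)
        · simpa [hd] using hs
        · exact hr t)
    refine ⟨d', a', t₀ + 1, he, fun t => ?_⟩
    have := h' (t + 1)
    rw [show t₀ + 1 + t = t₀ + (t + 1) by ring]
    exact this

namespace BoolComb

/-- The truth value of a Boolean combination. -/
def eval {k : ℕ} (v : Fin k → Prop) : BoolComb k → Prop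
  | var f => v f
  | neg b => ¬ b.eval v
  | or b c => b.eval v ∨ c.eval v

theorem sat_toFLTL {A P : Type} {k : ℕ} {lab : ℕ → Set P} {a : ℕ → A} {i : ℕ}
    {fl : Fin k → TransFluent A} (b : BoolComb k) :
    FLTL.Sat lab a (b.toFLTL fl) i ↔ b.eval fun f => (fl f).HoldsAt a i := by
  induction b with
  | var f => rfl
  | neg b ih => exact not_congr ih
  | or b c ihb ihc => exact or_congr ihb ihc

end BoolComb

/-! ### Environments that record the values of the fluents -/

namespace RTCInstance

variable (I : RTCInstance)

/-- A deterministic system that unfolds the environment into states and fluent values. -/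
structure Unfolding (X : Type) where
  /-- the state of the environment and the values of the fluents -/
  conf : X → Fin I.s × (Fin I.k → Prop)
  /-- the transitions -/
  step : X → Fin I.α → Option X
  /-- the initial state -/
  x₀ : X
  conf_init : conf x₀ = (I.init, fun f => (I.fluents f).initially = true)
  conf_step : ∀ x a y, step x a = some y → I.next (conf x).1 a = some (conf y).1 ∧
    ∀ f, (conf y).2 f ↔
      (a ∈ (I.fluents f).initiating ∨ ((conf x).2 f ∧ a ∉ (I.fluents f).terminating))
  exists_step : ∀ x a q, I.next (conf x).1 a = some q → ∃ y, step x a = some y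

namespace Unfolding

variable {I} {X : Type} (Un : I.Unfolding X)

/-- The arena of an unfolding. -/
def arena : Arena X (Fin I.α) where
  step := Un.step
  ctrl a := a ∈ I.ctrl
  n := I.n
  m := I.m
  rho x := I.rho.eval (Un.conf x).2
  as i x := ∃ h : i < I.n, (I.assume ⟨i, h⟩).eval (Un.conf x).2
  gs j x := ∃ h : j < I.m, (I.guar ⟨j, h⟩).eval (Un.conf x).2

variable {Un}

/-- A fluent at position `t` already takes the action number `t` into account, so its value is
stored in the configuration number `t + 1`. -/
theorem holdsAt_iff {x : ℕ → X} {a : ℕ → Fin I.α} (h0 : x 0 = Un.x₀)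
    (h : ∀ t, Un.step (x t) (a t) = some (x (t + 1))) (f : Fin I.k) (t : ℕ) :
    (I.fluents f).HoldsAt a t ↔ (Un.conf (x (t + 1))).2 f := by
  rw [(Un.conf_step _ _ _ (h t)).2 f]
  cases t with
  | zero => rw [TransFluent.holdsAt_zero, h0, Un.conf_init]
  | succ t => rw [TransFluent.holdsAt_succ, holdsAt_iff h0 h f t]

theorem env_enabled_iff {x : X} {a : Fin I.α} :
    I.env.Enabled (Un.conf x).1 a ↔ ∃ y, Un.step x a = some y :=
  ⟨fun ⟨_, h⟩ => Un.exists_step _ _ _ h, fun ⟨_, h⟩ => ⟨_, (Un.conf_step _ _ _ h).1⟩⟩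

theorem quiet_iff {x : X} :
    Un.arena.Quiet x ↔ ∀ u ∉ I.ctrl, ¬ I.env.Enabled (Un.conf x).1 u := by
  simp only [env_enabled_iff, not_exists]
  exact ⟨fun h u hu y => h u y hu, fun h u y hu => h u hu y⟩

/-- The shift by one separates the two kinds of atoms: `ρ`, the assumptions and the guarantees read
the configuration entered at time `t`, whereas the labels describe the states that are left. -/
theorem sat_iff_winningRun {Q : Type} {M : DLTS Q (Fin I.α) (Fin I.α)} (hM : M.LabelsEnabled)
    {x : ℕ → X} {a : ℕ → Fin I.α} {q : ℕ → Q} (h0 : x 0 = Un.x₀)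
    (h : ∀ t, Un.step (x t) (a t) = some (x (t + 1))) {s : ℕ → Fin I.s × Q}
    (hs : ∀ t, s t = ((Un.conf (x t)).1, q t)) :
    FLTL.Sat (fun i => (I.env.par M).label (s i)) a
      (FLTL.and (nonZenoC I.ctrl) (FLTL.imp (nonZenoE I.ctrl) I.goal)) 0 ↔
    Un.arena.WinningRun x a fun t => ∃ c ∈ I.ctrl, M.Enabled (q t) c := by
  have hE : ∀ t u, Sum.inl u ∈ (I.env.par M).label (s t) ↔ I.env.Enabled (Un.conf (x t)).1 u := by
    intro t u
    simp only [DLTS.par, hs, Set.mem_union, Set.mem_image, Sum.inl.injEq, exists_eq_right,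
      reduceCtorEq, and_false, exists_false, or_false]
    rfl
  have hMl : ∀ t u, Sum.inr u ∈ (I.env.par M).label (s t) ↔ M.Enabled (q t) u := by
    intro t u
    rw [← hM]
    simp [DLTS.par, hs]
  have hev : ∀ (b : BoolComb I.k) t,
      FLTL.Sat (fun i => (I.env.par M).label (s i)) a (b.toFLTL I.fluents) t ↔
        b.eval (Un.conf (x (t + 1))).2 := by
    intro b t
    rw [BoolComb.sat_toFLTL]
    simp only [holdsAt_iff h0 h]
  have hor : ∀ (φ ψ : FLTL (Fin I.α) (Fin I.α ⊕ Fin I.α)) t,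
      FLTL.Sat (fun i => (I.env.par M).label (s i)) a (φ.or ψ) t ↔
        FLTL.Sat (fun i => (I.env.par M).label (s i)) a φ t ∨
        FLTL.Sat (fun i => (I.env.par M).label (s i)) a ψ t := fun _ _ _ => Iff.rfl
  simp only [Arena.WinningRun, nonZenoC, nonZenoE, goal, FLTL.sat_and, FLTL.sat_imp,
    FLTL.sat_alw, FLTL.sat_ev, FLTL.sat_conj, hor, sat_someAction, sat_passE, sat_passM, hE, hMl,
    hev, quiet_iff, List.forall_mem_ofFn_iff, Set.mem_compl_iff, ge_iff_le, Nat.zero_le,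
    forall_const]
  refine and_congr Iff.rfl (imp_congr ?_ (and_congr Iff.rfl (imp_congr ?_ ?_)))
  · refine forall_congr' fun t => exists_congr fun t' => and_congr Iff.rfl (or_congr Iff.rfl ?_)
    push Not
    rfl
  · exact ⟨fun H i hi t => (H ⟨i, hi⟩ t).imp fun _ h => ⟨h.1, hi, h.2⟩,
      fun H i t => (H i i.2 t).imp fun _ h => ⟨h.1, h.2.2⟩⟩
  · exact ⟨fun H i hi t => (H ⟨i, hi⟩ t).imp fun _ h => ⟨h.1, hi, h.2⟩,
      fun H i t => (H i i.2 t).imp fun _ h => ⟨h.1, h.2.2⟩⟩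

theorem controllable_of_family [Finite X] {P : ℕ} {Y : ℕ → ℕ → Bool → X → Prop}
    {B : ℕ → ℕ → ℕ → ℕ → Bool → X → Prop} (F : Un.arena.Family P Y B)
    (h₀ : Y 0 P true Un.x₀) : I.Controllable := by
  obtain ⟨Q, hQ, st, tr, q₀, hst, hstep, hlegal, htotal, hwin⟩ := F.exists_controller h₀
  let M : DLTS Q (Fin I.α) (Fin I.α) := ⟨tr, fun q => {a | ∃ q', tr q a q'}, q₀⟩
  -- The controller keeps a copy of the environment state. As the environment is deterministic, the
  -- copy stays correct.
  have hreach : ∀ z, (I.env.par M).Reachable z → z.1 = (Un.conf (st z.2)).1 := by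
    intro z hz
    induction hz with
    | init =>
      change I.init = (Un.conf (st q₀)).1
      rw [hst, Un.conf_init]
    | step _ h ih =>
      have h1 := (Un.conf_step _ _ _ (hstep _ _ _ h.2)).1
      have h2 : I.next _ _ = some _ := h.1
      rw [ih] at h2
      exact Option.some_injective _ (h2.symm.trans h1)
  refine ⟨Q, hQ, M, fun _ _ => Iff.rfl, fun z hz => ⟨?_, ?_, ?_⟩, fun z hz => ?_, ?_⟩
  · rintro ⟨u, hu, q', h⟩ u' hu' hen
    rw [hreach z hz, env_enabled_iff] at hen
    obtain ⟨y, hy⟩ := hen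
    exact hlegal _ (Or.inl ⟨u, q', hu, h⟩) u' y hu' hy
  · rintro ⟨q, u, hu, h⟩ u' hu' hen
    rw [hreach z hz, env_enabled_iff] at hen
    obtain ⟨y, hy⟩ := hen
    exact hlegal _ (Or.inr ⟨u, q, hu, h⟩) u' y hu' hy
  · rintro c - hc ⟨q', h⟩
    refine hc ?_
    rw [hreach z hz, env_enabled_iff]
    exact ⟨_, hstep _ _ _ h⟩
  · obtain ⟨a, q', h⟩ := htotal z.2
    refine ⟨a, ((Un.conf (st q')).1, q'), ?_, h⟩
    rw [hreach z hz]
    exact (Un.conf_step _ _ _ (hstep _ _ _ h)).1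
  · intro s a he
    have hr : ∀ t, (I.env.par M).Reachable (s t) := by
      intro t
      induction t with
      | zero => rw [he.1]; exact .init
      | succ t ih => exact .step ih (he.2 t)
    rw [sat_iff_winningRun (Un := Un) (q := fun t => (s t).2) (x := fun t => st (s t).2)
      (fun _ _ => Iff.rfl) (by simp only [he.1]; exact hst) (fun t => hstep _ _ _ (he.2 t).2)
      (fun t => by rw [← hreach _ (hr t)])]
    have := hwin (fun t => (s t).2) a fun t => (he.2 t).2
    convert this using 2 with t
    exact ⟨fun ⟨c, hc, q', h⟩ => ⟨c, q', hc, h⟩, fun ⟨c, q', hc, h⟩ => ⟨c, hc, q', h⟩⟩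

/-- The product is formed by the reachable pairs of a configuration and a controller state. It
inherits legality, totality and winning runs from the solution. -/
theorem exists_family_of_controllable [Finite X] (hn : 0 < I.n) (h : I.Controllable) :
    ∃ (Y : ℕ → ℕ → Bool → X → Prop) (B : ℕ → ℕ → ℕ → ℕ → Bool → X → Prop),
      Un.arena.Family (Nat.card (Bool × X)) Y B ∧ Y 0 (Nat.card (Bool × X)) true Un.x₀ := by
  obtain ⟨Q, hQ, M, hlab, hlegal, hdead, hsat⟩ := h
  let T : DLTS X Empty (Fin I.α) := ⟨fun x a y => Un.step x a = some y, fun _ => ∅, Un.x₀⟩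
  let D := {d : X × Q // (T.par M).Reachable d}
  have hreach : ∀ d, (T.par M).Reachable d → (I.env.par M).Reachable ((Un.conf d.1).1, d.2) := by
    intro d hd
    induction hd with
    | init =>
      change (I.env.par M).Reachable ((Un.conf Un.x₀).1, M.init)
      rw [Un.conf_init]
      exact .init
    | step _ h ih => exact .step ih ⟨(Un.conf_step _ _ _ h.1).1, h.2⟩
  let tr : D → Fin I.α → D → Prop := fun d a d' => (T.par M).trans d.1 a d'.1
  have mk : ∀ (d : D) a y q, Un.step d.1.1 a = some y → M.trans d.1.2 a q →
      ∃ d' : D, tr d a d' ∧ d'.1 = (y, q) :=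
    fun d a y q h1 h2 => ⟨⟨(y, q), .step d.2 ⟨h1, h2⟩⟩, ⟨h1, h2⟩, rfl⟩
  have hoff : ∀ d : D, (∃ c ∈ I.ctrl, M.Enabled d.1.2 c) ↔ ∃ c d', c ∈ I.ctrl ∧ tr d c d' := by
    refine fun d => ⟨fun ⟨c, hc, q, hq⟩ => ?_, fun ⟨c, d', hc, h⟩ => ⟨c, hc, _, h.2⟩⟩
    have : I.env.Enabled (Un.conf d.1.1).1 c := by
      by_contra hcon
      exact (hlegal _ (hreach _ d.2)).2.2 c hc hcon ⟨q, hq⟩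
    obtain ⟨y, hy⟩ := env_enabled_iff.1 this
    obtain ⟨d', h, -⟩ := mk d c y q hy hq
    exact ⟨c, d', hc, h⟩
  have htotal : ∀ d : D, ∃ a d', tr d a d' := by
    intro d
    obtain ⟨a, z, hz⟩ := hdead _ (hreach _ d.2)
    obtain ⟨y, hy⟩ := Un.exists_step _ _ _ hz.1
    obtain ⟨d', h, -⟩ := mk d a y z.2 hy hz.2
    exact ⟨a, d', h⟩
  have hwin : ∀ (d : ℕ → D) (a : ℕ → Fin I.α), (∀ t, tr (d t) (a t) (d (t + 1))) →
      Un.arena.WinningRun (fun t => (d t).1.1) a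
        (fun t => ∃ c d', c ∈ I.ctrl ∧ tr (d t) c d') := by
    intro d a hr
    obtain ⟨d', a', t₀, he, ht⟩ := DLTS.Reachable.exists_run (d 0).2 (fun t => (d t).1) a rfl hr
    have hw := (sat_iff_winningRun (Un := Un) (q := fun t => (d' t).2) (x := fun t => (d' t).1)
      (s := fun t => ((Un.conf (d' t).1).1, (d' t).2)) (a := a') hlab (by simp [he.1]; rfl)
      (fun t => (he.2 t).1) (fun t => rfl)).1 (hsat _ a' ⟨by
        simp only [he.1]
        change ((Un.conf Un.x₀).1, M.init) = _
        rw [Un.conf_init]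
        rfl, fun t => ⟨(Un.conf_step _ _ _ (he.2 t).1).1, (he.2 t).2⟩⟩)
    -- Recurrence is insensitive to the finite prefix that leads to the start of the run.
    have shift : ∀ (p : ℕ → Prop) (p' : ℕ → Prop), (∀ t, p t ↔ p' (t₀ + t)) →
        ((∀ t, ∃ t' ≥ t, p t') ↔ ∀ t, ∃ t' ≥ t, p' t') := by
      intro p p' hp
      constructor
      · intro H t
        obtain ⟨t', h1, h2⟩ := H t
        exact ⟨t₀ + t', by omega, (hp _).1 h2⟩
      · intro H t
        obtain ⟨t', h1, h2⟩ := H (t₀ + t)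
        exact ⟨t' - t₀, by omega, (hp _).2 (by rwa [show t₀ + (t' - t₀) = t' by omega])⟩
    have e1 : ∀ t, (d' (t₀ + t)).1 = (d t).1.1 := fun t => by rw [(ht t).1]
    have e2 : ∀ t, a' (t₀ + t) = a t := fun t => (ht t).2
    have e3 : ∀ t, (∃ c ∈ I.ctrl, M.Enabled (d' (t₀ + t)).2 c) ↔
        ∃ c d', c ∈ I.ctrl ∧ tr (d t) c d' := fun t => by rw [← hoff, (ht t).1]
    refine ⟨(shift _ _ fun t => ?_).2 hw.1, fun hE => ?_⟩
    · simp only [e1, e2]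
    · obtain ⟨h1, h2⟩ := hw.2 ((shift _ _ fun t => by rw [e2]; simp only [e3]).1 hE)
      refine ⟨fun t => by simpa only [← e1, Nat.add_assoc] using h1 (t₀ + t), fun hA j hj => ?_⟩
      refine (shift _ _ fun t => ?_).2 (h2 (fun i hi => (shift _ _ fun t => ?_).1 (hA i hi)) j hj)
      · simp only [← e1, Nat.add_assoc]
      · simp only [← e1, Nat.add_assoc]
  -- Safety is only promised on runs that satisfy ψ_e. Any transition can be extended to such a run
  -- by taking a controllable action whenever one is offered.
  have hrho : ∀ d a d', tr d a d' → Un.arena.rho d'.1.1 := by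
    intro d a d' h
    have next : ∀ d : D, ∃ a d', tr d a d' ∧
        (a ∈ I.ctrl ∨ ¬ ∃ c d', c ∈ I.ctrl ∧ tr d c d') := by
      intro d
      by_cases ho : ∃ c d', c ∈ I.ctrl ∧ tr d c d'
      · obtain ⟨c, d', hc, h⟩ := ho
        exact ⟨c, d', h, Or.inl hc⟩
      · obtain ⟨a, d', h⟩ := htotal d
        exact ⟨a, d', h, Or.inr ho⟩
    choose act nx hnx using next
    have hw := hwin (fun t => Nat.casesOn t d fun t => nx^[t] d')
      (fun t => Nat.casesOn t a fun t => act (nx^[t] d')) (by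
        rintro (_ | t)
        · exact h
        · simp only [Function.iterate_succ_apply']
          exact (hnx _).1)
    exact (hw.2 fun t => ⟨t + 1, by omega, (hnx _).2⟩).1 0
  let H : Arena.Product Un.arena D :=
    { st := fun d => d.1.1
      tr := tr
      afterU := fun d => ∃ q, ∃ u ∉ I.ctrl, M.trans q u d.1.2
      step_eq := fun d a d' h => h.1
      rho := hrho
      legal := by
        intro d
        obtain ⟨l1, l2, -⟩ := hlegal _ (hreach _ d.2)
        have all : (∀ u ∉ I.ctrl, I.env.Enabled (Un.conf d.1.1).1 u → M.Enabled d.1.2 u) →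
            ∀ u y, u ∉ I.ctrl → Un.step d.1.1 u = some y → ∃ d', tr d u d' := by
          intro h u y hu hy
          obtain ⟨q, hq⟩ := h u hu (env_enabled_iff.2 ⟨y, hy⟩)
          obtain ⟨d', h, -⟩ := mk d u y q hy hq
          exact ⟨d', h⟩
        -- Clause (i) settles the case that some uncontrollable action is admitted, clause (ii) the
        -- case that the state is the target of one. In the remaining case none is admitted.
        by_cases hu : ∃ u ∉ I.ctrl, M.Enabled d.1.2 u
        · exact Or.inl (all (l1 hu))
        · by_cases ha : ∃ q, ∃ u ∉ I.ctrl, M.trans q u d.1.2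
          · exact Or.inl (all (l2 ha))
          · exact Or.inr ⟨fun u d' hcu h => hu ⟨u, hcu, _, h.2⟩, ha⟩
      afterU_of_tr := fun d u d' hu h => ⟨_, u, hu, h.2⟩
      total := htotal
      winning := hwin }
  have : Nonempty X := ⟨Un.x₀⟩
  refine ⟨_, _, Arena.family_of_subset (R := H.posns)
    fun j hj => Arena.Product.posns_subset hn hj, ?_⟩
  exact Arena.Product.posns_subset (H := H) hn (Nat.zero_le _)
    (Set.mem_iUnion.2 ⟨⟨(Un.x₀, M.init), .init⟩, rfl, Or.inl rfl⟩)

end Unfolding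

end RTCInstance

end RTC

/-! ### Linear-time computation of the largest consistent set of an AND/OR graph. -/

namespace RTC

open Prog

/-! ### Propagation in AND/OR graphs -/

/-- The edges of an AND/OR graph: source, target, and kind (`0`: the source needs the target, `1`:
the source needs one of its targets of this kind). -/
abbrev Edges := List (ℕ × ℕ × ℕ)

/-- `B` is a consistent set of alive nodes; the node `0` is dead. -/
def Consistent (L : Edges) (B : ℕ → Prop) : Prop :=
  ¬ B 0 ∧ ∀ q p w, (q, p, w) ∈ L → B q →
    (w = 0 → B p) ∧ (w = 1 → ∃ p', (q, p', 1) ∈ L ∧ B p')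

namespace Edges

/-- Source of an edge. -/
def src (L : Edges) (e : ℕ) : ℕ := (L.getD e (0, 0, 0)).1

/-- Target of an edge. -/
def dst (L : Edges) (e : ℕ) : ℕ := (L.getD e (0, 0, 0)).2.1

/-- Kind of an edge. -/
def wt (L : Edges) (e : ℕ) : ℕ := (L.getD e (0, 0, 0)).2.2

theorem mem_of_lt {L : Edges} {e : ℕ} (h : e < L.length) : (L.src e, L.dst e, L.wt e) ∈ L := by
  have : (L.src e, L.dst e, L.wt e) = L[e] := by simp [src, dst, wt, h]
  rw [this]
  exact List.getElem_mem h

theorem exists_of_mem {L : Edges} {q p w : ℕ} (h : (q, p, w) ∈ L) :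
    ∃ e < L.length, L.src e = q ∧ L.dst e = p ∧ L.wt e = w := by
  obtain ⟨e, he, h⟩ := List.mem_iff_getElem.1 h
  exact ⟨e, he, by simp [src, he, h], by simp [dst, he, h], by simp [wt, he, h]⟩

theorem getD_append_left {L : Edges} {x : ℕ × ℕ × ℕ} {e : ℕ} (h : e < L.length) :
    (L ++ [x]).getD e (0, 0, 0) = L.getD e (0, 0, 0) := by
  simp [List.getD_eq_getElem?_getD, List.getElem?_append_left h]

theorem getD_append_self {L : Edges} {x : ℕ × ℕ × ℕ} :
    (L ++ [x]).getD L.length (0, 0, 0) = x := by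
  simp [List.getD_eq_getElem?_getD]

end Edges

/-- `h` is the head of the linked list `l`, where `0` marks the end and entries are shifted by one.
    -/
def Linked (link : ℕ → ℕ) : ℕ → List ℕ → Prop
  | h, [] => h = 0
  | h, e :: l => h = e + 1 ∧ Linked link (link e) l

theorem Linked.congr {link link' : ℕ → ℕ} {h : ℕ} {l : List ℕ} (H : Linked link h l)
    (hl : ∀ e ∈ l, link' e = link e) : Linked link' h l := by
  induction l generalizing h with
  | nil => exact H
  | cons e l ih =>
    refine ⟨H.1, ?_⟩
    rw [hl e (by simp)]
    exact ih H.2 fun e' he' => hl e' (by simp [he'])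

/-- The arrays represent the graph `L` by linked lists of incoming edges. -/
structure GraphAt (L : Edges) (ne : ℕ) (src wt link head cnt : ℕ → ℕ) : Prop where
  ne_eq : ne = L.length
  src_eq : ∀ e < L.length, src e = L.src e
  wt_eq : ∀ e < L.length, wt e = L.wt e
  wt_le : ∀ e < L.length, L.wt e ≤ 1
  linked : ∀ p, ∃ l, Linked link (head p) l ∧ l.Nodup ∧ ∀ e, e ∈ l ↔ e < L.length ∧ L.dst e = p
  cnt_eq : ∀ q, cnt q = {e ∈ Finset.range L.length | L.src e = q ∧ L.wt e = 1}.card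

/-- The store represents the graph `L`. -/
def GraphOn (L : Edges) (σ : Store) : Prop :=
  GraphAt L (σ.reg 8) (σ.mem 20) (σ.mem 21) (σ.mem 22) (σ.mem 23) (σ.mem 24)

/-- Append an edge; its data are in the registers `q`, `p` and `w`. -/
def emit (q p w : ℕ) : Prog :=
  .block [.store 20 8 q, .store 21 8 w, .load 9 23 p, .store 22 8 9, .const 10 1, .add 8 8 10,
    .store 23 p 8, .load 9 24 q, .add 9 9 w, .store 24 q 9]

/-- The number of the new edge is the old length. It becomes the head of the list of its target,
stored as length plus one because `0` ends a list. -/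
theorem GraphAt.append {L : Edges} {ne : ℕ} {src wt link head cnt : ℕ → ℕ}
    (h : GraphAt L ne src wt link head cnt) (q p w : ℕ) (hw : w ≤ 1) :
    GraphAt (L ++ [(q, p, w)]) (ne + 1) (Function.update src ne q) (Function.update wt ne w)
      (Function.update link ne (head p)) (Function.update head p (ne + 1))
      (Function.update cnt q (cnt q + w)) := by
  obtain ⟨rfl, hs, hwt, hle, hl, hc⟩ := h
  have e1 : ∀ e < L.length, Edges.src (L ++ [(q, p, w)]) e = L.src e := fun e he => by
    unfold Edges.src; rw [Edges.getD_append_left he]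
  have e2 : ∀ e < L.length, Edges.dst (L ++ [(q, p, w)]) e = L.dst e := fun e he => by
    unfold Edges.dst; rw [Edges.getD_append_left he]
  have e3 : ∀ e < L.length, Edges.wt (L ++ [(q, p, w)]) e = L.wt e := fun e he => by
    unfold Edges.wt; rw [Edges.getD_append_left he]
  have f1 : Edges.src (L ++ [(q, p, w)]) L.length = q := by
    unfold Edges.src; rw [Edges.getD_append_self]
  have f2 : Edges.dst (L ++ [(q, p, w)]) L.length = p := by
    unfold Edges.dst; rw [Edges.getD_append_self]
  have f3 : Edges.wt (L ++ [(q, p, w)]) L.length = w := by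
    unfold Edges.wt; rw [Edges.getD_append_self]
  have hlen : (L ++ [(q, p, w)]).length = L.length + 1 := by simp
  refine ⟨by simp, fun e he => ?_, fun e he => ?_, fun e he => ?_, fun p' => ?_, fun q' => ?_⟩
  · rcases (show e ≤ L.length by omega).lt_or_eq with he | rfl
    · rw [Function.update_of_ne he.ne, e1 e he, hs e he]
    · rw [Function.update_self, f1]
  · rcases (show e ≤ L.length by omega).lt_or_eq with he | rfl
    · rw [Function.update_of_ne he.ne, e3 e he, hwt e he]
    · rw [Function.update_self, f3]
  · rcases (show e ≤ L.length by omega).lt_or_eq with he | rfl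
    · rw [e3 e he]; exact hle e he
    · rw [f3]; exact hw
  · obtain ⟨l, h1, h2, h3⟩ := hl p'
    have h1' : Linked (Function.update link L.length (head p)) (head p') l :=
      h1.congr fun e he => Function.update_of_ne ((h3 e).1 he).1.ne _ _
    by_cases hp : p' = p
    · subst hp
      refine ⟨L.length :: l, ⟨by simp, by simpa using h1'⟩, ?_, fun e => ?_⟩
      · exact List.nodup_cons.2 ⟨fun h => by simpa using ((h3 _).1 h).1, h2⟩
      · rw [List.mem_cons, h3, hlen]
        constructor
        · rintro (rfl | ⟨he, hd⟩)
          · exact ⟨Nat.lt_succ_self _, f2⟩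
          · exact ⟨by omega, by rw [e2 e he]; exact hd⟩
        · rintro ⟨he, hd⟩
          rcases (show e ≤ L.length by omega).lt_or_eq with he | rfl
          · exact Or.inr ⟨he, by rw [← e2 e he]; exact hd⟩
          · exact Or.inl rfl
    · refine ⟨l, by rwa [Function.update_of_ne hp], h2, fun e => ?_⟩
      rw [h3, hlen]
      constructor
      · rintro ⟨he, hd⟩
        exact ⟨by omega, by rw [e2 e he]; exact hd⟩
      · rintro ⟨he, hd⟩
        rcases (show e ≤ L.length by omega).lt_or_eq with he | rfl
        · exact ⟨he, by rw [← e2 e he]; exact hd⟩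
        · exact absurd (hd.symm.trans f2) hp
  · rw [hlen, Finset.range_add_one, Finset.filter_insert, f1, f3]
    have hfil : {e ∈ Finset.range L.length | Edges.src (L ++ [(q, p, w)]) e = q' ∧
        Edges.wt (L ++ [(q, p, w)]) e = 1} =
        {e ∈ Finset.range L.length | L.src e = q' ∧ L.wt e = 1} := by
      refine Finset.filter_congr fun e he => ?_
      rw [e1 e (Finset.mem_range.1 he), e3 e (Finset.mem_range.1 he)]
    rw [hfil]
    by_cases hq : q' = q
    · subst hq
      rw [Function.update_self, hc]
      rcases Nat.le_one_iff_eq_zero_or_eq_one.1 hw with rfl | rfl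
      · simp
      · rw [if_pos ⟨rfl, rfl⟩, Finset.card_insert_of_notMem (by simp)]
    · rw [Function.update_of_ne hq, if_neg (fun h => hq h.1.symm), hc]

theorem graphOn_emit {L : Edges} {σ : Store} (h : GraphOn L σ) {q p w : ℕ}
    (hq : q ≠ 8 ∧ q ≠ 9 ∧ q ≠ 10) (hp : p ≠ 8 ∧ p ≠ 9 ∧ p ≠ 10) (hw : w ≠ 8 ∧ w ≠ 9 ∧ w ≠ 10)
    (hle : σ.reg w ≤ 1) :
    GraphOn (L ++ [(σ.reg q, σ.reg p, σ.reg w)]) ((emit q p w).exec σ) := by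
  have := GraphAt.append h (σ.reg q) (σ.reg p) (σ.reg w) hle
  simpa [GraphOn, emit, block, Prog.exec, hq, hp, hw] using this

/-- The inner loop of the propagation: the next incoming edge of a dead node. -/
def solveEdge : Prog :=
  .block [.sub 15 14 9, .load 16 20 15, .load 17 21 15,
    .ite 17 (.block [.load 18 24 16, .sub 18 18 9, .store 24 16 18]) (.const 18 0),
    .ite 18 (.const 19 0) (.seq (.load 19 25 16)
      (.ite 19 (.const 19 0) (.block [.store 25 16 9, .store 26 12 16, .add 12 12 9]))),
    .load 14 22 15]

/-- Propagation of dead nodes along a graph, starting from the node `0`. -/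
def solve : Prog :=
  .seq (.block [.const 9 1, .const 13 0, .store 26 13 13, .store 25 13 9, .const 12 1])
    (.loop 12 (.seq (.block [.const 9 1, .sub 12 12 9, .load 13 26 12, .load 14 23 13])
      (.loop 14 solveEdge)))

/-- The invariant of the propagation: `rem` are the edges not yet processed, the stack `stk` of
height `sp` holds the dead nodes not yet processed, and `l` are the remaining edges into the node
`cur`. -/
structure Propagating (L : Edges) (rem : Finset ℕ) (sp cur : ℕ) (l : List ℕ)
    (cnt dead stk : ℕ → ℕ) : Prop where
  rem_lt : ∀ e ∈ rem, e < L.length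
  cnt_eq : ∀ q, cnt q = {e ∈ rem | L.src e = q ∧ L.wt e = 1}.card
  dead_le : ∀ q, dead q ≤ 1
  dead_zero : dead 0 = 1
  stk_dead : ∀ k < sp, dead (stk k) = 1
  stk_inj : ∀ k < sp, ∀ k' < sp, stk k = stk k' → k = k'
  done : ∀ e < L.length, e ∉ rem → dead (L.dst e) = 1 ∧ ∀ k < sp, stk k ≠ L.dst e
  todo : ∀ e ∈ rem, dead (L.dst e) = 1 → (∃ k < sp, stk k = L.dst e) ∨ e ∈ l
  and_dead : ∀ e < L.length, e ∉ rem → L.wt e = 0 → dead (L.src e) = 1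
  or_dead : ∀ e < L.length, L.wt e = 1 →
    (∀ e' ∈ rem, ¬ (L.src e' = L.src e ∧ L.wt e' = 1)) → dead (L.src e) = 1
  sound : ∀ B, Consistent L B → ∀ q, dead q = 1 → ¬ B q
  nodup : l.Nodup
  mem_l : ∀ e ∈ l, e ∈ rem ∧ L.dst e = cur
  cur_dead : l ≠ [] → dead cur = 1 ∧ ∀ k < sp, stk k ≠ cur

/-- The counter of a node is the number of its unprocessed edges of kind `1`; processing an edge
removes it once. -/
theorem Propagating.mark {L : Edges} {rem : Finset ℕ} {sp cur e : ℕ} {l : List ℕ}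
    {cnt dead stk : ℕ → ℕ} (h : Propagating L rem sp cur (e :: l) cnt dead stk)
    {cnt' : ℕ → ℕ} (hcnt : cnt' = if L.wt e = 1
      then Function.update cnt (L.src e) (cnt (L.src e) - 1) else cnt) :
    (∀ q, cnt' q = {e' ∈ rem.erase e | L.src e' = q ∧ L.wt e' = 1}.card) := by
  intro q
  have he := (h.mem_l e (by simp)).1
  rw [Finset.filter_erase, hcnt]
  split_ifs with hw
  · by_cases hq : q = L.src e
    · subst hq
      rw [Function.update_self, h.cnt_eq, Finset.card_erase_of_mem (by simp [he, hw])]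
    · rw [Function.update_of_ne hq, h.cnt_eq, Finset.erase_eq_of_notMem]
      simp [Ne.symm hq]
  · rw [h.cnt_eq, Finset.erase_eq_of_notMem]
    simp [hw]

/-- Processing an edge into a dead node either changes nothing for its source, which has another
alternative or is dead already, or kills the source, which is then pushed. -/
theorem Propagating.step {L : Edges} {rem : Finset ℕ} {sp cur e : ℕ} {l : List ℕ}
    {cnt dead stk : ℕ → ℕ} (h : Propagating L rem sp cur (e :: l) cnt dead stk)
    (hle : ∀ e < L.length, L.wt e ≤ 1) {cnt' : ℕ → ℕ} (hcnt : cnt' = if L.wt e = 1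
      then Function.update cnt (L.src e) (cnt (L.src e) - 1) else cnt) :
    ((L.wt e = 1 ∧ cnt' (L.src e) ≠ 0) ∨ dead (L.src e) = 1 →
      Propagating L (rem.erase e) sp cur l cnt' dead stk) ∧
    (¬ (L.wt e = 1 ∧ cnt' (L.src e) ≠ 0) → dead (L.src e) = 0 →
      Propagating L (rem.erase e) (sp + 1) cur l cnt' (Function.update dead (L.src e) 1)
        (Function.update stk sp (L.src e))) := by
  obtain ⟨he, hecur⟩ := h.mem_l e (by simp)
  have helt := h.rem_lt e he
  obtain ⟨hcd, hcs⟩ := h.cur_dead (by simp)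
  have hc' := h.mark hcnt
  have hnd := List.nodup_cons.1 h.nodup
  constructor
  · intro hcase
    refine ⟨fun e' he' => h.rem_lt e' (Finset.mem_of_mem_erase he'), hc', h.dead_le, h.dead_zero,
      h.stk_dead, h.stk_inj, fun e' h1 h2 => ?_, fun e' h1 h2 => ?_, fun e' h1 h2 h3 => ?_,
      fun e' h1 h2 h3 => ?_, h.sound, hnd.2, fun e' h1 => ?_, fun _ => ⟨hcd, hcs⟩⟩
    · by_cases hee : e' = e
      · rw [hee, hecur]; exact ⟨hcd, hcs⟩
      · exact h.done e' h1 (by simpa [hee] using h2)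
    · obtain ⟨hne, h1⟩ := Finset.mem_erase.1 h1
      simpa [hne] using h.todo e' h1 h2
    · by_cases hee : e' = e
      · rw [hee] at h3 ⊢
        rcases hcase with hcase | hcase
        · omega
        · exact hcase
      · exact h.and_dead e' h1 (by simpa [hee] using h2) h3
    · by_cases hs : L.src e' = L.src e ∧ L.wt e = 1
      · rcases hcase with hcase | hcase
        · exact absurd (by
            rw [hc', Finset.card_eq_zero, Finset.filter_eq_empty_iff]
            intro e'' he''
            rw [← hs.1]
            exact h3 e'' he'') hcase.2
        · rw [hs.1]; exact hcase
      · refine h.or_dead e' h1 h2 fun e'' he'' hh => ?_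
        by_cases hee : e'' = e
        · rw [hee] at hh; exact hs ⟨hh.1.symm, hh.2⟩
        · exact h3 e'' (Finset.mem_erase.2 ⟨hee, he''⟩) hh
    · obtain ⟨h2, h3⟩ := h.mem_l e' (by simp [h1])
      exact ⟨Finset.mem_erase.2 ⟨fun hh => hnd.1 (hh ▸ h1), h2⟩, h3⟩
  · intro hw hd0
    have hne : ∀ q, dead q = 1 → q ≠ L.src e := fun q hq hh => by rw [hh] at hq; omega
    have hup : ∀ q, dead q = 1 → Function.update dead (L.src e) 1 q = 1 := fun q hq => by
      rw [Function.update_of_ne (hne q hq)]; exact hq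
    have hs : ∀ k < sp, Function.update stk sp (L.src e) k = stk k := fun k hk =>
      Function.update_of_ne hk.ne _ _
    have hsp : Function.update stk sp (L.src e) sp = L.src e := Function.update_self _ _ _
    have newstk : ∀ q, dead q = 1 → (∀ k < sp, stk k ≠ q) →
        ∀ k < sp + 1, Function.update stk sp (L.src e) k ≠ q := by
      intro q hq hk k hlt
      rcases (show k ≤ sp by omega).lt_or_eq with hlt | rfl
      · rw [hs k hlt]; exact hk k hlt
      · rw [hsp]; exact (hne q hq).symm
    refine ⟨fun e' he' => h.rem_lt e' (Finset.mem_of_mem_erase he'), hc', fun q => ?_,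
      hup _ h.dead_zero, fun k hk => ?_, fun k hk k' hk' hkk => ?_, fun e' h1 h2 => ?_,
      fun e' h1 h2 => ?_, fun e' h1 h2 h3 => ?_,
      fun e' h1 h2 h3 => ?_, fun B hB q hq => ?_, hnd.2, fun e' h1 => ?_,
      fun _ => ⟨hup _ hcd, newstk _ hcd hcs⟩⟩
    · rw [Function.update_apply]
      split_ifs
      · exact le_rfl
      · exact h.dead_le q
    · rcases (show k ≤ sp by omega).lt_or_eq with hlt | rfl
      · rw [hs k hlt]; exact hup _ (h.stk_dead k hlt)
      · rw [hsp, Function.update_self]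
    · rcases Nat.lt_succ_iff_lt_or_eq.1 hk with hlt | hlt <;>
        rcases Nat.lt_succ_iff_lt_or_eq.1 hk' with hlt' | hlt'
      · rw [hs k hlt, hs k' hlt'] at hkk
        exact h.stk_inj k hlt k' hlt' hkk
      · rw [hs k hlt, hlt', hsp] at hkk
        exact absurd hkk (hne _ (h.stk_dead k hlt))
      · rw [hs k' hlt', hlt, hsp] at hkk
        exact absurd hkk.symm (hne _ (h.stk_dead k' hlt'))
      · rw [hlt, hlt']
    · have : dead (L.dst e') = 1 ∧ ∀ k < sp, stk k ≠ L.dst e' := by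
        by_cases hee : e' = e
        · rw [hee, hecur]; exact ⟨hcd, hcs⟩
        · exact h.done e' h1 (by simpa [hee] using h2)
      exact ⟨hup _ this.1, newstk _ this.1 this.2⟩
    · obtain ⟨hee, h1⟩ := Finset.mem_erase.1 h1
      by_cases hq : L.dst e' = L.src e
      · exact Or.inl ⟨sp, Nat.lt_succ_self _, by rw [hsp, hq]⟩
      · rw [Function.update_of_ne hq] at h2
        rcases h.todo e' h1 h2 with ⟨k, hk, hkk⟩ | h
        · exact Or.inl ⟨k, by omega, by rw [hs k hk, hkk]⟩
        · exact Or.inr (by simpa [hee] using h)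
    · by_cases hee : e' = e
      · rw [hee, Function.update_self]
      · exact hup _ (h.and_dead e' h1 (by simpa [hee] using h2) h3)
    · by_cases hs : L.src e' = L.src e
      · rw [hs, Function.update_self]
      · refine hup _ (h.or_dead e' h1 h2 fun e'' he'' hh => ?_)
        by_cases hee : e'' = e
        · rw [hee] at hh; exact hs hh.1.symm
        · exact h3 e'' (Finset.mem_erase.2 ⟨hee, he''⟩) hh
    -- Soundness: a source dies through an obligatory edge into a dead node, or because its counter
    -- is `0`. In the latter case all its alternatives have been processed, so their targets are
    -- dead.
    · by_cases hqe : q = L.src e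
      · intro hBq
        rw [hqe] at hBq
        obtain ⟨c1, c2⟩ := hB.2 _ _ _ (Edges.mem_of_lt helt) hBq
        rcases Nat.le_one_iff_eq_zero_or_eq_one.1 (hle e helt) with h0 | h1
        · exact h.sound B hB _ hcd (hecur ▸ c1 h0)
        · obtain ⟨p', hp', hBp⟩ := c2 h1
          obtain ⟨e', he', hs', hd', hw'⟩ := Edges.exists_of_mem hp'
          have hnr : e' ∉ rem.erase e := by
            have hz : cnt' (L.src e) = 0 := by
              by_contra hcon
              exact hw ⟨h1, hcon⟩
            rw [hc', Finset.card_eq_zero, Finset.filter_eq_empty_iff] at hz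
            exact fun hh => hz hh ⟨hs', hw'⟩
          by_cases hee : e' = e
          · rw [hee, hecur] at hd'
            exact h.sound B hB _ hcd (hd' ▸ hBp)
          · exact h.sound B hB _ (h.done e' he' (by simpa [hee] using hnr)).1 (hd' ▸ hBp)
      · rw [Function.update_of_ne hqe] at hq
        exact h.sound B hB q hq
    · obtain ⟨h2, h3⟩ := h.mem_l e' (by simp [h1])
      exact ⟨Finset.mem_erase.2 ⟨fun hh => hnd.1 (hh ▸ h1), h2⟩, h3⟩

/-- The store during the propagation. -/
def PropOn (L : Edges) (σ₀ : Store) (rem : Finset ℕ) (sp cur : ℕ) (l : List ℕ) (σ : Store) :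
    Prop :=
  Propagating L rem sp cur l (σ.mem 24) (σ.mem 25) (σ.mem 26) ∧ σ.reg 12 = sp ∧ σ.reg 9 = 1 ∧
    ∀ b < 24, σ.mem b = σ₀.mem b

/-- An edge releases 30 units of potential. They pay for at most 15 steps and for the 10 units that
a pushed node deposits. -/
theorem run_solveEdge {L : Edges} {σ₀ : Store} (hG : GraphOn L σ₀) {rem : Finset ℕ} {sp cur : ℕ}
    {l : List ℕ} {σ : Store} (h : PropOn L σ₀ rem sp cur l σ)
    (hl : Linked (σ₀.mem 22) (σ.reg 14) l) (hx : σ.reg 14 ≠ 0) :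
    ∃ t σ' rem' sp' l', Run solveEdge σ t σ' ∧ PropOn L σ₀ rem' sp' cur l' σ' ∧
      Linked (σ₀.mem 22) (σ'.reg 14) l' ∧
      t + 1 + (30 * rem'.card + 10 * sp') ≤ 30 * rem.card + 10 * sp := by
  obtain ⟨hP, hsp, h9, hfr⟩ := h
  cases l with
  | nil => exact absurd hl hx
  | cons e l =>
    obtain ⟨h14, hl⟩ := hl
    obtain ⟨he, hecur⟩ := hP.mem_l e (by simp)
    have helt := hP.rem_lt e he
    obtain ⟨t, ht, hr⟩ := Run.exec (p := solveEdge) rfl σ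
    have hcost : solveEdge.cost = 14 := rfl
    have hcard : (rem.erase e).card + 1 = rem.card := Finset.card_erase_add_one he
    have hsrc : σ.mem 20 e = L.src e := by rw [hfr 20 (by norm_num)]; exact hG.src_eq e helt
    have hwt : σ.mem 21 e = L.wt e := by rw [hfr 21 (by norm_num)]; exact hG.wt_eq e helt
    have hlk : σ.mem 22 e = σ₀.mem 22 e := by rw [hfr 22 (by norm_num)]
    obtain ⟨s1, s2⟩ := hP.step hG.wt_le rfl
    have hfr' : ∀ b < 24, (solveEdge.exec σ).mem b = σ₀.mem b := fun b hb => by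
      rw [hr.frame.2 b ?_, hfr b hb]
      simp only [solveEdge, block, modM, Bool.or_false, Bool.false_or, Bool.or_eq_false_iff,
        beq_eq_false_iff_ne, ne_eq]
      omega
    have e9 : (solveEdge.exec σ).reg 9 = 1 := by rw [hr.frame.1 9 rfl, h9]
    have hsplit : L.wt e = 0 ∨ L.wt e = 1 := Nat.le_one_iff_eq_zero_or_eq_one.1 (hG.wt_le e helt)
    have hdsplit : σ.mem 25 (L.src e) = 0 ∨ σ.mem 25 (L.src e) = 1 :=
      Nat.le_one_iff_eq_zero_or_eq_one.1 (hP.dead_le _)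
    by_cases hkill : (L.wt e = 1 ∧ σ.mem 24 (L.src e) - 1 ≠ 0) ∨ σ.mem 25 (L.src e) = 1
    · refine ⟨t, _, rem.erase e, sp, l, hr, ⟨?_, ?_, e9, hfr'⟩, ?_, by omega⟩
      · have := s1 (by
          rcases hkill with ⟨h1, h2⟩ | h
          · exact Or.inl ⟨h1, by rw [if_pos h1, Function.update_self]; exact h2⟩
          · exact Or.inr h)
        rcases hsplit with hw | hw <;> by_cases hc : σ.mem 24 (L.src e) - 1 = 0 <;>
          rcases hdsplit with hd | hd <;>
          simp_all [solveEdge, block, Prog.exec]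
      · rcases hsplit with hw | hw <;> by_cases hc : σ.mem 24 (L.src e) - 1 = 0 <;>
          rcases hdsplit with hd | hd <;>
          simp_all [solveEdge, block, Prog.exec]
      · rcases hsplit with hw | hw <;> by_cases hc : σ.mem 24 (L.src e) - 1 = 0 <;>
          rcases hdsplit with hd | hd <;>
          simp_all [solveEdge, block, Prog.exec]
    · have hd : σ.mem 25 (L.src e) = 0 := hdsplit.resolve_right fun h => hkill (Or.inr h)
      have hw' : ¬ (L.wt e = 1 ∧ σ.mem 24 (L.src e) - 1 ≠ 0) := fun h => hkill (Or.inl h)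
      refine ⟨t, _, rem.erase e, sp + 1, l, hr, ⟨?_, ?_, e9, hfr'⟩, ?_, by omega⟩
      · have := s2 (by
          rintro ⟨h1, h2⟩
          rw [if_pos h1, Function.update_self] at h2
          exact hw' ⟨h1, h2⟩) hd
        rcases hsplit with hw | hw <;> by_cases hc : σ.mem 24 (L.src e) - 1 = 0 <;>
          simp_all [solveEdge, block, Prog.exec]
      · rcases hsplit with hw | hw <;> by_cases hc : σ.mem 24 (L.src e) - 1 = 0 <;>
          simp_all [solveEdge, block, Prog.exec]
      · rcases hsplit with hw | hw <;> by_cases hc : σ.mem 24 (L.src e) - 1 = 0 <;>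
          simp_all [solveEdge, block, Prog.exec]

/-- Dead nodes lie in no consistent set, and when the stack is empty the surviving nodes form a
consistent set; so survival is membership in the largest one. Each edge is processed at most once,
which makes the time linear. -/
theorem tri_solve {L : Edges} {σ₀ : Store} (hG : GraphOn L σ₀) (h25 : ∀ q, σ₀.mem 25 q = 0) :
    Tri solve σ₀ (30 * L.length + 20) fun σ =>
      ∀ g, (σ.mem 25 g = 0 ↔ ∃ B, Consistent L B ∧ B g) ∧ σ.mem 25 g ≤ 1 := by
  have outer := run_loop (Γ := Finset ℕ × ℕ) (x := 12)
    (p := .seq (.block [.const 9 1, .sub 12 12 9, .load 13 26 12, .load 14 23 13])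
      (.loop 14 solveEdge))
    (fun γ σ => PropOn L σ₀ γ.1 γ.2 0 [] σ) (fun γ => 30 * γ.1.card + 10 * γ.2) (by
      rintro ⟨rem, sp⟩ σ ⟨hP, hsp, h9, hfr⟩ hx
      simp only at hP hsp ⊢
      obtain ⟨sp, rfl⟩ : ∃ k, sp = k + 1 := ⟨sp - 1, by omega⟩
      set cur := σ.mem 26 sp with hcur
      obtain ⟨l, hl1, hl2, hl3⟩ := hG.linked cur
      obtain ⟨t, ht, hr⟩ := Run.exec (p := .block [.const 9 1, .sub 12 12 9, .load 13 26 12,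
        .load 14 23 13]) rfl σ
      set σ₁ := (Prog.block [.const 9 1, .sub 12 12 9, .load 13 26 12,
        .load 14 23 13]).exec σ with hσ₁
      have hmem : σ₁.mem = σ.mem := by simp [hσ₁, block, Prog.exec]
      have hcd : σ.mem 25 cur = 1 := hP.stk_dead sp (Nat.lt_succ_self _)
      have h1 : PropOn L σ₀ rem sp cur l σ₁ := by
        refine ⟨?_, by simp [hσ₁, block, Prog.exec, hsp], by simp [hσ₁, block, Prog.exec],
          by rw [hmem]; exact hfr⟩
        rw [hmem]
        have hncur : ∀ k < sp, σ.mem 26 k ≠ cur := fun k hk hh => by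
          have := hP.stk_inj k (by omega) sp (Nat.lt_succ_self _) hh
          omega
        refine ⟨hP.rem_lt, hP.cnt_eq, hP.dead_le, hP.dead_zero,
            fun k hk => hP.stk_dead k (by omega),
          fun k hk k' hk' => hP.stk_inj k (by omega) k' (by omega),
          fun e h1 h2 => ⟨(hP.done e h1 h2).1, fun k hk => (hP.done e h1 h2).2 k (by omega)⟩,
          fun e h1 h2 => ?_, hP.and_dead, hP.or_dead, hP.sound, hl2, fun e he => ?_,
          fun _ => ⟨hcd, hncur⟩⟩
        · rcases hP.todo e h1 h2 with ⟨k, hk, hkk⟩ | h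
          · rcases (show k ≤ sp by omega).lt_or_eq with hlt | rfl
            · exact Or.inl ⟨k, hlt, hkk⟩
            · exact Or.inr ((hl3 e).2 ⟨hP.rem_lt e h1, hkk.symm⟩)
          · simp at h
        · obtain ⟨h1, h2⟩ := (hl3 e).1 he
          refine ⟨?_, h2⟩
          by_contra hcon
          exact (hP.done e h1 hcon).2 sp (Nat.lt_succ_self _) h2.symm
      have h14 : Linked (σ₀.mem 22) (σ₁.reg 14) l := by
        have : σ₁.reg 14 = σ₀.mem 23 cur := by
          simp [hσ₁, block, Prog.exec, hsp, hfr 23 (by norm_num), hcur]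
        rw [this]
        exact hl1
      obtain ⟨t', σ', ⟨⟨rem', sp'⟩, l'⟩, hr', ⟨hP', hl'⟩, hx', ht'⟩ := run_loop
        (Γ := (Finset ℕ × ℕ) × List ℕ) (x := 14) (p := solveEdge)
        (fun γ σ => PropOn L σ₀ γ.1.1 γ.1.2 cur γ.2 σ ∧ Linked (σ₀.mem 22) (σ.reg 14) γ.2)
        (fun γ => 30 * γ.1.1.card + 10 * γ.1.2) (by
          rintro ⟨⟨rem, sp⟩, l⟩ σ ⟨hP, hl⟩ hx
          obtain ⟨t, σ', rem', sp', l', h1, h2, h3, h4⟩ := run_solveEdge hG hP hl hx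
          exact ⟨t, σ', ⟨⟨rem', sp'⟩, l'⟩, h1, ⟨h2, h3⟩, h4⟩)
        ((rem, sp), l) σ₁ ⟨h1, h14⟩
      have hnil : l' = [] := by
        cases l' with
        | nil => rfl
        | cons e l' =>
          have := hl'.1
          omega
      subst hnil
      refine ⟨t + t', σ', (rem', sp'), .seq hr hr', ⟨⟨hP'.1.rem_lt, hP'.1.cnt_eq, hP'.1.dead_le,
        hP'.1.dead_zero, hP'.1.stk_dead, hP'.1.stk_inj, hP'.1.done, hP'.1.todo, hP'.1.and_dead,
        hP'.1.or_dead, hP'.1.sound, hP'.1.nodup, by simp, by simp⟩, hP'.2⟩, ?_⟩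
      -- A popped node releases 10 units of potential, enough for the 4 set-up steps and the two
      -- loop tests.
      have hc : (Prog.block [.const 9 1, .sub 12 12 9, .load 13 26 12, .load 14 23 13]).cost = 4 :=
        rfl
      simp only at ht' ⊢
      omega)
  obtain ⟨t, ht, hr⟩ := Run.exec (p := .block [.const 9 1, .const 13 0, .store 26 13 13,
    .store 25 13 9, .const 12 1]) rfl σ₀
  set σ₁ := (Prog.block [.const 9 1, .const 13 0, .store 26 13 13,
    .store 25 13 9, .const 12 1]).exec σ₀ with hσ₁
  have hd : σ₁.mem 25 = Function.update (σ₀.mem 25) 0 1 := by simp [hσ₁, block, Prog.exec]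
  have h1 : PropOn L σ₀ (Finset.range L.length) 1 0 [] σ₁ := by
    have hd1 : ∀ q, σ₁.mem 25 q = 1 ↔ q = 0 := by
      intro q
      rw [hd, Function.update_apply, h25]
      split_ifs <;> simp_all
    have hs0 : σ₁.mem 26 0 = 0 := by simp [hσ₁, block, Prog.exec]
    refine ⟨⟨fun e he => Finset.mem_range.1 he, ?_, fun q => ?_, (hd1 0).2 rfl, fun k hk => ?_,
      fun k hk k' hk' _ => by omega, fun e h1 h2 => absurd (Finset.mem_range.2 h1) h2,
      fun e h1 h2 => ?_, fun e h1 h2 => absurd (Finset.mem_range.2 h1) h2, fun e h1 h2 h3 => ?_,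
      fun B hB q hq => ?_, List.nodup_nil, by simp, by simp⟩, ?_, ?_, ?_⟩
    · have : σ₁.mem 24 = σ₀.mem 24 := by simp [hσ₁, block, Prog.exec]
      rw [this]
      exact hG.cnt_eq
    · rw [hd, Function.update_apply, h25]
      split_ifs <;> simp
    · obtain rfl : k = 0 := by omega
      rw [hs0]
      exact (hd1 0).2 rfl
    · exact Or.inl ⟨0, by omega, by rw [hs0, (hd1 _).1 h2]⟩
    · exact absurd ⟨rfl, h2⟩ (h3 e (Finset.mem_range.2 h1))
    · rw [(hd1 q).1 hq]; exact hB.1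
    · simp [hσ₁, block, Prog.exec]
    · simp [hσ₁, block, Prog.exec]
    · intro b hb
      rw [hr.frame.2 b]
      simp only [block, modM, Bool.or_false, Bool.false_or, Bool.or_eq_false_iff,
        beq_eq_false_iff_ne, ne_eq]
      omega
  obtain ⟨t', σ', ⟨rem, sp⟩, hr', ⟨hP, hsp, -, hfr⟩, hx, ht'⟩ := outer (Finset.range L.length,
      1) σ₁ h1
  refine ⟨t + t', σ', .seq hr hr', ?_, fun g => ⟨⟨fun hg => ?_, ?_⟩, hP.dead_le g⟩⟩
  · have hc : (Prog.block [.const 9 1, .const 13 0, .store 26 13 13,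
      .store 25 13 9, .const 12 1]).cost = 5 := rfl
    simp only [Finset.card_range] at ht'
    omega
  · simp only at hP hsp
    obtain rfl : sp = 0 := by omega
    -- The surviving nodes are the witness. An unprocessed edge has a surviving target, since the
    -- stack is empty; a surviving node with alternatives still has an unprocessed one.
    refine ⟨fun q => σ'.mem 25 q = 0, ⟨by simp [hP.dead_zero], fun q p w hmem hq => ?_⟩, hg⟩
    obtain ⟨e, he, rfl, rfl, rfl⟩ := Edges.exists_of_mem hmem
    have alive : ∀ e ∈ rem, σ'.mem 25 (L.dst e) = 0 := by
      intro e' he'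
      have := hP.dead_le (L.dst e')
      by_contra hcon
      have := hP.todo e' he' (by omega)
      simp at this
    constructor
    · intro hw
      by_cases her : e ∈ rem
      · exact alive e her
      · have := hP.and_dead e he her hw
        omega
    · intro hw
      by_contra hcon
      have := hP.or_dead e he hw fun e' he' hh => hcon
        ⟨L.dst e', by rw [← hh.1, ← hh.2]; exact Edges.mem_of_lt (hP.rem_lt e' he'), alive e' he'⟩
      omega
  · rintro ⟨B, hB, hBg⟩
    have := hP.dead_le g
    by_contra hcon
    exact hP.sound B hB g (by omega) hBg

end RTC

/-! ### Enumeration of the reachable configurations. -/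

namespace RTC

open Prog

theorem Framed.refl (p : Prog) (σ : Store) : Framed p σ σ := ⟨fun _ _ => rfl, fun _ _ => rfl⟩

theorem Framed.trans {p : Prog} {σ₁ σ₂ σ₃ : Store} (h : Framed p σ₁ σ₂) (h' : Framed p σ₂ σ₃) :
    Framed p σ₁ σ₃ :=
  ⟨fun y hy => (h'.1 y hy).trans (h.1 y hy), fun b hb => (h'.2 b hb).trans (h.2 b hb)⟩

/-- The rule for `for`-loops, with the facts that the loop cannot change at hand. -/
theorem Tri.forLoop_framed {r n : ℕ} {body : Prog} {σ : Store} {N T : ℕ}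
    (Inv : ℕ → Store → Prop) (hn : σ.reg n = N)
    (hfr : body.modR r = false ∧ body.modR n = false ∧ r ≠ n ∧ r ≠ 6 ∧ r ≠ 7 ∧ n ≠ 6 ∧ n ≠ 7)
    (h0 : Inv 0 ((σ.setReg r 0).setReg 6 N))
    (hstep : ∀ i σ', i < N → Inv i σ' → σ'.reg r = i → Framed (.forLoop r n body) σ σ' →
      Tri body σ' T fun σ'' =>
        Inv (i + 1) (((σ''.setReg 7 1).setReg r (i + 1)).setReg 6 (N - (i + 1)))) :
    Tri (.forLoop r n body) σ (N * (T + 4) + 3) (Inv N) := by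
  have hmod : ∀ y, (Prog.forLoop r n body).modR y = false →
      body.modR y = false ∧ y ≠ r ∧ y ≠ 6 ∧ y ≠ 7 := by
    intro y hy
    simp only [Prog.forLoop, modR, Bool.or_eq_false_iff, beq_eq_false_iff_ne] at hy
    exact ⟨hy.2.2.1, Ne.symm hy.1, Ne.symm hy.2.1, Ne.symm hy.2.2.2.1⟩
  have hmem : ∀ b, (Prog.forLoop r n body).modM b = false → body.modM b = false := by
    intro b hb
    simpa [Prog.forLoop, modM] using hb
  refine (Tri.forLoop (T := T) (fun i σ' => Inv i σ' ∧ Framed (.forLoop r n body) σ σ') hn hfr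
    ⟨h0, fun y hy => ?_, fun _ _ => rfl⟩ ?_).mono le_rfl fun _ _ h => h.1
  · obtain ⟨-, h1, h2, -⟩ := hmod y hy
    simp [h1, h2]
  · rintro i σ' hi ⟨hI, hF⟩ hr -
    refine (hstep i σ' hi hI hr hF).mono le_rfl fun σ'' hF' hI' => ⟨hI', fun y hy => ?_,
      fun b hb => ?_⟩
    · obtain ⟨h1, h2, h3, h4⟩ := hmod y hy
      simp [h2, h3, h4, hF'.1 y h1, hF.1 y hy]
    · simp [hF'.2 b (hmem b hb), hF.2 b hb]

/-! ### Enumeration of the reachable configurations -/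

theorem rowMajor_eq {r c : ℕ} (g : Fin r → Fin c → ℕ) (i : Fin r) (j : Fin c) :
    rowMajor g (i.val * c + j.val) = g i j := by
  have h1 : (i.val * c + j.val) / c = i.val := by
    rw [Nat.mul_comm, Nat.mul_add_div (by have := j.2; omega), Nat.div_eq_of_lt j.2, Nat.add_zero]
  have h2 : (i.val * c + j.val) % c = j.val := by
    rw [Nat.mul_comm, Nat.mul_add_mod, Nat.mod_eq_of_lt j.2]
  have h : (i.val * c + j.val) / c < r ∧ (i.val * c + j.val) % c < c := by
    rw [h1, h2]; exact ⟨i.2, j.2⟩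
  rw [rowMajor, dif_pos h]
  congr 1 <;> exact Fin.ext (by assumption)

/-- The number with leading part `q` and the binary digits `bits 0, …, bits (k - 1)`. -/
def pack (q : ℕ) (bits : ℕ → ℕ) : ℕ → ℕ
  | 0 => q
  | k + 1 => pack q bits k + pack q bits k + bits k

/-- The last binary digit is recovered by parity, the rest by induction. Thus a configuration can
serve as an array index. -/
theorem pack_inj {q q' : ℕ} {bits bits' : ℕ → ℕ} {k : ℕ} (hb : ∀ f < k, bits f ≤ 1)
    (hb' : ∀ f < k, bits' f ≤ 1) (h : pack q bits k = pack q' bits' k) :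
    q = q' ∧ ∀ f < k, bits f = bits' f := by
  induction k with
  | zero => exact ⟨h, fun f hf => absurd hf (Nat.not_lt_zero f)⟩
  | succ k ih =>
    simp only [pack] at h
    have h1 := hb k (Nat.lt_succ_self _)
    have h2 := hb' k (Nat.lt_succ_self _)
    obtain ⟨e1, e2⟩ := ih (fun f hf => hb f (by omega)) (fun f hf => hb' f (by omega)) (by omega)
    refine ⟨e1, fun f hf => ?_⟩
    rcases Nat.lt_succ_iff_lt_or_eq.1 hf with hf | rfl
    · exact e2 f hf
    · omega

namespace RTCInstance

variable (I : RTCInstance)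

/-- A state of the environment with truth values of the fluents. -/
abbrev BConf : Type := Fin I.s × (Fin I.k → Bool)

variable {I}

/-- The truth value of the fluent number `f` as a digit. -/
def BConf.bit (x : I.BConf) (f : ℕ) : ℕ := if h : f < I.k then (x.2 ⟨f, h⟩).toNat else 0

/-- The code of a configuration. -/
def BConf.key (x : I.BConf) : ℕ := pack x.1 x.bit I.k

theorem BConf.bit_le (x : I.BConf) (f : ℕ) : x.bit f ≤ 1 := by
  unfold BConf.bit
  split_ifs
  · exact Bool.toNat_le _
  · exact Nat.zero_le _

theorem BConf.key_inj {x y : I.BConf} (h : x.key = y.key) : x = y := by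
  obtain ⟨h1, h2⟩ := pack_inj (fun f _ => x.bit_le f) (fun f _ => y.bit_le f) h
  refine Prod.ext (Fin.ext h1) (funext fun f => ?_)
  have := h2 f f.2
  simp only [BConf.bit, f.2, dif_pos] at this
  revert this
  cases x.2 f <;> cases y.2 f <;> simp

/-- Reachability of a configuration. -/
def BConf.IsReach (x : I.BConf) : Prop := I.Config x.1 fun f => x.2 f = true

open Classical in
/-- The effect of an action on a configuration. -/
noncomputable def BConf.step (x : I.BConf) (a : Fin I.α) : Option I.BConf :=
  (I.next x.1 a).map fun q => (q, fun f => decide (a ∈ (I.fluents f).initiating) ||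
    (x.2 f && !decide (a ∈ (I.fluents f).terminating)))

theorem BConf.IsReach.step {x y : I.BConf} (hx : x.IsReach) {a : Fin I.α}
    (h : x.step a = some y) : y.IsReach := by
  simp only [BConf.step, Option.map_eq_some_iff] at h
  obtain ⟨q, hq, rfl⟩ := h
  simpa [BConf.IsReach] using Config.step hx hq

/-- The initial configuration. -/
def bInit (I : RTCInstance) : I.BConf := (I.init, fun f => (I.fluents f).initially)

/-- Only reachable configurations are ever listed, each once. This bound turns the length of the
list into `N`, rather than into 2 ^ k times the number of states. -/
theorem length_le_numStates {cs : List I.BConf} (hn : cs.Nodup) (hr : ∀ x ∈ cs, x.IsReach) :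
    cs.length ≤ I.numStates := by
  classical
  refine le_trans ?_ (le_max_right _ _)
  rw [← List.toFinset_card_of_nodup hn, ← Set.ncard_coe_finset]
  refine Set.ncard_le_ncard_of_injOn (fun x => (x.1, fun f => x.2 f = true)) ?_ ?_ (Set.toFinite _)
  · intro x hx
    exact hr x (by simpa using hx)
  · rintro ⟨q, v⟩ - ⟨q', v'⟩ - h
    simp only [Prod.mk.injEq] at h
    refine Prod.ext h.1 (funext fun f => ?_)
    have := congrFun h.2 f
    simpa using this

/-- The entry of the successor table: the number of the successor plus one, or zero. -/
noncomputable def succIdx (cs : List I.BConf) (x : I.BConf) (a : Fin I.α) : ℕ :=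
  (x.step a).elim 0 fun y => cs.idxOf y + 1

/-- The arrays represent the list `cs` of configurations. -/
structure ConfAt (I : RTCInstance) (cs : List I.BConf) (nc nck : ℕ) (cq cv idx : ℕ → ℕ) :
    Prop where
  nc_eq : nc = cs.length
  nck_eq : nck = cs.length * I.k
  cq_eq : ∀ c (h : c < cs.length), cq c = (cs[c]).1
  cv_eq : ∀ c (h : c < cs.length), ∀ f < I.k, cv (c * I.k + f) = (cs[c]).bit f
  idx_eq : ∀ x : I.BConf, idx x.key = if x ∈ cs then cs.idxOf x + 1 else 0
  nodup : cs.Nodup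
  reach : ∀ x ∈ cs, x.IsReach
  init : cs[0]? = some I.bInit

/-- The first `p` entries of the successor table are correct. -/
def SuccAt (cs : List I.BConf) (p : ℕ) (succ : ℕ → ℕ) : Prop :=
  ∀ c (h : c < cs.length) (a : Fin I.α), c * I.α + a < p →
    succ (c * I.α + a) = succIdx cs cs[c] a ∧ ∀ y, (cs[c]).step a = some y → y ∈ cs

theorem ConfAt.append {cs : List I.BConf} {nc nck : ℕ} {cq cv idx : ℕ → ℕ}
    (h : ConfAt I cs nc nck cq cv idx) {x : I.BConf} (hx : x ∉ cs) (hr : x.IsReach)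
    (hcv : ∀ f < I.k, cv (nck + f) = x.bit f) :
    ConfAt I (cs ++ [x]) (nc + 1) (nck + I.k) (Function.update cq nc x.1) cv
      (Function.update idx x.key (nc + 1)) := by
  obtain ⟨rfl, rfl, h1, h2, h3, h4, h5, h6⟩ := h
  have hlen : (cs ++ [x]).length = cs.length + 1 := by simp
  refine ⟨by simp, by simp [Nat.succ_mul], fun c hc => ?_, fun c hc f hf => ?_, fun y => ?_, ?_,
      ?_, ?_⟩
  · rw [hlen] at hc
    rcases Nat.lt_succ_iff_lt_or_eq.1 hc with hc | rfl
    · rw [Function.update_of_ne hc.ne, h1 c hc, List.getElem_append_left hc]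
    · simp
  · rw [hlen] at hc
    rcases Nat.lt_succ_iff_lt_or_eq.1 hc with hc | rfl
    · rw [h2 c hc f hf, List.getElem_append_left hc]
    · simp [hcv f hf]
  · by_cases hy : y = x
    · subst hy
      simp [List.idxOf_append_of_notMem hx]
    · rw [Function.update_of_ne fun hk => hy (BConf.key_inj hk), h3]
      by_cases hyc : y ∈ cs
      · simp [hyc, List.idxOf_append_of_mem hyc]
      · simp [hyc, hy]
  · exact List.nodup_append.2 ⟨h4, by simp, by rintro a ha b hb rfl; simp at hb; exact hx (hb ▸ ha)⟩
  · intro y hy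
    rcases List.mem_append.1 hy with hy | hy
    · exact h5 y hy
    · simp at hy; exact hy ▸ hr
  · rw [List.getElem?_append_left]
    · exact h6
    · by_contra hcon
      rw [List.getElem?_eq_none (by omega)] at h6
      simp at h6

/-- Appending does not change the positions of the configurations listed before, so known entries of
the successor table stay valid. -/
theorem SuccAt.append {cs : List I.BConf} {p : ℕ} {succ : ℕ → ℕ} (h : SuccAt cs p succ)
    (x : I.BConf) (hp : p ≤ cs.length * I.α) : SuccAt (cs ++ [x]) p succ := by
  intro c hc a hca
  have hc' : c < cs.length := by
    by_contra hcon
    have := Nat.mul_le_mul_right I.α (Nat.le_of_not_lt hcon)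
    omega
  rw [List.getElem_append_left hc']
  obtain ⟨h1, h2⟩ := h c hc' a hca
  refine ⟨?_, fun y hy => List.mem_append_left _ (h2 y hy)⟩
  rw [h1, succIdx, succIdx]
  cases hs : (cs[c]).step a with
  | none => rfl
  | some y => simp [List.idxOf_append_of_mem (h2 y hs)]

/-- The entries of the fluent table. -/
theorem input_mem_two (I : RTCInstance) (f : Fin I.k) (a : Fin I.α) (x : I.BConf)
    {y : I.BConf} (hy : x.step a = some y) :
    (I.input.mem 2 (f.val * I.α + a.val) = 0 → y.bit f = x.bit f) ∧
      (I.input.mem 2 (f.val * I.α + a.val) ≠ 0 → y.bit f = 2 - I.input.mem 2 (f.val * I.α + a.val))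
          := by
  classical
  have hm : I.input.mem 2 (f.val * I.α + a.val) = if a ∈ (I.fluents f).initiating then 1
        else if a ∈ (I.fluents f).terminating then 2 else 0 := by
    have : I.input.mem 2 = rowMajor fun (f : Fin I.k) (a : Fin I.α) =>
        if a ∈ (I.fluents f).initiating then 1
        else if a ∈ (I.fluents f).terminating then 2 else 0 := by
      unfold input
      simp only
    rw [this, rowMajor_eq]
  simp only [BConf.step, Option.map_eq_some_iff] at hy
  obtain ⟨q, hq, rfl⟩ := hy
  rw [hm]
  simp only [BConf.bit, f.2, dif_pos]
  split_ifs <;> simp_all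

end RTCInstance

/-- Compute the successor configuration in the next free place and its code. -/
def succBits : Prog :=
  .block [.load 36 2 34, .add 31 26 35, .load 37 12 31,
    -- Table entries `1` (initiating) and `2` (terminating) become the digits `2 - 1` and `2 - 2`;
    -- entry `0` keeps the old digit.
    .ite 36 (.seq (.const 38 2) (.sub 37 38 36)) (.const 38 0),
    .add 31 27 35, .store 12 31 37, .add 33 33 33, .add 33 33 37, .add 34 34 1]

/-- Store the number of the successor configuration, which is added if it is new. -/
def addConf : Prog :=
  .block [.load 39 13 33, .ite 39 (.const 38 0) (.block [.store 11 24 32, .const 38 1,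
      .add 24 24 38, .add 27 27 2, .store 13 33 24, .const 38 0, .add 39 24 38]),
    .store 14 28 39]

/-- Determine the successor under an action. -/
def succConf : Prog :=
  .seq (.seq (.add 31 29 30) (.load 32 0 31))
    (.seq (.ite 32
      (.seq (.block [.const 38 1, .sub 32 32 38, .const 38 0, .add 33 32 38, .add 34 30 38])
        (.seq (.forLoop 35 2 succBits) addConf))
      (.store 14 28 32))
    (.seq (.const 38 1) (.add 28 28 38)))

/-- The row offsets of the transition table. -/
def rowOffsets : Prog :=
  .seq (.const 41 0) (.forLoop 42 0 (.seq (.store 10 42 41) (.add 41 41 1)))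

/-- The initial configuration. -/
def initConf : Prog :=
  .seq (.block [.const 42 0, .store 11 42 5, .add 33 5 42])
    (.seq (.forLoop 35 2 (.block [.load 37 3 35, .store 12 35 37, .add 33 33 33, .add 33 33 37]))
      (.block [.const 24 1, .store 13 33 24, .const 25 0, .const 26 0, .add 27 2 25, .const 28 0,
        .const 40 1]))

/-- Enumerate the reachable configurations. -/
def enumerate : Prog :=
  .seq rowOffsets (.seq initConf (.loop 40
    (.seq (.seq (.load 42 11 25) (.load 29 10 42)) (.seq (.forLoop 30 1 succConf)
      (.block [.const 38 1, .add 25 25 38, .add 26 26 2, .sub 40 24 25])))))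

namespace RTCInstance

variable {I : RTCInstance}

/-- The input is unchanged. -/
def InputOn (I : RTCInstance) (σ : Store) : Prop :=
  (∀ x < 6, σ.reg x = I.input.reg x) ∧ ∀ b < 5, σ.mem b = I.input.mem b

/-- The candidate is written behind the digits of all listed configurations, so nothing is
overwritten and it need not be copied if it turns out to be new. -/
theorem tri_succBits {σ : Store} (hI : I.InputOn σ) {x y : I.BConf} {a : Fin I.α}
    (hy : x.step a = some y) (hx : ∀ f < I.k, σ.mem 12 (σ.reg 26 + f) = x.bit f)
    (hle : σ.reg 26 + I.k ≤ σ.reg 27) (h33 : σ.reg 33 = y.1) (h34 : σ.reg 34 = a) :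
    Tri (.forLoop 35 2 succBits) σ (I.k * 15 + 3) fun σ' =>
      σ'.reg 33 = y.key ∧ (∀ f < I.k, σ'.mem 12 (σ.reg 27 + f) = y.bit f) ∧
        ∀ p < σ.reg 27, σ'.mem 12 p = σ.mem 12 p := by
  have h2 : σ.reg 2 = I.k := hI.1 2 (by norm_num)
  have h1 : σ.reg 1 = I.α := hI.1 1 (by norm_num)
  refine (Tri.forLoop_framed (T := 11) (fun f σ' => σ'.reg 33 = pack y.1 y.bit f ∧
    σ'.reg 34 = f * I.α + a ∧ (∀ f' < f, σ'.mem 12 (σ.reg 27 + f') = y.bit f') ∧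
    ∀ p < σ.reg 27, σ'.mem 12 p = σ.mem 12 p) h2 (by decide)
    (by simp [pack, h33, h34]) ?_).mono le_rfl fun σ' _ h => ⟨h.1, h.2.2⟩
  rintro f σ' hf ⟨i1, i2, i3, i4⟩ hr hF
  have g1 : σ'.reg 1 = I.α := (hF.1 1 rfl).trans h1
  have g26 : σ'.reg 26 = σ.reg 26 := hF.1 26 rfl
  have g27 : σ'.reg 27 = σ.reg 27 := hF.1 27 rfl
  have gm : σ'.mem 2 = I.input.mem 2 := (hF.2 2 rfl).trans (hI.2 2 (by norm_num))
  have gx : σ'.mem 12 (σ.reg 26 + f) = x.bit f := by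
    rw [i4 _ (by omega)]; exact hx f hf
  obtain ⟨c1, c2⟩ := I.input_mem_two ⟨f, hf⟩ a x hy
  simp only at c1 c2
  have hbit : (((if σ'.mem 2 (σ'.reg 34) = 0 then x.bit f else 2 - σ'.mem 2 (σ'.reg 34)))) =
      y.bit f := by
    rw [i2, gm]
    split_ifs with h
    · exact (c1 h).symm
    · exact (c2 h).symm
  refine Tri.exec rfl (by decide) ?_
  have hsucc : f * I.α + a + I.α = (f + 1) * I.α + a := by ring
  have upd : ∀ v, v = y.bit f → (∀ f' < f + 1, Function.update (σ'.mem 12) (σ.reg 27 + f) v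
      (σ.reg 27 + f') = y.bit f') ∧ ∀ p < σ.reg 27, Function.update (σ'.mem 12) (σ.reg 27 + f) v p =
      σ.mem 12 p := by
    rintro v rfl
    refine ⟨fun f' hf' => ?_, fun p hp => ?_⟩
    · rcases Nat.lt_succ_iff_lt_or_eq.1 hf' with h | rfl
      · rw [Function.update_of_ne (by omega), i3 f' h]
      · rw [Function.update_self]
    · rw [Function.update_of_ne (by omega), i4 p hp]
  by_cases h0 : σ'.mem 2 (σ'.reg 34) = 0
  · rw [if_pos h0] at hbit
    rw [i2] at h0
    refine ⟨?_, ?_, ?_⟩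
    · simp [succBits, block, Prog.exec, h0, i2, g26, hr, gx, hbit, i1, pack]
    · simp [succBits, block, Prog.exec, h0, g1, i2, hsucc]
    · simpa [succBits, block, Prog.exec, h0, i2, g26, g27, hr, gx] using upd _ hbit
  · rw [if_neg h0] at hbit
    rw [i2] at h0 hbit
    refine ⟨?_, ?_, ?_⟩
    · simp [succBits, block, Prog.exec, h0, i2, hbit, i1, pack]
    · simp [succBits, block, Prog.exec, h0, g1, i2, hsucc]
    · simpa [succBits, block, Prog.exec, h0, i2, g27, hr] using upd _ hbit

/-- The store during the enumeration: the configurations `cs` have been found, and the first `p`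
entries of the successor table are known. -/
structure Enumerating (I : RTCInstance) (cs : List I.BConf) (cur p : ℕ) (σ : Store) : Prop where
  input : I.InputOn σ
  off : ∀ q < I.s, σ.mem 10 q = q * I.α
  conf : ConfAt I cs (σ.reg 24) (σ.reg 27) (σ.mem 11) (σ.mem 12) (σ.mem 13)
  cur_eq : σ.reg 25 = cur
  curk_eq : σ.reg 26 = cur * I.k
  succ : SuccAt cs p (σ.mem 14)

theorem input_mem_zero (I : RTCInstance) (q : Fin I.s) (a : Fin I.α) :
    I.input.mem 0 (q.val * I.α + a.val) = (I.next q a).elim 0 fun q' => q'.val + 1 := by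
  have : I.input.mem 0 = rowMajor fun q a => (I.next q a).elim 0 fun q' => q'.val + 1 := rfl
  rw [this, rowMajor_eq]

theorem row_inj {α c c' : ℕ} {a a' : Fin α} (h : c * α + a = c' * α + a') : c = c' ∧ a = a' := by
  have h1 := a.2
  have h2 := a'.2
  have : c = c' := by
    rcases lt_trichotomy c c' with h3 | h3 | h3
    · have := Nat.mul_le_mul_right α h3
      rw [Nat.succ_mul] at this
      omega
    · exact h3
    · have := Nat.mul_le_mul_right α h3
      rw [Nat.succ_mul] at this
      omega
  subst this
  exact ⟨rfl, Fin.ext (by omega)⟩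

theorem SuccAt.set {cs : List I.BConf} {cur : ℕ} {a : Fin I.α} {succ : ℕ → ℕ}
    (h : SuccAt cs (cur * I.α + a) succ) {x : I.BConf} (hx : cs[cur]? = some x)
    (hy : ∀ y, x.step a = some y → y ∈ cs) :
    SuccAt cs (cur * I.α + a + 1)
      (Function.update succ (cur * I.α + a) (succIdx cs x a)) := by
  intro c hc a' hlt
  rcases Nat.lt_succ_iff_lt_or_eq.1 hlt with hlt | heq
  · rw [Function.update_of_ne hlt.ne]
    exact h c hc a' hlt
  · obtain ⟨rfl, rfl⟩ := row_inj heq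
    rw [List.getElem?_eq_getElem hc] at hx
    obtain rfl := Option.some_injective _ hx
    rw [Function.update_self]
    exact ⟨rfl, hy⟩

/-- Membership takes a single load: arrays are unbounded and initially zero, and the key of the
configuration is itself the index. -/
theorem tri_addConf {cs : List I.BConf} {cur : ℕ} {a : Fin I.α} {σ : Store}
    (h : Enumerating I cs cur (cur * I.α + a) σ) {x y : I.BConf} (hx : cs[cur]? = some x)
    (hy : x.step a = some y) (h33 : σ.reg 33 = y.key) (h32 : σ.reg 32 = y.1)
    (h28 : σ.reg 28 = cur * I.α + a) (hbit : ∀ f < I.k, σ.mem 12 (σ.reg 27 + f) = y.bit f) :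
    Tri addConf σ 10 fun σ' => (∃ cs', cs'[cur]? = some x ∧
      Enumerating I cs' cur (cur * I.α + a + 1) σ') ∧ σ'.reg 28 = σ.reg 28 := by
  have hcur : cur < cs.length := by
    by_contra hcon
    rw [List.getElem?_eq_none (by omega)] at hx
    simp at hx
  have hxr : x.IsReach := h.conf.reach x (List.mem_of_getElem? hx)
  have hidx := h.conf.idx_eq y
  refine Tri.exec rfl (by decide) ⟨?_, ?_⟩
  · by_cases hyc : y ∈ cs
    · rw [if_pos hyc] at hidx
      have hne : σ.mem 13 y.key ≠ 0 := by omega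
      refine ⟨cs, hx, ⟨?_, ?_⟩, ?_, ?_, ?_, ?_, ?_⟩
      · intro r hr
        rw [← h.input.1 r hr]
        have : r ≠ 39 ∧ r ≠ 38 := by omega
        simp [addConf, block, Prog.exec, h33, hne, this]
      · intro b hb
        rw [← h.input.2 b hb]
        have : b ≠ 14 := by omega
        simp [addConf, block, Prog.exec, h33, hne, this]
      · simpa [addConf, block, Prog.exec, h33, hne] using h.off
      · simpa [addConf, block, Prog.exec, h33, hne] using h.conf
      · simpa [addConf, block, Prog.exec, h33, hne] using h.cur_eq
      · simpa [addConf, block, Prog.exec, h33, hne] using h.curk_eq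
      · have := h.succ.set hx (fun z hz => by
          obtain rfl := Option.some_injective _ (hy.symm.trans hz)
          exact hyc)
        have hs : succIdx cs x a = cs.idxOf y + 1 := by simp [succIdx, hy]
        rw [hs] at this
        simpa [addConf, block, Prog.exec, h33, hne, h28, hidx] using this
    · rw [if_neg hyc] at hidx
      have hc' := h.conf.append hyc (hxr.step hy) hbit
      have hx' : (cs ++ [y])[cur]? = some x := by
        rw [List.getElem?_append_left hcur]; exact hx
      have h2 : σ.reg 2 = I.k := h.input.1 2 (by norm_num)
      refine ⟨cs ++ [y], hx', ⟨?_, ?_⟩, ?_, ?_, ?_, ?_, ?_⟩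
      · intro r hr
        rw [← h.input.1 r hr]
        have : r ≠ 39 ∧ r ≠ 38 ∧ r ≠ 24 ∧ r ≠ 27 := by omega
        simp [addConf, block, Prog.exec, h33, hidx, this]
      · intro b hb
        rw [← h.input.2 b hb]
        have : b ≠ 14 ∧ b ≠ 11 ∧ b ≠ 13 := by omega
        simp [addConf, block, Prog.exec, h33, hidx, this]
      · simpa [addConf, block, Prog.exec, h33, hidx] using h.off
      · simpa [addConf, block, Prog.exec, h33, hidx, h32, h2] using hc'
      · simpa [addConf, block, Prog.exec, h33, hidx] using h.cur_eq
      · simpa [addConf, block, Prog.exec, h33, hidx] using h.curk_eq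
      · have hle : cur * I.α + a ≤ cs.length * I.α := by
          have := Nat.mul_le_mul_right I.α hcur
          rw [Nat.succ_mul] at this
          have := a.2
          omega
        have := (h.succ.append y hle).set hx' (fun z hz => by
          obtain rfl := Option.some_injective _ (hy.symm.trans hz)
          simp)
        have hs : succIdx (cs ++ [y]) x a = σ.reg 24 + 1 := by
          simp [succIdx, hy, List.idxOf_append_of_notMem hyc, h.conf.nc_eq]
        rw [hs] at this
        simpa [addConf, block, Prog.exec, h33, hidx, h28] using this
  · by_cases h0 : σ.mem 13 y.key = 0 <;>
      simp [addConf, block, Prog.exec, h33, h0]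

theorem Enumerating.congr {cs : List I.BConf} {cur p : ℕ} {σ σ' : Store}
    (h : Enumerating I cs cur p σ) (hr : ∀ x, x < 6 ∨ (24 ≤ x ∧ x < 28) → σ'.reg x = σ.reg x)
    (hm : ∀ b < 15, σ'.mem b = σ.mem b) : Enumerating I cs cur p σ' := by
  refine ⟨⟨fun x hx => ?_, fun b hb => ?_⟩, ?_, ?_, ?_, ?_, ?_⟩
  · rw [hr x (Or.inl hx), h.input.1 x hx]
  · rw [hm b (by omega), h.input.2 b hb]
  · rw [hm 10 (by norm_num)]; exact h.off
  · rw [hr 24 (by norm_num), hr 27 (by norm_num), hm 11 (by norm_num), hm 12 (by norm_num),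
      hm 13 (by norm_num)]
    exact h.conf
  · rw [hr 25 (by norm_num)]; exact h.cur_eq
  · rw [hr 26 (by norm_num)]; exact h.curk_eq
  · rw [hm 14 (by norm_num)]; exact h.succ

theorem tri_succConf {cs : List I.BConf} {cur : ℕ} {a : Fin I.α} {σ : Store}
    (h : Enumerating I cs cur (cur * I.α + a) σ) {x : I.BConf} (hx : cs[cur]? = some x)
    (h29 : σ.reg 29 = x.1 * I.α) (h30 : σ.reg 30 = a) (h28 : σ.reg 28 = cur * I.α + a) :
    Tri succConf σ (I.k * 15 + 30) fun σ' => (∃ cs', cs'[cur]? = some x ∧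
      Enumerating I cs' cur (cur * I.α + a + 1) σ') ∧ σ'.reg 28 = cur * I.α + a + 1 := by
  have hcur : cur < cs.length := by
    by_contra hcon
    rw [List.getElem?_eq_none (by omega)] at hx
    simp at hx
  have hxget : cs[cur] = x := by
    rw [List.getElem?_eq_getElem hcur] at hx
    exact Option.some_injective _ hx
  refine Tri.seq_exec (T₂ := I.k * 15 + 28) rfl ?_
    (by simp only [cost]; omega)
  set σ₁ := ((Prog.add 31 29 30).seq (.load 32 0 31)).exec σ with hσ₁
  have hE : Enumerating I cs cur (cur * I.α + a) σ₁ := h.congr (fun y hy => by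
    have : y ≠ 31 ∧ y ≠ 32 := by omega
    simp [hσ₁, Prog.exec, this]) (fun b _ => by simp [hσ₁, Prog.exec])
  have h32 : σ₁.reg 32 = (I.next x.1 a).elim 0 fun q' => q'.val + 1 := by
    simp only [hσ₁, Prog.exec, Store.reg_setReg, Store.mem_setReg, if_true]
    rw [h29, h30, h.input.2 0 (by norm_num), input_mem_zero]
  have g28 : σ₁.reg 28 = cur * I.α + a := by simp [hσ₁, Prog.exec, h28]
  have g30 : σ₁.reg 30 = a := by simp [hσ₁, Prog.exec, h30]
  refine Tri.mono (T := I.k * 15 + 25 + 1 + 2) (Tri.seq (T₁ := I.k * 15 + 25 + 1)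
    (T₂ := 2) ((Tri.ite (T := I.k * 15 + 25) (Q := fun σ' => (∃ cs', cs'[cur]? = some x ∧
      Enumerating I cs' cur (cur * I.α + a + 1) σ') ∧ σ'.reg 28 = cur * I.α + a)
      (fun hne => ?_) (fun h0 => ?_)).mono le_rfl fun σ' _ hQ => ?_)) (by omega) fun _ _ h => h
  · obtain ⟨q, hq⟩ : ∃ q, I.next x.1 a = some q := by
      cases hn : I.next x.1 a with
      | none => rw [h32, hn] at hne; simp at hne
      | some q => exact ⟨q, rfl⟩
    rw [hq] at h32
    simp only [Option.elim] at h32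
    obtain ⟨y, hy, hy1⟩ : ∃ y, x.step a = some y ∧ y.1 = q := by
      exact ⟨(q, _), by rw [BConf.step, hq, Option.map_some], rfl⟩
    refine Tri.seq_exec (T₂ := I.k * 15 + 3 + 10) rfl ?_ (by simp only [cost, block]; omega)
    set σ₂ := (block [.const 38 1, .sub 32 32 38, .const 38 0, .add 33 32 38,
      .add 34 30 38]).exec σ₁ with hσ₂
    have hE₂ : Enumerating I cs cur (cur * I.α + a) σ₂ := hE.congr (fun y hy => by
      have : y ≠ 32 ∧ y ≠ 33 ∧ y ≠ 34 ∧ y ≠ 38 := by omega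
      simp [hσ₂, block, Prog.exec, this]) (fun b _ => by simp [hσ₂, block, Prog.exec])
    have k33 : σ₂.reg 33 = y.1 := by simp [hσ₂, block, Prog.exec, h32, hy1]
    have k32 : σ₂.reg 32 = y.1 := by simp [hσ₂, block, Prog.exec, h32, hy1]
    have k34 : σ₂.reg 34 = a := by simp [hσ₂, block, Prog.exec, g30]
    have k28 : σ₂.reg 28 = cur * I.α + a := by simp [hσ₂, block, Prog.exec, g28]
    have hle : σ₂.reg 26 + I.k ≤ σ₂.reg 27 := by
      rw [hE₂.curk_eq, hE₂.conf.nck_eq, ← Nat.succ_mul]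
      exact Nat.mul_le_mul_right _ hcur
    refine Tri.seq ((tri_succBits hE₂.input hy (fun f hf => ?_) hle k33 k34).mono le_rfl
      fun σ₃ hF hQ => ?_)
    · rw [hE₂.curk_eq, hE₂.conf.cv_eq cur hcur f hf, hxget]
    obtain ⟨b1, b2, b3⟩ := hQ
    have f26 : σ₃.reg 26 = σ₂.reg 26 := hF.1 26 rfl
    have f27 : σ₃.reg 27 = σ₂.reg 27 := hF.1 27 rfl
    have hE₃ : Enumerating I cs cur (cur * I.α + a) σ₃ := by
      refine ⟨⟨fun r hr => ?_, fun b hb => ?_⟩, ?_, ?_, ?_, ?_, ?_⟩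
      · rw [hF.1 r, hE₂.input.1 r hr]
        interval_cases r <;> rfl
      · rw [hF.2 b, hE₂.input.2 b hb]
        interval_cases b <;> rfl
      · rw [hF.2 10 rfl]; exact hE₂.off
      · rw [hF.1 24 rfl, f27, hF.2 11 rfl, hF.2 13 rfl]
        refine { hE₂.conf with cv_eq := fun c hc f hf => ?_ }
        rw [b3, hE₂.conf.cv_eq c hc f hf]
        rw [hE₂.conf.nck_eq]
        have := Nat.mul_le_mul_right I.k hc
        rw [Nat.succ_mul] at this
        omega
      · rw [hF.1 25 rfl]; exact hE₂.cur_eq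
      · rw [f26]; exact hE₂.curk_eq
      · rw [hF.2 14 rfl]; exact hE₂.succ
    have l28 : σ₃.reg 28 = cur * I.α + a := (hF.1 28 rfl).trans k28
    refine (tri_addConf hE₃ hx hy b1 ((hF.1 32 rfl).trans k32) l28
      (fun f hf => by rw [f27]; exact b2 f hf)).mono le_rfl fun σ' _ h => ⟨h.1, h.2.trans l28⟩
  · have hn : I.next x.1 a = none := by
      cases hn : I.next x.1 a with
      | none => rfl
      | some q => rw [h32, hn] at h0; simp at h0
    have hs : x.step a = none := by simp [BConf.step, hn]
    refine Tri.exec rfl (by simp only [cost]; omega) ⟨⟨cs, hx, ⟨hE.input.1, fun b hb => ?_⟩, ?_, ?_,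
      hE.cur_eq, hE.curk_eq, ?_⟩, g28⟩
    · have : b ≠ 14 := by omega
      simp only [Prog.exec, Store.mem_setMem, this, if_false]
      exact hE.input.2 b hb
    · simpa [Prog.exec] using hE.off
    · simpa [Prog.exec] using hE.conf
    · have := hE.succ.set hx (fun y hy => by rw [hs] at hy; simp at hy)
      have hsi : succIdx cs x a = 0 := by simp [succIdx, hs]
      rw [hsi] at this
      simpa [Prog.exec, g28, h0] using this
  · obtain ⟨⟨cs', hx', hE'⟩, h28'⟩ := hQ
    refine Tri.exec rfl (by decide) ⟨⟨cs', hx', hE'.congr (fun y hy => ?_)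
      (fun b _ => by simp [Prog.exec])⟩, by simp [Prog.exec, h28']⟩
    have : y ≠ 28 ∧ y ≠ 38 := by omega
    simp [Prog.exec, this]

theorem tri_rowOffsets {σ : Store} (h : I.InputOn σ) :
    Tri rowOffsets σ (I.s * 6 + 4) fun σ' => ∀ q < I.s, σ'.mem 10 q = q * I.α := by
  have h0 : σ.reg 0 = I.s := h.1 0 (by norm_num)
  have h1 : σ.reg 1 = I.α := h.1 1 (by norm_num)
  refine Tri.seq_exec (T₂ := I.s * (2 + 4) + 3) rfl ?_ (by simp only [cost]; omega)
  refine (Tri.forLoop_framed (T := 2) (fun i σ' => σ'.reg 41 = i * I.α ∧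
    ∀ q < i, σ'.mem 10 q = q * I.α) (by simpa [Prog.exec] using h0) (by decide)
    (by simp [Prog.exec]) ?_).mono le_rfl fun σ' _ h => h.2
  rintro i σ' hi ⟨i1, i2⟩ hr hF
  have g1 : σ'.reg 1 = I.α := (hF.1 1 rfl).trans (by simpa [Prog.exec] using h1)
  refine Tri.exec rfl le_rfl ⟨by simp [Prog.exec, i1, g1, Nat.succ_mul], fun q hq => ?_⟩
  simp only [Prog.exec, Store.mem_setReg, Store.mem_setMem, hr, i1, if_true, Store.reg_setMem]
  rcases Nat.lt_succ_iff_lt_or_eq.1 hq with hq | rfl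
  · rw [Function.update_of_ne hq.ne, i2 q hq]
  · rw [Function.update_self]

theorem input_mem_three (I : RTCInstance) (f : ℕ) : I.input.mem 3 f = I.bInit.bit f := by
  have : I.input.mem 3 = fun i =>
    (List.ofFn fun f : Fin I.k => if (I.fluents f).initially then 1 else 0).getD i 0 := rfl
  rw [this]
  simp only [List.getD_eq_getElem?_getD, List.getElem?_ofFn, BConf.bit, bInit]
  by_cases h : f < I.k
  · cases hb : (I.fluents ⟨f, h⟩).initially <;> simp [h, hb]
  · simp [h]

theorem tri_initConf {σ : Store} (h : I.InputOn σ) (hoff : ∀ q < I.s, σ.mem 10 q = q * I.α)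
    (h13 : ∀ i, σ.mem 13 i = 0) :
    Tri initConf σ (I.k * 8 + 13) fun σ' =>
      Enumerating I [I.bInit] 0 0 σ' ∧ σ'.reg 28 = 0 ∧ σ'.reg 40 = 1 := by
  have h2 : σ.reg 2 = I.k := h.1 2 (by norm_num)
  have h5 : σ.reg 5 = I.init := h.1 5 (by norm_num)
  refine Tri.seq_exec (T₂ := I.k * 8 + 10) rfl ?_ (by simp only [cost, block]; omega)
  set σ₁ := (block [.const 42 0, .store 11 42 5, .add 33 5 42]).exec σ with hσ₁
  refine (Tri.seq (T₁ := I.k * (4 + 4) + 3) (T₂ := 7) ((Tri.forLoop_framed (T := 4) (fun f σ' =>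
    σ'.reg 33 = pack I.init I.bInit.bit f ∧ ∀ f' < f, σ'.mem 12 f' = I.bInit.bit f')
    (by simpa [hσ₁, block, Prog.exec] using h2) (by decide) (by
      simp [hσ₁, block, Prog.exec, h5, pack]) ?_).mono le_rfl fun σ₂ hF hQ => ?_)).mono
      (by omega) fun _ _ h => h
  · rintro f σ' hf ⟨i1, i2⟩ hr hF
    have g3 : σ'.mem 3 = I.input.mem 3 :=
      (hF.2 3 rfl).trans (by simpa [hσ₁, block, Prog.exec] using h.2 3 (by norm_num))
    refine Tri.exec rfl le_rfl ⟨?_, fun f' hf' => ?_⟩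
    · simp [block, Prog.exec, hr, g3, input_mem_three, i1, pack]
    · simp only [block, Prog.exec, Store.mem_setReg, Store.mem_setMem, Store.reg_setMem,
        Store.reg_setReg, hr, g3, input_mem_three, if_true]
      norm_num
      rcases Nat.lt_succ_iff_lt_or_eq.1 hf' with hf' | rfl
      · rw [Function.update_of_ne hf'.ne, i2 f' hf']
      · rw [Function.update_self]
  · obtain ⟨b1, b2⟩ := hQ
    have e11 : σ₂.mem 11 0 = I.init := by
      rw [hF.2 11 rfl]; simp [hσ₁, block, Prog.exec, h5]
    have e13 : σ₂.mem 13 = fun _ => 0 := by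
      rw [hF.2 13 rfl]; funext i; simpa [hσ₁, block, Prog.exec] using h13 i
    have e10 : σ₂.mem 10 = σ.mem 10 := by
      rw [hF.2 10 rfl]; simp [hσ₁, block, Prog.exec]
    have e2 : σ₂.reg 2 = I.k := by
      rw [hF.1 2 rfl]; simpa [hσ₁, block, Prog.exec] using h2
    have hkey : I.bInit.key = σ₂.reg 33 := b1.symm
    refine Tri.exec rfl le_rfl ⟨⟨⟨fun r hr => ?_, fun b hb => ?_⟩, ?_, ?_, ?_, ?_, ?_⟩, ?_, ?_⟩
    · have h' : r ≠ 24 ∧ r ≠ 25 ∧ r ≠ 26 ∧ r ≠ 27 ∧ r ≠ 28 ∧ r ≠ 40 ∧ r ≠ 42 ∧ r ≠ 33 := by omega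
      have : σ₂.reg r = σ₁.reg r := hF.1 r (by interval_cases r <;> rfl)
      rw [← h.1 r hr]
      simp [block, Prog.exec, h', this, hσ₁]
    · have h' : b ≠ 11 ∧ b ≠ 13 := by omega
      have : σ₂.mem b = σ₁.mem b := hF.2 b (by interval_cases b <;> rfl)
      rw [← h.2 b hb]
      simp [block, Prog.exec, h', this, hσ₁]
    · simpa [block, Prog.exec, e10] using hoff
    · have hc : ConfAt I [I.bInit] 1 I.k (σ₂.mem 11) (σ₂.mem 12)
          (Function.update (σ₂.mem 13) (σ₂.reg 33) 1) := by
        refine ⟨rfl, by simp, fun c hc => ?_, fun c hc f hf => ?_, fun x => ?_, by simp, ?_, rfl⟩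
        · obtain rfl : c = 0 := by simpa using hc
          simpa [bInit] using e11
        · obtain rfl : c = 0 := by simpa using hc
          simpa using b2 f hf
        · rw [← hkey, e13]
          by_cases hx : x = I.bInit
          · simp [hx]
          · rw [Function.update_of_ne fun hk => hx (BConf.key_inj hk)]
            simp [hx]
        · intro x hx
          obtain rfl : x = I.bInit := by simpa using hx
          exact Config.init
      simpa [block, Prog.exec, e2] using hc
    · simp [block, Prog.exec]
    · simp [block, Prog.exec]
    · intro c hc a ha
      omega
    · simp [block, Prog.exec]
    · simp [block, Prog.exec]

theorem inputOn_input (I : RTCInstance) : I.InputOn I.input :=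
  ⟨fun _ _ => rfl, fun _ _ => rfl⟩

/-- The result of the enumeration: all reachable configurations and their successors. -/
theorem tri_enumerate (I : RTCInstance) :
    Tri enumerate I.input (I.s * 6 + I.k * 8 + 20 +
        I.numStates * (I.α * (I.k * 15 + 34) + 10)) fun σ =>
      ∃ cs, Enumerating I cs cs.length (cs.length * I.α) σ := by
  refine (Tri.seq (T₁ := I.s * 6 + 4) (T₂ := I.k * 8 + 13 + (I.numStates *
    (I.α * (I.k * 15 + 34) + 10) + 1)) ((tri_rowOffsets I.inputOn_input).mono le_rfl
    fun σ₁ hF₁ hoff => Tri.seq ((tri_initConf (σ := σ₁) ⟨fun x hx => ?_, fun b hb => ?_⟩ hoff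
      fun i => ?_).mono le_rfl fun σ₂ _ hQ => ?_))).mono (by omega) fun _ _ h => h
  · exact hF₁.1 x (by interval_cases x <;> rfl)
  · exact hF₁.2 b (by interval_cases b <;> rfl)
  · rw [hF₁.2 13 rfl]; rfl
  obtain ⟨hE, h28, h40⟩ := hQ
  have key := run_loop (Γ := List I.BConf × ℕ) (x := 40)
    (p := (.seq (.seq (.load 42 11 25) (.load 29 10 42)) (.seq (.forLoop 30 1 succConf)
      (.block [.const 38 1, .add 25 25 38, .add 26 26 2, .sub 40 24 25]))))
    (fun γ σ => Enumerating I γ.1 γ.2 (γ.2 * I.α) σ ∧ σ.reg 28 = γ.2 * I.α ∧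
      σ.reg 40 = γ.1.length - γ.2 ∧ γ.2 ≤ γ.1.length)
    -- The list serves as a worklist that may grow while it is scanned. Its length never exceeds
    -- `N`, so the number of rounds is bounded although the final length is unknown.
    (fun γ => (I.numStates - γ.2) * (I.α * (I.k * 15 + 34) + 10)) (by
      rintro ⟨cs, cur⟩ σ ⟨hE, h28, h40, hle⟩ hne
      simp only at hE h28 h40 hle ⊢
      have hcur : cur < cs.length := by omega
      have hN : cs.length ≤ I.numStates := length_le_numStates hE.conf.nodup hE.conf.reach
      obtain ⟨x, hx⟩ : ∃ x, cs[cur]? = some x := ⟨_, List.getElem?_eq_getElem hcur⟩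
      have hxget : cs[cur] = x := by
        rw [List.getElem?_eq_getElem hcur] at hx
        exact Option.some_injective _ hx
      suffices hT : Tri (.seq (.seq (.load 42 11 25) (.load 29 10 42)) (.seq (.forLoop 30 1
          succConf)
          (.block [.const 38 1, .add 25 25 38, .add 26 26 2, .sub 40 24 25]))) σ
          (I.α * (I.k * 15 + 34) + 9) fun σ' => ∃ cs', (Enumerating I cs' (cur + 1)
            ((cur + 1) * I.α) σ' ∧ σ'.reg 28 = (cur + 1) * I.α ∧
            σ'.reg 40 = cs'.length - (cur + 1) ∧ cur + 1 ≤ cs'.length) by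
        obtain ⟨t, σ', hr, ht, cs', hQ⟩ := hT
        refine ⟨t, σ', (cs', cur + 1), hr, hQ, ?_⟩
        have : I.numStates - cur = I.numStates - (cur + 1) + 1 := by omega
        rw [this, Nat.succ_mul]
        simp only
        omega
      refine Tri.seq_exec (T₂ := I.α * (I.k * 15 + 34) + 3 + 4) rfl ?_ (by simp only [cost]; omega)
      set σ₁ := ((Prog.load 42 11 25).seq (.load 29 10 42)).exec σ with hσ₁
      have hE₁ : Enumerating I cs cur (cur * I.α) σ₁ := hE.congr (fun y hy => by
        have : y ≠ 42 ∧ y ≠ 29 := by omega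
        simp [hσ₁, Prog.exec, this]) (fun b _ => by simp [hσ₁, Prog.exec])
      have g29 : σ₁.reg 29 = x.1 * I.α := by
        have := hE.conf.cq_eq cur hcur
        rw [hxget] at this
        simp [hσ₁, Prog.exec, hE.cur_eq, this, hE.off]
      have g28 : σ₁.reg 28 = cur * I.α := by simp [hσ₁, Prog.exec, h28]
      refine Tri.seq ((Tri.forLoop_framed (N := I.α) (T := I.k * 15 + 30) (fun i σ' =>
        (∃ cs', cs'[cur]? = some x ∧ Enumerating I cs' cur (cur * I.α + i) σ') ∧
          σ'.reg 28 = cur * I.α + i) (hE₁.input.1 1 (by norm_num)) (by decide) ?_ ?_).mono le_rfl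
          fun σ' _ hQ => ?_)
      · exact ⟨⟨cs, hx, hE₁.congr (fun y hy => by
          have : y ≠ 30 ∧ y ≠ 6 := by omega
          simp [this]) (fun b _ => rfl)⟩, by simpa using g28⟩
      · rintro a σ' ha ⟨⟨cs', hx', hE'⟩, h28'⟩ hr hF
        refine (tri_succConf (a := ⟨a, ha⟩) hE' hx' ((hF.1 29 rfl).trans g29) hr h28').mono le_rfl
          fun σ'' _ hQ => ?_
        obtain ⟨⟨cs'', hx'', hE''⟩, h28''⟩ := hQ
        exact ⟨⟨cs'', hx'', hE''.congr (fun y hy => by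
          have : y ≠ 30 ∧ y ≠ 6 ∧ y ≠ 7 := by omega
          simp [this]) (fun b _ => rfl)⟩, by simpa [Nat.add_assoc] using h28''⟩
      · obtain ⟨⟨cs', hx', hE'⟩, h28'⟩ := hQ
        have hlt : cur < cs'.length := by
          by_contra hcon
          rw [List.getElem?_eq_none (by omega)] at hx'
          simp at hx'
        refine Tri.exec rfl le_rfl ⟨cs', ⟨⟨fun r hr => ?_, fun b hb => ?_⟩, ?_, ?_, ?_, ?_, ?_⟩,
          ?_, ?_, hlt⟩
        · have : r ≠ 38 ∧ r ≠ 25 ∧ r ≠ 26 ∧ r ≠ 40 := by omega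
          simp [block, Prog.exec, this, hE'.input.1 r hr]
        · simp [block, Prog.exec, hE'.input.2 b hb]
        · simpa [block, Prog.exec] using hE'.off
        · simpa [block, Prog.exec] using hE'.conf
        · simp [block, Prog.exec, hE'.cur_eq]
        · have h2 : σ'.reg 2 = I.k := hE'.input.1 2 (by norm_num)
          simp [block, Prog.exec, hE'.curk_eq, h2, Nat.succ_mul]
        · rw [Nat.succ_mul]
          simpa [block, Prog.exec] using hE'.succ
        · simp [block, Prog.exec, h28', Nat.succ_mul]
        · simp [block, Prog.exec, hE'.conf.nc_eq, hE'.cur_eq])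
    ([I.bInit], 0) σ₂ ⟨by simpa using hE, by simpa using h28, by simpa using h40, by simp⟩
  obtain ⟨t, σ', ⟨cs, cur⟩, hr, ⟨hE', -, h40', hle⟩, hx, ht⟩ := key
  refine ⟨t, σ', hr, by simp only [Nat.sub_zero] at ht; omega, cs, ?_⟩
  simp only at hE' h40' hle
  obtain rfl : cur = cs.length := by omega
  exact hE'

end RTCInstance

end RTC

/-! ### Ranks as consistent sets of an AND/OR graph. -/

namespace RTC

/-! ### The AND/OR graph of the ranked winning conditions -/

/-- The tables that describe an arena: `succ x a` is `0` or the successor plus one, `ctl a` tells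
whether `a` is controllable, `loud x` whether an uncontrollable action is enabled, and `val r x` is
the value of the safety condition (`r = 0`), the assumptions and the guarantees. -/
structure Tab where
  /-- number of actions -/
  α : ℕ
  /-- number of assumptions -/
  n : ℕ
  /-- number of guarantees -/
  m : ℕ
  /-- number of states -/
  N : ℕ
  /-- the transition table -/
  succ : ℕ → ℕ → ℕ
  /-- the controllable actions -/
  ctl : ℕ → ℕ
  /-- the states with uncontrollable actions -/
  loud : ℕ → ℕ
  /-- the values of the conditions -/
  val : ℕ → ℕ → ℕ

/-- The nodes of the graph. -/
inductive Nd where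
  /-- the dead node -/
  | bot
  /-- positions of a rank -/
  | Y (j s b x : ℕ)
  /-- positions where the controller waits -/
  | W (j s i x : ℕ)
  /-- positions at a stage -/
  | B (j s i v b x : ℕ)
  /-- targets of a transition -/
  | T (j s i v b x : ℕ)

/-- The number with the given digits in base `D`. -/
def digits (D t j s i v b x : ℕ) : ℕ := x + D * (b + D * (v + D * (i + D * (s + D * (j + D * t)))))

theorem add_mul_inj {D x x' y y' : ℕ} (hx : x < D) (hx' : x' < D) (h : x + D * y = x' + D * y') :
    x = x' ∧ y = y' := by
  have e1 := congrArg (· % D) h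
  simp only [Nat.add_mul_mod_self_left, Nat.mod_eq_of_lt hx, Nat.mod_eq_of_lt hx'] at e1
  subst e1
  exact ⟨rfl, Nat.eq_of_mul_eq_mul_left (by omega) (Nat.add_left_cancel h)⟩

theorem digits_inj {D t j s i v b x t' j' s' i' v' b' x' : ℕ}
    (h : j < D ∧ s < D ∧ i < D ∧ v < D ∧ b < D ∧ x < D)
    (h' : j' < D ∧ s' < D ∧ i' < D ∧ v' < D ∧ b' < D ∧ x' < D)
    (e : digits D t j s i v b x = digits D t' j' s' i' v' b' x') :
    t = t' ∧ j = j' ∧ s = s' ∧ i = i' ∧ v = v' ∧ b = b' ∧ x = x' := by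
  obtain ⟨h1, h2, h3, h4, h5, h6⟩ := h
  obtain ⟨h1', h2', h3', h4', h5', h6'⟩ := h'
  obtain ⟨e6, e⟩ := add_mul_inj h6 h6' e
  obtain ⟨e5, e⟩ := add_mul_inj h5 h5' e
  obtain ⟨e4, e⟩ := add_mul_inj h4 h4' e
  obtain ⟨e3, e⟩ := add_mul_inj h3 h3' e
  obtain ⟨e2, e⟩ := add_mul_inj h2 h2' e
  obtain ⟨e1, e⟩ := add_mul_inj h1 h1' e
  exact ⟨e, e1, e2, e3, e4, e5, e6⟩

namespace Nd

/-- The number of a node. -/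
def code (D : ℕ) : Nd → ℕ
  | bot => 0
  | Y j s b x => digits D 1 j s 0 0 b x
  | W j s i x => digits D 2 j s i 0 0 x
  | B j s i v b x => digits D 3 j s i v b x
  | T j s i v b x => digits D 4 j s i v b x

/-- The components of the node are smaller than `D`. -/
def Lt (D : ℕ) : Nd → Prop
  | bot => 0 < D
  | Y j s b x => j < D ∧ s < D ∧ b < D ∧ x < D
  | W j s i x => j < D ∧ s < D ∧ i < D ∧ x < D
  | B j s i v b x => j < D ∧ s < D ∧ i < D ∧ v < D ∧ b < D ∧ x < D
  | T j s i v b x => j < D ∧ s < D ∧ i < D ∧ v < D ∧ b < D ∧ x < D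

theorem code_inj {D : ℕ} {a a' : Nd} (h : a.Lt D) (h' : a'.Lt D) (e : a.code D = a'.code D) :
    a = a' := by
  -- The dead node is treated as the node with tag `0` and all digits `0`.
  have h0 : digits D 0 0 0 0 0 0 0 = 0 := by simp [digits]
  cases a <;> cases a' <;> simp only [code, Lt] at h h' e <;>
    first
    | rfl
    | (try rw [← h0] at e
       have := digits_inj (by omega) (by omega) e
       first
       | (exfalso; omega)
       | (simp only [Y.injEq, W.injEq, B.injEq, T.injEq]; omega))

end Nd

namespace Tab

variable (t : Tab)

/-- The bound for ranks and counters. -/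
def P : ℕ := 2 * t.N

/-- A number that exceeds all components of nodes. -/
def D : ℕ := t.n + t.m + 2 * t.N + 5

/-- The phase after `j`. -/
def nxt (j : ℕ) : ℕ := if j < t.m then j + 1 else 0

/-- The goal of phase `j` is reached. -/
def Hit (j v b x : ℕ) : Prop := if j < t.m then t.val (t.n + 1 + j) x ≠ 0 else b = 0 ∨ v = t.P

instance (j v b x : ℕ) : Decidable (t.Hit j v b x) := by unfold Hit; infer_instance

/-- Stage `i` can go on in the state `x`. -/
def Stay (i x : ℕ) : Prop := i < t.n → t.val (i + 1) x = 0

instance (i x : ℕ) : Decidable (t.Stay i x) := by unfold Stay; infer_instance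

/-- The counter after a controllable action. -/
def after (i v b x : ℕ) : Option ℕ :=
  if i < t.n then if t.loud x = 0 then some t.P else if b = 0 then none else some v else some 0

/-- The edges of the graph. -/
inductive Edge (t : Tab) : Nd → Nd → ℕ → Prop
  -- A node without edges of kind `1` is under no obligation to have an alternative. An edge of kind
  -- `1` to the dead node imposes it and provides no way out; so rank `0`, which has no other edge,
  -- is empty.
  | y_zero {j b x : ℕ} : j ≤ t.m → b < 2 → x < t.N → Edge t (.Y j 0 b x) .bot 1
  | y_succ {j s b x : ℕ} : j ≤ t.m → s < t.P → b < 2 → x < t.N →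
      Edge t (.Y j (s + 1) b x) (.Y j s b x) 1
  | y_b {j s i b x : ℕ} : j ≤ t.m → s < t.P → i ≤ t.n → b < 2 → x < t.N →
      Edge t (.Y j (s + 1) b x) (.B j s i t.P b x) 1
  | w_bot {j s i x : ℕ} : j ≤ t.m → s < t.P → i ≤ t.n → x < t.N → Edge t (.W j s i x) .bot 1
  -- Waiting needs every uncontrollable successor (kind `0`) and at least one of them (kind `1` next
  -- to the dead node), since the state must not be quiet.
  | w_t {j s i x a y w : ℕ} : j ≤ t.m → s < t.P → i ≤ t.n → x < t.N → a < t.α → t.ctl a = 0 →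
      t.succ x a = y + 1 → w < 2 → Edge t (.W j s i x) (.T j s i t.P 0 y) w
  | b_bot {j s i v b x : ℕ} : j ≤ t.m → s < t.P → i ≤ t.n → v ≤ t.P → b < 2 → x < t.N →
      Edge t (.B j s i v b x) .bot 1
  -- Before the last stage waiting is one of the alternatives; in the last stage it is an obligation
  -- besides a controllable action.
  | b_w {j s i v b x : ℕ} : j ≤ t.m → s < t.P → i ≤ t.n → v < t.P → b < 2 → x < t.N →
      Edge t (.B j s i (v + 1) b x) (.W j s i x) (if i < t.n then 1 else 0)
  | b_t {j s i v b x a y v' : ℕ} : j ≤ t.m → s < t.P → i ≤ t.n → v < t.P → b < 2 → x < t.N →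
      a < t.α → t.ctl a ≠ 0 → t.succ x a = y + 1 → t.after i v b x = some v' →
      Edge t (.B j s i (v + 1) b x) (.T j s i v' 1 y) 1
  | t_bot {j s i v b x : ℕ} : j ≤ t.m → s < t.P → i ≤ t.n → v ≤ t.P → b < 2 → x < t.N →
      Edge t (.T j s i v b x) .bot 1
  | t_hit {j s i v b x : ℕ} : j ≤ t.m → s < t.P → i ≤ t.n → v ≤ t.P → b < 2 → x < t.N →
      t.val 0 x ≠ 0 → t.Hit j v b x → Edge t (.T j s i v b x) (.Y (t.nxt j) t.P b x) 1
  | t_low {j s i v b x : ℕ} : j ≤ t.m → s < t.P → i ≤ t.n → v ≤ t.P → b < 2 → x < t.N →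
      t.val 0 x ≠ 0 → Edge t (.T j s i v b x) (.Y j s b x) 1
  | t_stay {j s i v b x : ℕ} : j ≤ t.m → s < t.P → i ≤ t.n → v ≤ t.P → b < 2 → x < t.N →
      t.val 0 x ≠ 0 → t.Stay i x → Edge t (.T j s i v b x) (.B j s i v b x) 1

/-- The edges for targets. -/
def tEdges (j s i x b v : ℕ) : List (Nd × Nd × ℕ) :=
  [(.T j s i v b x, .bot, 1)] ++ ([(.B j s i v b x, .bot, 1)] ++
    if t.val 0 x = 0 then [] else
      (if t.Hit j v b x then [(.T j s i v b x, .Y (t.nxt j) t.P b x, 1)] else []) ++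
        ([(.T j s i v b x, .Y j s b x, 1)] ++
          if t.Stay i x then [(.T j s i v b x, .B j s i v b x, 1)] else []))

/-- The edges for a controllable action. -/
def cEdges (j s i x b v a : ℕ) : List (Nd × Nd × ℕ) :=
  if t.ctl a = 0 then [] else if t.succ x a = 0 then [] else
    (t.after i v b x).elim [] fun v' =>
      [(.B j s i (v + 1) b x, .T j s i v' 1 (t.succ x a - 1), 1)]

/-- The edges for positions at a stage. -/
def vEdges (j s i x b v : ℕ) : List (Nd × Nd × ℕ) :=
  [(.B j s i (v + 1) b x, .W j s i x, if i < t.n then 1 else 0)] ++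
    (List.range t.α).flatMap (t.cEdges j s i x b v)

/-- The edges for an uncontrollable action. -/
def uEdges (j s i x a : ℕ) : List (Nd × Nd × ℕ) :=
  if t.ctl a = 0 then if t.succ x a = 0 then [] else
    [(.W j s i x, .T j s i t.P 0 (t.succ x a - 1), 0)] ++
      [(.W j s i x, .T j s i t.P 0 (t.succ x a - 1), 1)] else []

/-- The edges for given `j`, `s`, `i`, `x` and `b`. -/
def bEdges (j s i x b : ℕ) : List (Nd × Nd × ℕ) :=
  [(.Y j (s + 1) b x, .B j s i t.P b x, 1)] ++ ((List.range (t.P + 1)).flatMap (t.tEdges j s i x b)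
      ++
    (List.range t.P).flatMap (t.vEdges j s i x b))

/-- The edges for given `j`, `s`, `i` and `x`. -/
def xEdges (j s i x : ℕ) : List (Nd × Nd × ℕ) :=
  [(.W j s i x, .bot, 1)] ++ ((List.range t.α).flatMap (t.uEdges j s i x) ++
    (List.range 2).flatMap (t.bEdges j s i x))

/-- The edges for given `j` and `s`. -/
def sEdges (j s : ℕ) : List (Nd × Nd × ℕ) :=
  ((List.range 2).flatMap fun b => (List.range t.N).flatMap fun x =>
    [(.Y j (s + 1) b x, .Y j s b x, 1)]) ++
  (List.range (t.n + 1)).flatMap fun i => (List.range t.N).flatMap (t.xEdges j s i)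

/-- The edges for given `j`. -/
def jEdges (j : ℕ) : List (Nd × Nd × ℕ) :=
  ((List.range 2).flatMap fun b => (List.range t.N).flatMap fun x => [(.Y j 0 b x, .bot, 1)]) ++
  (List.range t.P).flatMap (t.sEdges j)

/-- The list of all edges. -/
def edges : List (Nd × Nd × ℕ) := (List.range (t.m + 1)).flatMap t.jEdges

variable {t}

theorem edge_of_mem {a b : Nd} {w : ℕ} (h : (a, b, w) ∈ t.edges) : t.Edge a b w := by
  simp only [edges, jEdges, sEdges, List.mem_flatMap, List.mem_append, List.mem_range,
    List.mem_singleton, Prod.mk.injEq] at h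
  obtain ⟨j, hj, ⟨b, hb, x, hx, rfl, rfl, rfl⟩ | ⟨s, hs, ⟨b, hb, x, hx, rfl, rfl, rfl⟩ |
    ⟨i, hi, x, hx, h⟩⟩⟩ := h
  · exact .y_zero (by omega) hb hx
  · exact .y_succ (by omega) hs hb hx
  rw [Nat.lt_succ_iff] at hj hi
  simp only [xEdges, bEdges, List.mem_flatMap, List.mem_append, List.mem_range,
    List.mem_singleton, Prod.mk.injEq] at h
  obtain ⟨rfl, rfl, rfl⟩ | ⟨a', ha, h⟩ | ⟨b', hb, ⟨rfl, rfl, rfl⟩ | ⟨v, hv, h⟩ | ⟨v, hv, h⟩⟩ := h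
  · exact .w_bot hj hs hi hx
  · unfold uEdges at h
    split_ifs at h with h1 h2
    · simp at h
    · simp only [List.mem_append, List.mem_singleton, Prod.mk.injEq] at h
      obtain ⟨rfl, rfl, rfl⟩ | ⟨rfl, rfl, rfl⟩ := h
      · exact .w_t hj hs hi hx ha h1 (by omega) (by omega)
      · exact .w_t hj hs hi hx ha h1 (by omega) (by omega)
    · simp at h
  · exact .y_b hj hs hi hb hx
  · rw [Nat.lt_succ_iff] at hv
    simp only [tEdges, List.mem_append, List.mem_singleton, Prod.mk.injEq] at h
    obtain ⟨rfl, rfl, rfl⟩ | ⟨rfl, rfl, rfl⟩ | h := h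
    · exact .t_bot hj hs hi hv hb hx
    · exact .b_bot hj hs hi hv hb hx
    · by_cases h0 : t.val 0 x = 0
      · simp [h0] at h
      simp only [h0, if_false, List.mem_append, List.mem_singleton, Prod.mk.injEq] at h
      obtain h | ⟨rfl, rfl, rfl⟩ | h := h
      · split_ifs at h with h1
        · simp only [List.mem_singleton, Prod.mk.injEq] at h
          obtain ⟨rfl, rfl, rfl⟩ := h
          exact .t_hit hj hs hi hv hb hx h0 h1
        · simp at h
      · exact .t_low hj hs hi hv hb hx h0
      · split_ifs at h with h1
        · simp only [List.mem_singleton, Prod.mk.injEq] at h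
          obtain ⟨rfl, rfl, rfl⟩ := h
          exact .t_stay hj hs hi hv hb hx h0 h1
        · simp at h
  · simp only [vEdges, List.mem_append, List.mem_singleton, Prod.mk.injEq, List.mem_flatMap,
      List.mem_range] at h
    obtain ⟨rfl, rfl, rfl⟩ | ⟨a', ha, h⟩ := h
    · exact .b_w hj hs hi hv hb hx
    · unfold cEdges at h
      split_ifs at h with h1 h2
      · simp at h
      · simp at h
      · cases hv' : t.after i v b' x with
        | none => simp [hv'] at h
        | some v' =>
          simp only [hv', Option.elim, List.mem_singleton, Prod.mk.injEq] at h
          obtain ⟨rfl, rfl, rfl⟩ := h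
          exact .b_t hj hs hi hv hb hx ha h1 (by omega) hv'

theorem mem_edges {a b : Nd} {w : ℕ} (h : t.Edge a b w) : (a, b, w) ∈ t.edges := by
  simp only [edges, jEdges, sEdges, List.mem_flatMap, List.mem_append, List.mem_range,
    List.mem_singleton, Prod.mk.injEq]
  cases h with
  | y_zero hj hb hx => exact ⟨_, Nat.lt_succ_of_le hj, Or.inl ⟨_, hb, _, hx, rfl, rfl, rfl⟩⟩
  | y_succ hj hs hb hx => exact ⟨_, Nat.lt_succ_of_le hj, Or.inr ⟨_, hs, Or.inl ⟨_, hb, _, hx,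
      rfl, rfl, rfl⟩⟩⟩
  | y_b hj hs hi hb hx =>
    exact ⟨_, Nat.lt_succ_of_le hj, Or.inr ⟨_, hs, Or.inr ⟨_, Nat.lt_succ_of_le hi, _, hx,
        List.mem_append_right _
      (List.mem_append_right _ (List.mem_flatMap.2 ⟨_, List.mem_range.2 hb, by simp [bEdges]⟩))⟩⟩⟩
  | w_bot hj hs hi hx => exact ⟨_, Nat.lt_succ_of_le hj, Or.inr ⟨_, hs, Or.inr ⟨_,
      Nat.lt_succ_of_le hi, _, hx, by simp [xEdges]⟩⟩⟩
  | w_t hj hs hi hx ha hc hy hw =>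
    refine ⟨_, Nat.lt_succ_of_le hj, Or.inr ⟨_, hs, Or.inr ⟨_, Nat.lt_succ_of_le hi, _, hx,
        List.mem_append_right _
      (List.mem_append_left _ (List.mem_flatMap.2 ⟨_, List.mem_range.2 ha, ?_⟩))⟩⟩⟩
    simp [uEdges, hc, hy]
    omega
  | b_w hj hs hi hv hb hx =>
    exact ⟨_, Nat.lt_succ_of_le hj, Or.inr ⟨_, hs, Or.inr ⟨_, Nat.lt_succ_of_le hi, _, hx,
        List.mem_append_right _
      (List.mem_append_right _ (List.mem_flatMap.2 ⟨_, List.mem_range.2 hb,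
        List.mem_append_right _ (List.mem_append_right _ (List.mem_flatMap.2 ⟨_,
            List.mem_range.2 hv,
          by simp [vEdges]⟩))⟩))⟩⟩⟩
  | b_t hj hs hi hv hb hx ha hc hy hv' =>
    refine ⟨_, Nat.lt_succ_of_le hj, Or.inr ⟨_, hs, Or.inr ⟨_, Nat.lt_succ_of_le hi, _, hx,
        List.mem_append_right _
      (List.mem_append_right _ (List.mem_flatMap.2 ⟨_, List.mem_range.2 hb,
        List.mem_append_right _ (List.mem_append_right _ (List.mem_flatMap.2 ⟨_,
            List.mem_range.2 hv,
          List.mem_append_right _ (List.mem_flatMap.2 ⟨_, List.mem_range.2 ha, ?_⟩)⟩))⟩))⟩⟩⟩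
    simp [cEdges, hc, hy, hv']
  | b_bot hj hs hi hv hb hx =>
    exact ⟨_, Nat.lt_succ_of_le hj, Or.inr ⟨_, hs, Or.inr ⟨_, Nat.lt_succ_of_le hi, _, hx,
        List.mem_append_right _
      (List.mem_append_right _ (List.mem_flatMap.2 ⟨_, List.mem_range.2 hb,
        List.mem_append_right _ (List.mem_append_left _ (List.mem_flatMap.2
          ⟨_, List.mem_range.2 (Nat.lt_succ_of_le hv), by simp [tEdges]⟩))⟩))⟩⟩⟩
  | t_bot hj hs hi hv hb hx =>
    exact ⟨_, Nat.lt_succ_of_le hj, Or.inr ⟨_, hs, Or.inr ⟨_, Nat.lt_succ_of_le hi, _, hx,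
        List.mem_append_right _
      (List.mem_append_right _ (List.mem_flatMap.2 ⟨_, List.mem_range.2 hb,
        List.mem_append_right _ (List.mem_append_left _ (List.mem_flatMap.2
          ⟨_, List.mem_range.2 (Nat.lt_succ_of_le hv), by simp [tEdges]⟩))⟩))⟩⟩⟩
  | t_hit hj hs hi hv hb hx h0 h1 =>
    exact ⟨_, Nat.lt_succ_of_le hj, Or.inr ⟨_, hs, Or.inr ⟨_, Nat.lt_succ_of_le hi, _, hx,
        List.mem_append_right _
      (List.mem_append_right _ (List.mem_flatMap.2 ⟨_, List.mem_range.2 hb,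
        List.mem_append_right _ (List.mem_append_left _ (List.mem_flatMap.2
          ⟨_, List.mem_range.2 (Nat.lt_succ_of_le hv), by simp [tEdges, h0, h1]⟩))⟩))⟩⟩⟩
  | t_low hj hs hi hv hb hx h0 =>
    exact ⟨_, Nat.lt_succ_of_le hj, Or.inr ⟨_, hs, Or.inr ⟨_, Nat.lt_succ_of_le hi, _, hx,
        List.mem_append_right _
      (List.mem_append_right _ (List.mem_flatMap.2 ⟨_, List.mem_range.2 hb,
        List.mem_append_right _ (List.mem_append_left _ (List.mem_flatMap.2
          ⟨_, List.mem_range.2 (Nat.lt_succ_of_le hv), by simp [tEdges, h0]⟩))⟩))⟩⟩⟩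
  | t_stay hj hs hi hv hb hx h0 h1 =>
    exact ⟨_, Nat.lt_succ_of_le hj, Or.inr ⟨_, hs, Or.inr ⟨_, Nat.lt_succ_of_le hi, _, hx,
        List.mem_append_right _
      (List.mem_append_right _ (List.mem_flatMap.2 ⟨_, List.mem_range.2 hb,
        List.mem_append_right _ (List.mem_append_left _ (List.mem_flatMap.2
          ⟨_, List.mem_range.2 (Nat.lt_succ_of_le hv), by simp [tEdges, h0, h1]⟩))⟩))⟩⟩⟩

theorem nxt_le (j : ℕ) : t.nxt j ≤ t.m := by
  unfold nxt
  split_ifs <;> omega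

theorem after_le {i v b x v' : ℕ} (h : t.after i v b x = some v') (hv : v ≤ t.P) : v' ≤ t.P := by
  unfold after at h
  split_ifs at h <;> simp at h <;> omega

theorem Edge.lt (hs : ∀ x < t.N, ∀ a < t.α, t.succ x a ≤ t.N) {a b : Nd} {w : ℕ}
    (h : t.Edge a b w) : a.Lt t.D ∧ b.Lt t.D := by
  have hP : t.P = 2 * t.N := rfl
  have hD : t.D = t.n + t.m + 2 * t.N + 5 := rfl
  cases h with
  | w_t _ _ _ hx ha _ hy _ =>
    have := hs _ hx _ ha
    simp only [Nd.Lt]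
    omega
  | b_t _ _ _ hv _ hx ha _ hy hv' =>
    have := hs _ hx _ ha
    have := after_le hv' hv.le
    simp only [Nd.Lt]
    omega
  | @t_hit j =>
    have := t.nxt_le j
    simp only [Nd.Lt]
    omega
  | _ => simp only [Nd.Lt]; omega

/-- Consistent sets of nodes. -/
def Sound (t : Tab) (A : Nd → Prop) : Prop :=
  ¬ A .bot ∧ ∀ a b w, t.Edge a b w → A a → (w = 0 → A b) ∧ (w = 1 → ∃ b', t.Edge a b' 1 ∧ A b')

/-- The graph on numbers. -/
def graph (t : Tab) : Edges := t.edges.map fun e => (e.1.code t.D, e.2.1.code t.D, e.2.2)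

/-- Numbering is injective on nodes with components below `D`, and edges only join such nodes, so
consistent sets can be carried back and forth. -/
theorem exists_consistent_iff (hs : ∀ x < t.N, ∀ a < t.α, t.succ x a ≤ t.N) {g : Nd}
    (hg : g.Lt t.D) :
    (∃ B, Consistent t.graph B ∧ B (g.code t.D)) ↔ ∃ A, t.Sound A ∧ A g := by
  have hmem : ∀ q p w, (q, p, w) ∈ t.graph ↔ ∃ a b, t.Edge a b w ∧ a.code t.D = q ∧
      b.code t.D = p := by
    intro q p w
    simp only [graph, List.mem_map, Prod.mk.injEq, Prod.exists]
    constructor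
    · rintro ⟨a, b, w', h, rfl, rfl, rfl⟩
      exact ⟨a, b, edge_of_mem h, rfl, rfl⟩
    · rintro ⟨a, b, h, rfl, rfl⟩
      exact ⟨a, b, w, mem_edges h, rfl, rfl, rfl⟩
  constructor
  · rintro ⟨B, ⟨h0, hB⟩, hBg⟩
    refine ⟨fun a => B (a.code t.D), ⟨h0, fun a b w h ha => ?_⟩, hBg⟩
    obtain ⟨h1, h2⟩ := hB _ _ _ ((hmem _ _ _).2 ⟨a, b, h, rfl, rfl⟩) ha
    refine ⟨h1, fun hw => ?_⟩
    obtain ⟨p', hp', hBp⟩ := h2 hw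
    obtain ⟨a', b', h', e, rfl⟩ := (hmem _ _ _).1 hp'
    obtain rfl := Nd.code_inj (h'.lt hs).1 (h.lt hs).1 e
    exact ⟨b', h', hBp⟩
  · rintro ⟨A, ⟨h0, hA⟩, hAg⟩
    refine ⟨fun q => ∃ a, a.Lt t.D ∧ a.code t.D = q ∧ A a, ⟨?_, ?_⟩, g, hg, rfl, hAg⟩
    · rintro ⟨a, hl, e, ha⟩
      have : a = .bot := Nd.code_inj (D := t.D) hl (by simp [Nd.Lt, D]) e
      exact h0 (this ▸ ha)
    · rintro q p w h ⟨a, hl, rfl, ha⟩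
      obtain ⟨a', b, h', e, rfl⟩ := (hmem _ _ _).1 h
      obtain rfl := Nd.code_inj (h'.lt hs).1 hl e
      obtain ⟨h1, h2⟩ := hA _ _ _ h' ha
      refine ⟨fun hw => ⟨b, (h'.lt hs).2, rfl, h1 hw⟩, fun hw => ?_⟩
      obtain ⟨b', hb', hAb⟩ := h2 hw
      exact ⟨_, (hmem _ _ _).2 ⟨a', b', hb', rfl, rfl⟩, b', (hb'.lt hs).2, rfl, hAb⟩

/-- The tables describe the arena `G`. -/
structure Rep (t : Tab) (G : Arena (Fin t.N) (Fin t.α)) : Prop where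
  n_eq : G.n = t.n
  m_eq : G.m = t.m
  succ_eq : ∀ (x : Fin t.N) (a : Fin t.α), t.succ x a = (G.step x a).elim 0 fun y => y.val + 1
  ctl_iff : ∀ a : Fin t.α, t.ctl a ≠ 0 ↔ G.ctrl a
  loud_iff : ∀ x : Fin t.N, t.loud x = 0 ↔ G.Quiet x
  rho_iff : ∀ x : Fin t.N, t.val 0 x ≠ 0 ↔ G.rho x
  as_iff : ∀ i < t.n, ∀ x : Fin t.N, t.val (i + 1) x ≠ 0 ↔ G.as i x
  gs_iff : ∀ j < t.m, ∀ x : Fin t.N, t.val (t.n + 1 + j) x ≠ 0 ↔ G.gs j x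

namespace Rep

variable {G : Arena (Fin t.N) (Fin t.α)} (R : t.Rep G)

include R

theorem succ_eq_iff {x : Fin t.N} {a : Fin t.α} {y : ℕ} :
    t.succ x a = y + 1 ↔ ∃ h : y < t.N, G.step x a = some ⟨y, h⟩ := by
  rw [R.succ_eq]
  cases h : G.step x a with
  | none => simp
  | some z =>
    simp only [Option.elim, Option.some.injEq]
    constructor
    · intro h
      obtain rfl : z.val = y := by omega
      exact ⟨z.2, rfl⟩
    · rintro ⟨hy, rfl⟩
      rfl

theorem succ_le {x a : ℕ} (hx : x < t.N) (ha : a < t.α) : t.succ x a ≤ t.N := by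
  have := R.succ_eq ⟨x, hx⟩ ⟨a, ha⟩
  simp only at this
  rw [this]
  cases h : G.step ⟨x, hx⟩ ⟨a, ha⟩ with
  | none => simp
  | some z => exact z.2

theorem nxt_eq (j : ℕ) : G.nxt j = t.nxt j := by simp [Arena.nxt, nxt, R.m_eq]

/-- The counter doubles as the flag of `GoalHit`. It equals `P` after a move from a quiet state or
an uncontrollable action, and is smaller after a controllable action from any other state. -/
theorem hit_iff {j v : ℕ} {b : Bool} {x : Fin t.N} :
    t.Hit j v b.toNat x ↔ G.GoalHit j (v = t.P) b x := by
  unfold Hit Arena.GoalHit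
  rw [R.m_eq]
  split_ifs with h
  · exact R.gs_iff j h x
  · cases b <;> simp

theorem stay_iff {i : ℕ} {x : Fin t.N} : t.Stay i x ↔ (i < G.n → ¬ G.as i x) := by
  unfold Stay
  rw [R.n_eq]
  refine forall_congr' fun h => ?_
  rw [← R.as_iff i h, not_not]

end Rep

theorem toNat_decide_eq_one {b : ℕ} (h : b < 2) : (decide (b = 1)).toNat = b := by
  interval_cases b <;> rfl

/-- Alternatives that lead to the dead node are void, so each node of the set picks an edge whose
constructor is the required clause of `Family`. -/
theorem exists_family_of_sound {G : Arena (Fin t.N) (Fin t.α)} (R : t.Rep G) {A : Nd → Prop}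
    (hA : t.Sound A) :
    G.Family t.P (fun j s b x => A (.Y j s b.toNat x))
      (fun j s i v b x => A (.B j s i v b.toNat x)) := by
  obtain ⟨h0, hA⟩ := hA
  have hor : ∀ {a b}, t.Edge a b 1 → A a → ∃ b', t.Edge a b' 1 ∧ A b' :=
    fun h ha => (hA _ _ _ h ha).2 rfl
  have hb : ∀ b : Bool, b.toNat < 2 := fun b => by cases b <;> decide
  have hTgt : ∀ {j s i v : ℕ} {b : Bool} {x : Fin t.N}, j ≤ t.m → s < t.P → i ≤ t.n → v ≤ t.P →
      A (.T j s i v b.toNat x) → G.Tgt (fun b x => A (.Y (G.nxt j) t.P b.toNat x))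
        (fun b x => A (.Y j s b.toNat x)) (fun b x => A (.B j s i v b.toNat x)) j i
        (v = t.P) b x := by
    intro j s i v b x hj hs hi hv hT
    obtain ⟨b', he, hb'⟩ := hor (.t_bot hj hs hi hv (hb b) x.2) hT
    cases he with
    | t_bot => exact absurd hb' h0
    | t_hit _ _ _ _ _ _ hr hh =>
      exact ⟨(R.rho_iff x).1 hr, Or.inl ⟨R.hit_iff.1 hh, by rw [R.nxt_eq]; exact hb'⟩⟩
    | t_low _ _ _ _ _ _ hr => exact ⟨(R.rho_iff x).1 hr, Or.inr (Or.inl hb')⟩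
    | t_stay _ _ _ _ _ _ hr hst =>
      exact ⟨(R.rho_iff x).1 hr, Or.inr (Or.inr ⟨R.stay_iff.1 hst, hb'⟩)⟩
  have hWait : ∀ {j s i : ℕ} {x : Fin t.N}, j ≤ t.m → s < t.P → i ≤ t.n → A (.W j s i x) →
      G.Wait (G.Tgt (fun b x => A (.Y (G.nxt j) t.P b.toNat x))
        (fun b x => A (.Y j s b.toNat x)) (fun b x => A (.B j s i t.P b.toNat x)) j i True) x := by
    intro j s i x hj hs hi hW
    refine ⟨fun hq => ?_, fun u y hu hy => ?_⟩
    · obtain ⟨b', he, hb'⟩ := hor (.w_bot hj hs hi x.2) hW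
      cases he with
      | w_bot => exact h0 hb'
      | @w_t _ _ _ _ a y _ _ _ _ _ ha hc hy =>
        obtain ⟨hy', hstep⟩ := (R.succ_eq_iff (a := ⟨a, ha⟩)).1 hy
        exact hq ⟨a, ha⟩ _ (fun hcon => (R.ctl_iff _).2 hcon hc) hstep
    · have hu' : t.ctl u = 0 := by
        by_contra hcon
        exact hu ((R.ctl_iff u).1 hcon)
      have := (hA _ _ _ (.w_t (w := 0) hj hs hi x.2 u.2 hu'
        (R.succ_eq_iff.2 ⟨y.2, hy⟩) (by norm_num)) hW).1 rfl
      exact (hTgt (b := false) hj hs hi le_rfl this).mono (fun _ _ h => h) (fun _ _ h => h)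
        (fun _ _ h => h) fun _ => trivial
  have hB0 : ∀ {j s i : ℕ} {b : Bool} {x : Fin t.N}, j ≤ t.m → s < t.P → i ≤ t.n →
      ¬ A (.B j s i 0 b.toNat x) := by
    intro j s i b x hj hs hi hB
    obtain ⟨b', he, hb'⟩ := hor (.b_bot hj hs hi (Nat.zero_le _) (hb b) x.2) hB
    cases he
    exact h0 hb'
  refine ⟨?_, ?_, ?_, ?_, ?_⟩
  · intro j hj b x hY
    rw [R.m_eq] at hj
    obtain ⟨b', he, hb'⟩ := hor (.y_zero hj (hb b) x.2) hY
    cases he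
    exact h0 hb'
  · intro j hj s hs b x hY
    rw [R.m_eq] at hj
    rw [R.n_eq]
    obtain ⟨b', he, hb'⟩ := hor (.y_succ hj hs (hb b) x.2) hY
    cases he with
    | y_succ => exact Or.inl hb'
    | y_b _ _ hi => exact Or.inr ⟨_, hi, hb'⟩
  · intro j hj s hs i hi b x
    rw [R.m_eq] at hj
    rw [R.n_eq] at hi
    exact hB0 hj hs hi
  · intro j hj s hs i hi v hv b x hB
    rw [R.m_eq] at hj
    rw [R.n_eq] at hi
    obtain ⟨b', he, hb'⟩ := hor (.b_bot hj hs hi.le hv (hb b) x.2) hB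
    -- The kind of the edge `b_w` is a conditional expression, so the index has to be a variable
    -- before the case distinction.
    generalize hw : (1 : ℕ) = w at he
    cases he with
    | b_bot => exact absurd hb' h0
    | b_w => exact Or.inl (hWait hj hs hi.le hb')
    | @b_t _ _ _ _ _ _ a y v' _ _ _ _ _ _ ha hc hy hv' =>
      obtain ⟨hy', hstep⟩ := (R.succ_eq_iff (a := ⟨a, ha⟩)).1 hy
      refine Or.inr ⟨⟨a, ha⟩, ⟨y, hy'⟩, (R.ctl_iff _).1 hc, hstep, ?_⟩
      have hT := hTgt (b := true) (x := ⟨y, hy'⟩) hj hs hi.le (after_le hv' hv.le) hb'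
      unfold after at hv'
      rw [if_pos hi] at hv'
      split_ifs at hv' with h1 h2
      · obtain rfl := Option.some_injective _ hv'
        exact Or.inl ⟨(R.loud_iff x).1 h1, hT.mono (fun _ _ h => h) (fun _ _ h => h)
          (fun _ _ h => h) fun _ => trivial⟩
      · obtain rfl := Option.some_injective _ hv'
        refine Or.inr ⟨fun h => h1 ((R.loud_iff x).2 h), by cases b <;> simp_all, hT.mono
          (fun _ _ h => h) (fun _ _ h => h) (fun _ _ h => h) fun h => absurd h hv.ne⟩
  · intro j hj s hs v hv b x hB
    rw [R.m_eq] at hj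
    have hB' : A (.B j s t.n (v + 1) b.toNat x) := by rw [← R.n_eq]; exact hB
    have hWt : A (.W j s t.n x) :=
      (hA _ _ _ (.b_w hj hs le_rfl hv (hb b) x.2) hB').1 (if_neg (lt_irrefl _))
    obtain ⟨b', he, hb'⟩ := hor (.b_bot hj hs le_rfl hv (hb b) x.2) hB'
    rw [R.n_eq]
    refine ⟨hWait hj hs le_rfl hWt, ?_⟩
    generalize hw : (1 : ℕ) = w at he
    cases he with
    | b_bot => exact absurd hb' h0
    | b_w => simp at hw
    | @b_t _ _ _ _ _ _ a y v' _ _ _ _ _ _ ha hc hy hv' =>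
      obtain ⟨hy', hstep⟩ := (R.succ_eq_iff (a := ⟨a, ha⟩)).1 hy
      refine ⟨⟨a, ha⟩, ⟨y, hy'⟩, (R.ctl_iff _).1 hc, hstep, ?_⟩
      have hT := hTgt (b := true) (x := ⟨y, hy'⟩) hj hs le_rfl (after_le hv' hv.le) hb'
      unfold after at hv'
      rw [if_neg (lt_irrefl _)] at hv'
      obtain rfl := Option.some_injective _ hv'
      -- In the last stage the target carries the counter `0`. Positions with that counter are dead,
      -- so staying is impossible; and `0` differs from `P`, so the flag is false.
      exact hT.mono (fun _ _ h => h) (fun _ _ h => h) (fun b x h => hB0 hj hs le_rfl h)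
        fun h => by omega

/-- The auxiliary nodes `W` and `T` are interpreted by what they stand for, `Wait` and `Tgt`; the
clauses of `Family` then supply an alternative for every node. -/
theorem exists_sound_of_family {G : Arena (Fin t.N) (Fin t.α)} (R : t.Rep G)
    {Y : ℕ → ℕ → Bool → Fin t.N → Prop} {B : ℕ → ℕ → ℕ → ℕ → Bool → Fin t.N → Prop}
    (F : G.Family t.P Y B) :
    ∃ A, t.Sound A ∧ ∀ j s (b : Bool) (x : Fin t.N), Y j s b x → A (.Y j s b.toNat x) := by
  let tg (j s i v : ℕ) := G.Tgt (Y (G.nxt j) t.P) (Y j s) (B j s i v) j i (v = t.P)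
  let A : Nd → Prop := fun a => match a with
    | .bot => False
    | .Y j s b x => ∃ h : x < t.N, Y j s (decide (b = 1)) ⟨x, h⟩
    | .W j s i x => ∃ h : x < t.N, G.Wait (tg j s i t.P) ⟨x, h⟩
    | .B j s i v b x => ∃ h : x < t.N, B j s i v (decide (b = 1)) ⟨x, h⟩
    | .T j s i v b x => ∃ h : x < t.N, tg j s i v (decide (b = 1)) ⟨x, h⟩
  have hT : ∀ {j s i v b x : ℕ}, j ≤ t.m → s < t.P → i ≤ t.n → v ≤ t.P → b < 2 → x < t.N →
      A (.T j s i v b x) → ∃ b', t.Edge (.T j s i v b x) b' 1 ∧ A b' := by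
    rintro j s i v b x hj hs hi hv hb hx ⟨_, hr, h⟩
    have hr' : t.val 0 x ≠ 0 := (R.rho_iff ⟨x, hx⟩).2 hr
    rcases h with ⟨h1, h2⟩ | h | ⟨h1, h2⟩
    · refine ⟨_, .t_hit hj hs hi hv hb hx hr' ?_, hx, ?_⟩
      · have := (R.hit_iff (v := v) (x := ⟨x, hx⟩)).2 h1
        rwa [toNat_decide_eq_one hb] at this
      · rw [← R.nxt_eq]; exact h2
    · exact ⟨_, .t_low hj hs hi hv hb hx hr', hx, h⟩
    · exact ⟨_, .t_stay hj hs hi hv hb hx hr' ((R.stay_iff (x := ⟨x, hx⟩)).2 h1), hx, h2⟩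
  have hB : ∀ {j s i v b x : ℕ}, j ≤ t.m → s < t.P → i ≤ t.n → v < t.P → b < 2 → x < t.N →
      A (.B j s i (v + 1) b x) → (i < t.n ∨ A (.W j s i x)) ∧
        ∃ b', t.Edge (.B j s i (v + 1) b x) b' 1 ∧ A b' := by
    rintro j s i v b x hj hs hi hv hb hx ⟨_, h⟩
    rcases hi.lt_or_eq with hi' | rfl
    · refine ⟨Or.inl hi', ?_⟩
      have hw := Edge.b_w (t := t) hj hs hi hv hb hx
      rw [if_pos hi'] at hw
      rcases F.B_succ j (R.m_eq ▸ hj) s hs i (R.n_eq ▸ hi') v hv _ _ h with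
        h | ⟨c, y, hc, hy, ⟨hq, h⟩ | ⟨hq, hb1, h⟩⟩
      · exact ⟨_, hw, hx, h.mono fun _ _ h => h.mono (fun _ _ h => h) (fun _ _ h => h)
          (fun _ _ h => h) fun _ => rfl⟩
      · refine ⟨_, .b_t hj hs hi hv hb hx c.2 ((R.ctl_iff c).2 hc)
          ((R.succ_eq_iff (x := ⟨x, hx⟩)).2 ⟨y.2, hy⟩) (v' := t.P) ?_, y.2, h.mono
            (fun _ _ h => h) (fun _ _ h => h) (fun _ _ h => h) fun _ => rfl⟩
        have := (R.loud_iff ⟨x, hx⟩).2 hq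
        simp only at this
        simp [after, hi', this]
      · refine ⟨_, .b_t hj hs hi hv hb hx c.2 ((R.ctl_iff c).2 hc)
          ((R.succ_eq_iff (x := ⟨x, hx⟩)).2 ⟨y.2, hy⟩) (v' := v) ?_, y.2, h.mono
            (fun _ _ h => h) (fun _ _ h => h) (fun _ _ h => h) fun h => h.elim⟩
        have : t.loud x ≠ 0 := fun h => hq ((R.loud_iff ⟨x, hx⟩).1 h)
        simp at hb1
        simp [after, hi', this, hb1]
    · obtain ⟨h1, c, y, hc, hy, h2⟩ := F.B_last j (R.m_eq ▸ hj) s hs v hv _ _ (R.n_eq.symm ▸ h)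
      rw [R.n_eq] at h1 h2
      refine ⟨Or.inr ⟨hx, h1.mono fun _ _ h => h.mono (fun _ _ h => h) (fun _ _ h => h)
          (fun _ _ h => h) fun _ => rfl⟩, _, .b_t hj hs hi hv hb hx c.2 ((R.ctl_iff c).2 hc)
          ((R.succ_eq_iff (x := ⟨x, hx⟩)).2 ⟨y.2, hy⟩) (v' := 0) (by simp [after]), y.2, h2.mono
            (fun _ _ h => h) (fun _ _ h => h) (fun _ _ h => h.elim) fun h => h.elim⟩
  refine ⟨A, ⟨id, fun a b w he ha => ?_⟩, fun j s b x h => ⟨x.2, by cases b <;> exact h⟩⟩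
  cases he with
  | y_zero hj hb hx =>
    obtain ⟨_, h⟩ := ha
    exact absurd h (F.Y_zero _ (R.m_eq ▸ hj) _ _)
  | t_bot hj hs hi hv hb hx => exact ⟨by simp, fun _ => hT hj hs hi hv hb hx ha⟩
  | t_hit hj hs hi hv hb hx => exact ⟨by simp, fun _ => hT hj hs hi hv hb hx ha⟩
  | t_low hj hs hi hv hb hx => exact ⟨by simp, fun _ => hT hj hs hi hv hb hx ha⟩
  | t_stay hj hs hi hv hb hx => exact ⟨by simp, fun _ => hT hj hs hi hv hb hx ha⟩
  | b_t hj hs hi hv hb hx => exact ⟨by simp, fun _ => (hB hj hs hi hv hb hx ha).2⟩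
  | @b_w j s i v b x hj hs hi hv hb hx =>
    refine ⟨fun hw => ?_, fun _ => (hB hj hs hi hv hb hx ha).2⟩
    split_ifs at hw with h
    exact (hB hj hs hi hv hb hx ha).1.resolve_left h
  | @b_bot j s i v b x hj hs hi hv hb hx =>
    refine ⟨by simp, fun _ => ?_⟩
    cases v with
    | zero =>
      obtain ⟨_, h⟩ := ha
      exact absurd h (F.B_zero _ (R.m_eq ▸ hj) _ hs _ (R.n_eq ▸ hi) _ _)
    | succ v => exact (hB hj hs hi hv hb hx ha).2
  | @w_t j s i x a y w hj hs hi hx hal hc hy hw =>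
    obtain ⟨_, h1, h2⟩ := ha
    obtain ⟨hy', hstep⟩ := (R.succ_eq_iff (x := ⟨x, hx⟩) (a := ⟨a, hal⟩)).1 hy
    have hT' : A (.T j s i t.P 0 y) :=
      ⟨hy', h2 ⟨a, hal⟩ ⟨y, hy'⟩ (fun hcon => (R.ctl_iff _).2 hcon hc) hstep⟩
    exact ⟨fun _ => hT', fun _ => ⟨_, .w_t hj hs hi hx hal hc hy (by norm_num), hT'⟩⟩
  | @w_bot j s i x hj hs hi hx =>
    refine ⟨by simp, fun _ => ?_⟩
    obtain ⟨_, h1, h2⟩ := ha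
    simp only [Arena.Quiet, not_forall, not_not] at h1
    obtain ⟨u, y, hu, hy⟩ := h1
    have hc : t.ctl u = 0 := by
      by_contra hcon
      exact hu ((R.ctl_iff u).1 hcon)
    exact ⟨_, .w_t hj hs hi hx u.2 hc ((R.succ_eq_iff (x := ⟨x, hx⟩)).2 ⟨y.2, hy⟩) (by norm_num),
      y.2, h2 u y hu hy⟩
  | @y_succ j s b x hj hs hb hx =>
    refine ⟨by simp, fun _ => ?_⟩
    obtain ⟨_, h⟩ := ha
    rcases F.Y_succ j (R.m_eq ▸ hj) s hs _ _ h with h | ⟨i, hi, h⟩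
    · exact ⟨_, .y_succ hj hs hb hx, hx, h⟩
    · exact ⟨_, .y_b hj hs (R.n_eq ▸ hi) hb hx, hx, h⟩
  | @y_b j s i b x hj hs hi hb hx =>
    refine ⟨by simp, fun _ => ?_⟩
    obtain ⟨_, h⟩ := ha
    rcases F.Y_succ j (R.m_eq ▸ hj) s hs _ _ h with h | ⟨i, hi, h⟩
    · exact ⟨_, .y_succ hj hs hb hx, hx, h⟩
    · exact ⟨_, .y_b hj hs (R.n_eq ▸ hi) hb hx, hx, h⟩

/-- The graph decides whether there are ranked winning conditions. -/
theorem exists_consistent_iff_family {G : Arena (Fin t.N) (Fin t.α)} (R : t.Rep G)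
    (x₀ : Fin t.N) :
    (∃ B, Consistent t.graph B ∧ B ((Nd.Y 0 t.P 1 x₀).code t.D)) ↔
      ∃ Y B, G.Family t.P Y B ∧ Y 0 t.P true x₀ := by
  rw [exists_consistent_iff (fun x hx a ha => R.succ_le hx ha)
    (by have := x₀.2; simp only [Nd.Lt, P, D]; omega)]
  constructor
  · rintro ⟨A, hA, h⟩
    exact ⟨_, _, exists_family_of_sound R hA, h⟩
  · rintro ⟨Y, B, F, h⟩
    obtain ⟨A, hA, h'⟩ := exists_sound_of_family R F
    exact ⟨A, hA, h' _ _ _ _ h⟩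

end Tab

end RTC

/-! ### Rules for programs that append edges; addresses of nodes. -/

namespace RTC

open Prog

/-! ### Programs that build graphs -/

/-- The program changes none of the registers `R` and arrays `M`. -/
def Prog.keeps (p : Prog) (R M : List ℕ) : Bool :=
  R.all (fun r => !p.modR r) && M.all fun b => !p.modM b

theorem Framed.reg_eq {p : Prog} {σ σ' : Store} (h : Framed p σ σ') {R M : List ℕ}
    (hk : p.keeps R M = true) {r : ℕ} (hr : r ∈ R) : σ'.reg r = σ.reg r := by
  simp only [keeps, Bool.and_eq_true, List.all_eq_true, Bool.not_eq_true'] at hk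
  exact h.1 r (hk.1 r hr)

theorem Framed.mem_eq {p : Prog} {σ σ' : Store} (h : Framed p σ σ') {R M : List ℕ}
    (hk : p.keeps R M = true) {b : ℕ} (hb : b ∈ M) : σ'.mem b = σ.mem b := by
  simp only [keeps, Bool.and_eq_true, List.all_eq_true, Bool.not_eq_true'] at hk
  exact h.2 b (hk.2 b hb)

theorem Framed.exec {p : Prog} (h : p.loopFree = true) (σ : Store) : Framed p σ (p.exec σ) := by
  obtain ⟨t, -, hr⟩ := Run.exec h σ
  exact hr.frame

theorem Framed.setReg {p : Prog} {σ : Store} {r c : ℕ} (h : p.modR r = true) :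
    Framed p σ (σ.setReg r c) := by
  refine ⟨fun y hy => ?_, fun _ _ => rfl⟩
  have : y ≠ r := by
    rintro rfl
    simp [h] at hy
  simp [this]

theorem GraphOn.congr {L : Edges} {σ σ' : Store} (h : GraphOn L σ) (h8 : σ'.reg 8 = σ.reg 8)
    (hm : ∀ b ∈ [20, 21, 22, 23, 24], σ'.mem b = σ.mem b) : GraphOn L σ' := by
  unfold GraphOn
  rw [h8, hm 20 (by decide), hm 21 (by decide), hm 22 (by decide), hm 23 (by decide),
    hm 24 (by decide)]
  exact h

/-- The list of edges on numbers. -/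
def codeEdges (D : ℕ) (E : List (Nd × Nd × ℕ)) : Edges :=
  E.map fun e => (e.1.code D, e.2.1.code D, e.2.2)

/-- Started in `σ`, the program appends the edges `E` within `T` steps. -/
def Emits (D : ℕ) (p : Prog) (σ : Store) (T : ℕ) (E : List (Nd × Nd × ℕ)) : Prop :=
  E.length ≤ T ∧ ∀ L, GraphOn L σ → Tri p σ T (GraphOn (L ++ codeEdges D E))

variable {D : ℕ}

theorem Emits.mono {p : Prog} {σ : Store} {T T' : ℕ} {E : List (Nd × Nd × ℕ)}
    (h : Emits D p σ T E) (hT : T ≤ T') : Emits D p σ T' E :=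
  ⟨h.1.trans hT, fun L hL => (h.2 L hL).mono hT fun _ _ h => h⟩

theorem Emits.seq {p q : Prog} {σ : Store} {T₁ T₂ : ℕ} {E₁ E₂ : List (Nd × Nd × ℕ)}
    (h : Emits D p σ T₁ E₁) (h' : ∀ σ', Framed p σ σ' → Emits D q σ' T₂ E₂) :
    Emits D (.seq p q) σ (T₁ + T₂) (E₁ ++ E₂) := by
  refine ⟨?_, fun L hL => Tri.seq ((h.2 L hL).mono le_rfl fun σ' hF hL' => ?_)⟩
  · rw [List.length_append]
    exact Nat.add_le_add h.1 (h' σ (Framed.refl p σ)).1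
  · have := (h' σ' hF).2 _ hL'
    simpa [codeEdges] using this

theorem Emits.seq_exec {p q : Prog} {σ : Store} {T : ℕ} {E : List (Nd × Nd × ℕ)}
    (hp : p.loopFree = true) (hk : p.keeps [8] [20, 21, 22, 23, 24] = true)
    (h : Framed p σ (p.exec σ) → Emits D q (p.exec σ) T E) :
    Emits D (.seq p q) σ (p.cost + T) E := by
  have hF := Framed.exec hp σ
  refine ⟨(h hF).1.trans (Nat.le_add_left _ _), fun L hL => Tri.seq_exec hp ((h hF).2 L ?_) le_rfl⟩
  exact hL.congr (hF.reg_eq hk (by decide)) fun b hb => hF.mem_eq hk hb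

theorem Emits.exec {p : Prog} {σ : Store} {T : ℕ} (hp : p.loopFree = true)
    (hk : p.keeps [8] [20, 21, 22, 23, 24] = true) (hT : p.cost ≤ T) : Emits D p σ T [] := by
  have hF := Framed.exec hp σ
  refine ⟨Nat.zero_le _, fun L hL => Tri.exec hp hT ?_⟩
  simpa [codeEdges] using hL.congr (hF.reg_eq hk (by decide)) fun b hb => hF.mem_eq hk hb

theorem Emits.ite {x : ℕ} {p q : Prog} {σ : Store} {T : ℕ} {E₁ E₂ : List (Nd × Nd × ℕ)}
    {c : Prop} [Decidable c] (hc : σ.reg x ≠ 0 ↔ c) (h₁ : c → Emits D p σ T E₁)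
    (h₂ : ¬ c → Emits D q σ T E₂) :
    Emits D (.ite x p q) σ (T + 1) (if c then E₁ else E₂) := by
  split_ifs with h
  · exact ⟨(h₁ h).1.trans (Nat.le_succ _), fun L hL => Tri.ite (fun _ => (h₁ h).2 L hL)
      fun h0 => absurd h0 (hc.2 h)⟩
  · exact ⟨(h₂ h).1.trans (Nat.le_succ _), fun L hL => Tri.ite (fun h0 => absurd (hc.1 h0) h)
      fun _ => (h₂ h).2 L hL⟩

theorem Emits.forLoop {r n : ℕ} {body : Prog} {σ : Store} {N T : ℕ}
    {E : ℕ → List (Nd × Nd × ℕ)} (hn : σ.reg n = N)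
    (hfr : (body.modR r = false ∧ body.modR n = false ∧ r ≠ n ∧ r ≠ 6 ∧ r ≠ 7 ∧ n ≠ 6 ∧ n ≠ 7) ∧
      r ≠ 8)
    (hstep : ∀ i < N, ∀ σ', Framed (.forLoop r n body) σ σ' → σ'.reg r = i →
      Emits D body σ' T (E i)) :
    Emits D (.forLoop r n body) σ (N * (T + 4) + 3) ((List.range N).flatMap E) := by
  constructor
  · have hlen : ∀ K ≤ N, ((List.range K).flatMap E).length ≤ K * T := by
      intro K hK
      induction K with
      | zero => simp
      | succ K ih =>
        rw [List.range_succ, List.flatMap_append, List.length_append, Nat.succ_mul]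
        refine Nat.add_le_add (ih (by omega)) ?_
        -- The bound on the length of `E K` does not depend on the store, so any admissible store
        -- will do, such as `σ` with the counter set.
        have := (hstep K (by omega) (σ.setReg r K) (Framed.setReg (by simp [Prog.forLoop, modR]))
          (by simp)).1
        simpa using this
    refine (hlen N le_rfl).trans ?_
    have := Nat.mul_le_mul_left N (Nat.le_add_right T 4)
    omega
  · intro L hL
    refine Tri.forLoop_framed (fun i => GraphOn (L ++ codeEdges D ((List.range i).flatMap E))) hn
      hfr.1 ?_ ?_
    · have : (8 : ℕ) ≠ r := hfr.2.symm
      simpa [codeEdges] using hL.congr (σ' := (σ.setReg r 0).setReg 6 N) (by simp [this])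
        fun _ _ => rfl
    · intro i σ' hi hL' hr hF
      refine ((hstep i hi σ' hF hr).2 _ hL').mono le_rfl fun σ'' _ hL'' => ?_
      have h8 : (8 : ℕ) ≠ r := hfr.2.symm
      have := hL''.congr (σ' := ((σ''.setReg 7 1).setReg r (i + 1)).setReg 6 (N - (i + 1)))
        (by simp [h8]) fun _ _ => rfl
      rw [List.range_succ, List.flatMap_append]
      simpa [codeEdges] using this

/-! ### Addresses of nodes -/

/-- `d` becomes the sum of the array entries `l`, given by arrays and registers. -/
def addr (d : ℕ) : List (ℕ × ℕ) → Prog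
  | [] => .const d 0
  | e :: l => .seq (addr d l) (.seq (.load 47 e.1 e.2) (.add d d 47))

/-- The sum of array entries. -/
def addrVal (σ : Store) : List (ℕ × ℕ) → ℕ
  | [] => 0
  | e :: l => addrVal σ l + σ.mem e.1 (σ.reg e.2)

theorem addr_spec {d : ℕ} (hd : d ≠ 47) {l : List (ℕ × ℕ)} (h : ∀ e ∈ l, e.2 ≠ d ∧ e.2 ≠ 47)
    (σ : Store) : (addr d l).loopFree = true ∧ (addr d l).cost = 2 * l.length + 1 ∧
      ((addr d l).exec σ).reg d = addrVal σ l ∧ ((addr d l).exec σ).mem = σ.mem ∧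
      ∀ y, y ≠ d → y ≠ 47 → ((addr d l).exec σ).reg y = σ.reg y := by
  induction l with
  | nil => simp +contextual [addr, loopFree, cost, Prog.exec, addrVal]
  | cons e l ih =>
    obtain ⟨h1, h2, h3, h4, h5⟩ := ih fun e he => h e (List.mem_cons_of_mem _ he)
    obtain ⟨e1, e2⟩ := h e List.mem_cons_self
    refine ⟨by simp [addr, loopFree, h1], ?_, ?_, ?_, ?_⟩
    · simp only [addr, cost, h2, List.length_cons]
      omega
    · simp [addr, Prog.exec, h3, h4, h5 _ e1 e2, addrVal, hd]
    · simp [addr, Prog.exec, h4]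
    · intro y hy hy'
      simp [addr, Prog.exec, hy, hy', h5 y hy hy']

theorem addrVal_congr {σ σ' : Store} {l : List (ℕ × ℕ)} (hm : σ'.mem = σ.mem)
    (hr : ∀ e ∈ l, σ'.reg e.2 = σ.reg e.2) : addrVal σ' l = addrVal σ l := by
  induction l with
  | nil => rfl
  | cons e l ih =>
    simp only [addrVal]
    rw [ih fun e he => hr e (List.mem_cons_of_mem _ he), hm, hr e List.mem_cons_self]

/-- Append an edge between nodes that are given by addresses. -/
def link (q p : List (ℕ × ℕ)) (w : ℕ) : Prog :=
  .seq (addr 45 q) (.seq (addr 46 p) (emit 45 46 w))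

/-- Operands in registers from `50` on are safe from the scratch registers of `addr` and `emit`. Two
addresses of total length at most 14 cost at most 30 steps, the edge itself 10. The empty address
denotes the dead node. -/
theorem emits_link {σ : Store} {q p : List (ℕ × ℕ)} {w c : ℕ} {a b : Nd}
    (hq : addrVal σ q = a.code D) (hp : addrVal σ p = b.code D) (hw : σ.reg w = c)
    (hs : ((q ++ p).all (fun e => decide (50 ≤ e.2)) && decide (50 ≤ w) &&
      decide ((q ++ p).length ≤ 14)) = true) (hc : c ≤ 1) : Emits D (link q p w) σ 40 [(a, b,
          c)] := by
  simp only [Bool.and_eq_true, List.all_eq_true, decide_eq_true_eq, List.mem_append,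
    List.length_append] at hs
  obtain ⟨⟨hs, hw50⟩, hlen⟩ := hs
  refine ⟨by simp, fun L hL => ?_⟩
  obtain ⟨a1, a2, a3, a4, a5⟩ := addr_spec (d := 45) (by norm_num) (l := q)
    (fun e he => by have := hs e (Or.inl he); omega) σ
  obtain ⟨b1, b2, b3, b4, b5⟩ := addr_spec (d := 46) (by norm_num) (l := p)
    (fun e he => by have := hs e (Or.inr he); omega) ((addr 45 q).exec σ)
  refine Tri.exec (by simp [link, loopFree, a1, b1, emit, block]) ?_ ?_
  · simp only [link, cost, a2, b2, emit, block]
    omega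
  · simp only [link, Prog.exec]
    set σ' := (addr 46 p).exec ((addr 45 q).exec σ) with hσ'
    have e45 : σ'.reg 45 = a.code D := by
      rw [b5 45 (by norm_num) (by norm_num), a3, hq]
    have e46 : σ'.reg 46 = b.code D := by
      rw [b3, addrVal_congr a4 fun e he => by
        have := hs e (Or.inr he)
        exact a5 _ (by omega) (by omega), hp]
    have ew : σ'.reg w = c := by
      rw [b5 w (by omega) (by omega), a5 w (by omega) (by omega), hw]
    have hL' : GraphOn L σ' := hL.congr
      ((b5 8 (by norm_num) (by norm_num)).trans (a5 8 (by norm_num) (by norm_num)))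
      fun _ _ => by rw [b4, a4]
    have := graphOn_emit hL' (q := 45) (p := 46) (w := w) (by decide) (by decide)
      (by omega) (by omega)
    rw [e45, e46, ew] at this
    simpa [codeEdges] using this

/-- The address of a node whose components are given by registers. -/
def nodeAddr (t j s i v b x : ℕ) : List (ℕ × ℕ) :=
  [(30, x), (31, b), (32, v), (33, i), (34, s), (35, j), (36, t)]

/-- Address of a node `Y`; `b` and `x` are in the registers `54` and `53`. -/
def addrY (j s : ℕ) : List (ℕ × ℕ) := nodeAddr 61 j s 60 60 54 53

/-- Address of a node `W`. -/
def addrW : List (ℕ × ℕ) := nodeAddr 62 50 51 52 60 60 53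

/-- Address of a node `B`. -/
def addrB (v : ℕ) : List (ℕ × ℕ) := nodeAddr 63 50 51 52 v 54 53

/-- Address of a node `T`. -/
def addrT (v b x : ℕ) : List (ℕ × ℕ) := nodeAddr 64 50 51 52 v b x

/-- Registers used by the tables. -/
def regsBase : List ℕ := [1, 3, 4, 24, 60, 61, 62, 63, 64, 65, 66, 67, 68]

/-- Arrays used by the tables. -/
def arrsBase : List ℕ := [1, 14, 16, 17, 18, 30, 31, 32, 33, 34, 35, 36]

/-- The tables are in the store. -/
structure Base (t : Tab) (σ : Store) : Prop where
  pow : ∀ k < 7, ∀ d < t.D, σ.mem (30 + k) d = d * t.D ^ k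
  row : ∀ x < t.N, σ.mem 18 x = x * t.α
  succ : ∀ x < t.N, ∀ a < t.α, σ.mem 14 (x * t.α + a) = t.succ x a
  ctl : ∀ a < t.α, σ.mem 1 a = t.ctl a
  loud : ∀ x < t.N, σ.mem 17 x = t.loud x
  val : ∀ r < t.n + t.m + 1, ∀ x < t.N, σ.mem 16 (r * t.D + x) = t.val r x
  r1 : σ.reg 1 = t.α
  r3 : σ.reg 3 = t.n
  r4 : σ.reg 4 = t.m
  r24 : σ.reg 24 = t.N
  r60 : σ.reg 60 = 0
  r61 : σ.reg 61 = 1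
  r62 : σ.reg 62 = 2
  r63 : σ.reg 63 = 3
  r64 : σ.reg 64 = 4
  r65 : σ.reg 65 = t.P
  r66 : σ.reg 66 = t.P + 1
  r67 : σ.reg 67 = t.n + 1
  r68 : σ.reg 68 = t.m + 1

theorem Base.framed {t : Tab} {σ σ' : Store} (h : Base t σ) {p : Prog} (hF : Framed p σ σ')
    (hk : p.keeps regsBase arrsBase = true) : Base t σ' := by
  have hr : ∀ r ∈ regsBase, σ'.reg r = σ.reg r := fun r hr => hF.reg_eq hk hr
  have hm : ∀ b ∈ arrsBase, σ'.mem b = σ.mem b := fun r hr => hF.mem_eq hk hr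
  have hp : ∀ k < 7, σ'.mem (30 + k) = σ.mem (30 + k) := by
    intro k hk
    exact hm _ (by interval_cases k <;> decide)
  constructor
  · intro k hk d hd; rw [hp k hk]; exact h.pow k hk d hd
  · rw [hm 18 (by decide)]; exact h.row
  · rw [hm 14 (by decide)]; exact h.succ
  · rw [hm 1 (by decide)]; exact h.ctl
  · rw [hm 17 (by decide)]; exact h.loud
  · rw [hm 16 (by decide)]; exact h.val
  · rw [hr 1 (by decide)]; exact h.r1
  · rw [hr 3 (by decide)]; exact h.r3
  · rw [hr 4 (by decide)]; exact h.r4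
  · rw [hr 24 (by decide)]; exact h.r24
  · rw [hr 60 (by decide)]; exact h.r60
  · rw [hr 61 (by decide)]; exact h.r61
  · rw [hr 62 (by decide)]; exact h.r62
  · rw [hr 63 (by decide)]; exact h.r63
  · rw [hr 64 (by decide)]; exact h.r64
  · rw [hr 65 (by decide)]; exact h.r65
  · rw [hr 66 (by decide)]; exact h.r66
  · rw [hr 67 (by decide)]; exact h.r67
  · rw [hr 68 (by decide)]; exact h.r68

/-- The Horner form of `digits`, multiplied out, is a sum of multiples of powers of `D`, and each
summand is a table entry. This replaces multiplication. -/
theorem addrVal_node {t : Tab} {σ : Store} (h : Base t σ) {rt rj rs ri rv rb rx : ℕ}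
    {k j s i v b x : ℕ} (ht : σ.reg rt = k) (hj : σ.reg rj = j) (hs : σ.reg rs = s)
    (hi : σ.reg ri = i) (hv : σ.reg rv = v) (hb : σ.reg rb = b) (hx : σ.reg rx = x) (hk : k < 5)
    (hlt : j < t.D ∧ s < t.D ∧ i < t.D ∧ v < t.D ∧ b < t.D ∧ x < t.D) :
    addrVal σ (nodeAddr rt rj rs ri rv rb rx) = digits t.D k j s i v b x := by
  obtain ⟨l1, l2, l3, l4, l5, l6⟩ := hlt
  have l7 : k < t.D := by simp only [Tab.D]; omega
  have p0 := h.pow 0 (by norm_num) x l6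
  have p1 := h.pow 1 (by norm_num) b l5
  have p2 := h.pow 2 (by norm_num) v l4
  have p3 := h.pow 3 (by norm_num) i l3
  have p4 := h.pow 4 (by norm_num) s l2
  have p5 := h.pow 5 (by norm_num) j l1
  have p6 := h.pow 6 (by norm_num) k l7
  norm_num at p0 p1 p2 p3 p4 p5 p6
  simp only [nodeAddr, addrVal, ht, hj, hs, hi, hv, hb, hx, p0, p1, p2, p3, p4, p5, p6, digits]
  ring

end RTC

/-! ### Building the graph, with one loop for each index of a node. -/

namespace RTC

open Prog

/-! ### The program that builds the graph of an arena -/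

/-- Decide whether the goal of the phase is reached. -/
def buildHit : Prog :=
  .seq (.sub 79 4 50) (.ite 79 (.block [.load 78 31 58, .add 78 78 53, .load 78 16 78])
    (.ite 54 (.seq (.sub 79 65 55) (.ite 79 (.const 78 0) (.const 78 1))) (.const 78 1)))

/-- Decide whether the assumption of the stage holds. -/
def buildStay : Prog :=
  .seq (.sub 79 3 52) (.ite 79 (.block [.load 79 31 57, .add 79 79 53, .load 79 16 79])
    (.const 79 0))

/-- Edges for targets. -/
def buildT : Prog :=
  .seq (link (addrT 55 54 53) [] 61) (.seq (link (addrB 55) [] 61) (.seq (.load 77 16 53)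
    (.ite 77 (.seq buildHit (.seq (.ite 78 (link (addrT 55 54 53) (addrY 70 65) 61) (.const 77 0))
      (.seq (link (addrT 55 54 53) (addrY 50 51) 61) (.seq buildStay
        (.ite 79 (.const 77 0) (link (addrT 55 54 53) (addrB 55) 61)))))) (.const 77 0))))

/-- Look up an action and a successor. -/
def buildStep : Prog := .block [.load 77 1 56, .load 78 18 53, .add 78 78 56, .load 78 14 78]

/-- Determine the successor and the counter after a controllable action. -/
def buildAfter : Prog :=
  .block [.sub 75 78 61, .const 79 1, .ite 73 (.seq (.load 76 17 53)
    (.ite 76 (.ite 54 (.add 76 55 60) (.const 79 0)) (.add 76 65 60))) (.const 76 0)]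

/-- Edges for a controllable action. -/
def buildC : Prog :=
  .seq buildStep (.ite 77 (.ite 78 (.seq buildAfter
    (.ite 79 (link (addrB 72) (addrT 76 61 75) 61) (.const 79 0))) (.const 79 0)) (.const 79 0))

/-- Edges for positions at a stage. -/
def buildV : Prog :=
  .seq (.add 72 55 61) (.seq (link (addrB 72) addrW 73) (.forLoop 56 1 buildC))

/-- Edges for an uncontrollable action. -/
def buildU : Prog :=
  .seq buildStep (.ite 77 (.const 79 0) (.ite 78 (.seq (.sub 75 78 61)
    (.seq (link addrW (addrT 65 60 75) 60) (link addrW (addrT 65 60 75) 61))) (.const 79 0)))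

/-- Edges for given `j`, `s`, `i`, `x` and `b`. -/
def buildB : Prog :=
  .seq (link (addrY 50 71) (addrB 65) 61) (.seq (.forLoop 55 66 buildT) (.forLoop 55 65 buildV))

/-- Edges for given `j`, `s`, `i` and `x`. -/
def buildX : Prog :=
  .seq (link addrW [] 61) (.seq (.forLoop 56 1 buildU) (.forLoop 54 62 buildB))

/-- Edges for given `j`, `s` and `i`. -/
def buildI : Prog :=
  .seq (.seq (.add 57 52 61) (.seq (.sub 73 3 52) (.ite 73 (.const 73 1) (.const 73 0))))
    (.forLoop 53 24 buildX)

/-- Edges for given `j` and `s`. -/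
def buildS : Prog :=
  .seq (.add 71 51 61) (.seq (.forLoop 54 62 (.forLoop 53 24 (link (addrY 50 71) (addrY 50 51) 61)))
    (.forLoop 52 67 buildI))

/-- Edges for given `j`. -/
def buildJ : Prog :=
  .seq (.seq (.add 58 67 50) (.seq (.sub 70 4 50) (.ite 70 (.add 70 50 61) (.const 70 0))))
    (.seq (.forLoop 54 62 (.forLoop 53 24 (link (addrY 50 60) [] 61))) (.forLoop 51 65 buildS))

/-- All edges. -/
def build : Prog := .forLoop 50 68 buildJ

variable {t : Tab} {σ σ' : Store} {j s i x b v : ℕ} {p : Prog}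

/-- The store while the edges for `j` are built. -/
structure EnvJ (t : Tab) (j : ℕ) (σ : Store) : Prop extends Base t σ where
  le_m : j ≤ t.m
  r50 : σ.reg 50 = j
  r58 : σ.reg 58 = t.n + 1 + j
  r70 : σ.reg 70 = t.nxt j

/-- The store while the edges for `j` and `s` are built. -/
structure EnvS (t : Tab) (j s : ℕ) (σ : Store) : Prop extends EnvJ t j σ where
  lt_P : s < t.P
  r51 : σ.reg 51 = s
  r71 : σ.reg 71 = s + 1

/-- The store while the edges for `j`, `s` and `i` are built. -/
structure EnvI (t : Tab) (j s i : ℕ) (σ : Store) : Prop extends EnvS t j s σ where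
  le_n : i ≤ t.n
  r52 : σ.reg 52 = i
  r57 : σ.reg 57 = i + 1
  r73 : σ.reg 73 = if i < t.n then 1 else 0

/-- The store while the edges for `j`, `s`, `i` and `x` are built. -/
structure EnvX (t : Tab) (j s i x : ℕ) (σ : Store) : Prop extends EnvI t j s i σ where
  lt_N : x < t.N
  r53 : σ.reg 53 = x

/-- The store while the edges for `j`, `s`, `i`, `x` and `b` are built. -/
structure EnvB (t : Tab) (j s i x b : ℕ) (σ : Store) : Prop extends EnvX t j s i x σ where
  lt_two : b < 2
  r54 : σ.reg 54 = b

/-- Registers in use. -/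
def regsJ : List ℕ := [1, 3, 4, 24, 60, 61, 62, 63, 64, 65, 66, 67, 68, 50, 58, 70]

/-- Registers in use. -/
def regsS : List ℕ := regsJ ++ [51, 71]

/-- Registers in use. -/
def regsI : List ℕ := regsS ++ [52, 57, 73]

/-- Registers in use. -/
def regsX : List ℕ := regsI ++ [53]

/-- Registers in use. -/
def regsB : List ℕ := regsX ++ [54]

theorem Prog.keeps_of_subset {R R' M M' : List ℕ} (h : p.keeps R' M' = true) (hR : R ⊆ R')
    (hM : M ⊆ M') : p.keeps R M = true := by
  simp only [keeps, Bool.and_eq_true, List.all_eq_true] at h ⊢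
  exact ⟨fun r hr => h.1 r (hR hr), fun b hb => h.2 b (hM hb)⟩

theorem EnvJ.framed (h : EnvJ t j σ) (hF : Framed p σ σ') (hk : p.keeps regsJ arrsBase = true) :
    EnvJ t j σ' where
  toBase := h.toBase.framed hF (keeps_of_subset hk (by decide) (by decide))
  le_m := h.le_m
  r50 := (hF.reg_eq hk (by decide)).trans h.r50
  r58 := (hF.reg_eq hk (by decide)).trans h.r58
  r70 := (hF.reg_eq hk (by decide)).trans h.r70

theorem EnvS.framed (h : EnvS t j s σ) (hF : Framed p σ σ') (hk : p.keeps regsS arrsBase = true) :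
    EnvS t j s σ' where
  toEnvJ := h.toEnvJ.framed hF (keeps_of_subset hk (by decide) (by decide))
  lt_P := h.lt_P
  r51 := (hF.reg_eq hk (by decide)).trans h.r51
  r71 := (hF.reg_eq hk (by decide)).trans h.r71

theorem EnvI.framed (h : EnvI t j s i σ) (hF : Framed p σ σ')
    (hk : p.keeps regsI arrsBase = true) : EnvI t j s i σ' where
  toEnvS := h.toEnvS.framed hF (keeps_of_subset hk (by decide) (by decide))
  le_n := h.le_n
  r52 := (hF.reg_eq hk (by decide)).trans h.r52
  r57 := (hF.reg_eq hk (by decide)).trans h.r57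
  r73 := (hF.reg_eq hk (by decide)).trans h.r73

theorem EnvX.framed (h : EnvX t j s i x σ) (hF : Framed p σ σ')
    (hk : p.keeps regsX arrsBase = true) : EnvX t j s i x σ' where
  toEnvI := h.toEnvI.framed hF (keeps_of_subset hk (by decide) (by decide))
  lt_N := h.lt_N
  r53 := (hF.reg_eq hk (by decide)).trans h.r53

theorem EnvB.framed (h : EnvB t j s i x b σ) (hF : Framed p σ σ')
    (hk : p.keeps regsB arrsBase = true) : EnvB t j s i x b σ' where
  toEnvX := h.toEnvX.framed hF (keeps_of_subset hk (by decide) (by decide))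
  lt_two := h.lt_two
  r54 := (hF.reg_eq hk (by decide)).trans h.r54

theorem Base.addrY (h : Base t σ) {rj rs : ℕ} (hj : σ.reg rj = j) (hs : σ.reg rs = s)
    (hb : σ.reg 54 = b) (hx : σ.reg 53 = x) (hlt : j ≤ t.m ∧ s ≤ t.P ∧ b < 2 ∧ x < t.N) :
    addrVal σ (addrY rj rs) = (Nd.Y j s b x).code t.D :=
  addrVal_node h h.r61 hj hs h.r60 h.r60 hb hx (by norm_num)
    (by simp only [Tab.P, Tab.D] at hlt ⊢; omega)

theorem EnvX.addrW (h : EnvX t j s i x σ) : addrVal σ addrW = (Nd.W j s i x).code t.D :=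
  addrVal_node h.toBase h.r62 h.r50 h.r51 h.r52 h.r60 h.r60 h.r53 (by norm_num) (by
    have := h.le_m; have := h.lt_P; have := h.le_n; have := h.lt_N
    simp only [Tab.P, Tab.D] at *; omega)

theorem EnvB.addrB (h : EnvB t j s i x b σ) {rv : ℕ} (hv : σ.reg rv = v) (hle : v ≤ t.P) :
    addrVal σ (addrB rv) = (Nd.B j s i v b x).code t.D :=
  addrVal_node h.toBase h.r63 h.r50 h.r51 h.r52 hv h.r54 h.r53 (by norm_num) (by
    have := h.le_m; have := h.lt_P; have := h.le_n; have := h.lt_N; have := h.lt_two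
    simp only [Tab.P, Tab.D] at *; omega)

theorem EnvX.addrT (h : EnvX t j s i x σ) {rv rb rx y : ℕ} (hv : σ.reg rv = v) (hb : σ.reg rb = b)
    (hx : σ.reg rx = y) (hle : v ≤ t.P ∧ b < 2 ∧ y < t.N) :
    addrVal σ (addrT rv rb rx) = (Nd.T j s i v b y).code t.D :=
  addrVal_node h.toBase h.r64 h.r50 h.r51 h.r52 hv hb hx (by norm_num) (by
    have := h.le_m; have := h.lt_P; have := h.le_n
    simp only [Tab.P, Tab.D] at *; omega)

/-- Truncated subtraction decides the comparisons: `m - j` vanishes unless `j < m`, and `P - v`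
vanishes only for `v = P`, given `v ≤ P`. -/
theorem reg_buildHit (h : EnvB t j s i x b σ) (h55 : σ.reg 55 = v) (hv : v ≤ t.P) :
    (buildHit.exec σ).reg 78 ≠ 0 ↔ t.Hit j v b x := by
  have h31 := h.pow 1 (by norm_num) (t.n + 1 + j)
  norm_num at h31
  have hval := h.val (t.n + 1 + j)
  unfold Tab.Hit
  by_cases hj : j < t.m
  · have e := hval (by omega) x h.lt_N
    have h0 : t.m - j ≠ 0 := by omega
    simp [buildHit, block, Prog.exec, h.r4, h.r50, h0, hj, h.r58, h.r53, e,
      h31 (by simp only [Tab.D]; omega)]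
  · have h0 : t.m - j = 0 := by omega
    by_cases hb : b = 0
    · simp [buildHit, block, Prog.exec, h.r4, h.r50, h0, hj, h.r54, hb]
    · by_cases hP : t.P - v = 0
      · have : v = t.P := by omega
        simp [buildHit, block, Prog.exec, h.r4, h.r50, h0, hj, h.r54, hb, h.r65, h55, this]
      · have : v ≠ t.P := by omega
        simp [buildHit, block, Prog.exec, h.r4, h.r50, h0, hj, h.r54, hb, h.r65, h55, hP, this]

theorem reg_buildStay (h : EnvX t j s i x σ) :
    (buildStay.exec σ).reg 79 ≠ 0 ↔ ¬ t.Stay i x := by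
  have h31 := h.pow 1 (by norm_num) (i + 1)
  norm_num at h31
  have hval := h.val (i + 1)
  unfold Tab.Stay
  by_cases hi : i < t.n
  · have e := hval (by omega) x h.lt_N
    have h0 : t.n - i ≠ 0 := by omega
    simp [buildStay, block, Prog.exec, h.r3, h.r52, h0, hi, h.r57, h.r53, e,
      h31 (by simp only [Tab.D]; omega)]
  · have h0 : t.n - i = 0 := by omega
    simp [buildStay, block, Prog.exec, h.r3, h.r52, h0, hi]

theorem emits_buildT (h : EnvB t j s i x b σ) (h55 : σ.reg 55 = v) (hv : v ≤ t.P) :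
    Emits t.D buildT σ 230 (t.tEdges j s i x b v) := by
  -- One frame rule for all the intermediate programs; what they leave alone is evaluated by the
  -- kernel.
  have key : ∀ {p σ σ'}, EnvB t j s i x b σ → σ.reg 55 = v → Framed p σ σ' →
      p.keeps (regsB ++ [55]) arrsBase = true → EnvB t j s i x b σ' ∧ σ'.reg 55 = v :=
    fun h h55 hF hk => ⟨h.framed hF (keeps_of_subset hk (by decide) (by decide)),
      (hF.reg_eq hk (by decide)).trans h55⟩
  have hT : ∀ {σ}, EnvB t j s i x b σ → σ.reg 55 = v →
      addrVal σ (addrT 55 54 53) = (Nd.T j s i v b x).code t.D :=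
    fun h h55 => h.addrT h55 h.r54 h.r53 ⟨hv, h.lt_two, h.lt_N⟩
  refine (Emits.seq (T₁ := 40) (T₂ := 182)
    (emits_link (hT h h55) rfl h.r61 (by decide) le_rfl) fun σ₁ hF => ?_).mono (by norm_num)
  obtain ⟨h, h55⟩ := key h h55 hF (by decide +kernel)
  refine Emits.seq (T₁ := 40) (T₂ := 142)
    (emits_link (h.addrB h55 hv) rfl h.r61 (by decide) le_rfl) fun σ₂ hF => ?_
  obtain ⟨h, h55⟩ := key h h55 hF (by decide +kernel)
  refine Emits.seq_exec (T := 141) rfl rfl fun hF => ?_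
  have h77 : ((Prog.load 77 16 53).exec σ₂).reg 77 = t.val 0 x := by
    have := h.val 0 (by omega) x h.lt_N
    simpa [Prog.exec, h.r53] using this
  obtain ⟨h, h55⟩ := key h h55 hF (by decide +kernel)
  rw [← ite_not]
  refine Emits.ite (T := 140) (by rw [h77]) (fun h0 => ?_)
    fun h0 => Emits.exec rfl rfl (by decide)
  refine (Emits.seq_exec (T := 128) rfl rfl fun hF => ?_).mono (by decide)
  have h78 := reg_buildHit h h55 hv
  obtain ⟨h, h55⟩ := key h h55 hF (by decide +kernel)
  refine Emits.seq (T₁ := 41) (T₂ := 87) (Emits.ite h78 (fun hh => emits_link (hT h h55)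
      (h.addrY h.r70 h.r65 h.r54 h.r53 ⟨t.nxt_le j, le_rfl, h.lt_two,
          h.lt_N⟩) h.r61 (by decide) le_rfl)
      fun _ => Emits.exec rfl rfl (by decide)) fun σ₃ hF => ?_
  obtain ⟨h, h55⟩ := key h h55 hF (by decide +kernel)
  refine Emits.seq (T₁ := 40) (T₂ := 47) (emits_link (hT h h55)
      (h.addrY h.r50 h.r51 h.r54 h.r53 ⟨h.le_m, h.lt_P.le, h.lt_two,
          h.lt_N⟩) h.r61 (by decide) le_rfl)
      fun σ₄ hF => ?_
  obtain ⟨h, h55⟩ := key h h55 hF (by decide +kernel)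
  refine (Emits.seq_exec (T := 41) rfl rfl fun hF => ?_).mono (by decide)
  have h79 := reg_buildStay h.toEnvX
  obtain ⟨h, h55⟩ := key h h55 hF (by decide +kernel)
  rw [← ite_not]
  exact Emits.ite h79 (fun _ => Emits.exec rfl rfl (by decide)) fun _ =>
    emits_link (hT h h55) (h.addrB h55 hv) h.r61 (by decide) le_rfl

theorem reg_buildStep (h : EnvX t j s i x σ) {a : ℕ} (h56 : σ.reg 56 = a) (ha : a < t.α) :
    (buildStep.exec σ).reg 77 = t.ctl a ∧ (buildStep.exec σ).reg 78 = t.succ x a := by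
  simp [buildStep, block, Prog.exec, h56, h.ctl a ha, h.r53, h.row x h.lt_N,
    h.succ x h.lt_N a ha]

theorem reg_buildAfter (h : EnvB t j s i x b σ) (h55 : σ.reg 55 = v) {y : ℕ}
    (h78 : σ.reg 78 = y + 1) :
    (buildAfter.exec σ).reg 75 = y ∧
      ((buildAfter.exec σ).reg 79 = 0 → t.after i v b x = none) ∧
      ((buildAfter.exec σ).reg 79 ≠ 0 → t.after i v b x = some ((buildAfter.exec σ).reg 76)) := by
  unfold Tab.after
  by_cases hi : i < t.n
  · by_cases hl : t.loud x = 0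
    · simp [buildAfter, block, Prog.exec, h78, h.r61, h.r73, hi, h.r53, h.loud x h.lt_N, hl, h.r65,
        h.r60]
    · by_cases hb : b = 0
      · simp [buildAfter, block, Prog.exec, h78, h.r61, h.r73, hi, h.r53, h.loud x h.lt_N, hl,
            h.r54,
          hb]
      · simp [buildAfter, block, Prog.exec, h78, h.r61, h.r73, hi, h.r53, h.loud x h.lt_N, hl,
            h.r54,
          hb, h55, h.r60]
  · simp [buildAfter, block, Prog.exec, h78, h.r61, h.r73, hi]

theorem emits_buildC (hs : ∀ x < t.N, ∀ a < t.α, t.succ x a ≤ t.N) (h : EnvB t j s i x b σ)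
    (h55 : σ.reg 55 = v) (h72 : σ.reg 72 = v + 1) (hv : v < t.P) {a : ℕ} (h56 : σ.reg 56 = a)
    (ha : a < t.α) : Emits t.D buildC σ 60 (t.cEdges j s i x b v a) := by
  have key : ∀ {p σ σ'}, EnvB t j s i x b σ → σ.reg 55 = v → σ.reg 72 = v + 1 → Framed p σ σ' →
      p.keeps (regsB ++ [55, 72]) arrsBase = true → EnvB t j s i x b σ' ∧ σ'.reg 55 = v ∧
        σ'.reg 72 = v + 1 :=
    fun h h55 h72 hF hk => ⟨h.framed hF (keeps_of_subset hk (by decide) (by decide)),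
      (hF.reg_eq hk (by decide)).trans h55, (hF.reg_eq hk (by decide)).trans h72⟩
  refine (Emits.seq_exec (T := 53) rfl rfl fun hF => ?_).mono (by decide)
  obtain ⟨e77, e78⟩ := reg_buildStep h.toEnvX h56 ha
  obtain ⟨h, h55, h72⟩ := key h h55 h72 hF (by decide +kernel)
  unfold Tab.cEdges
  rw [← ite_not]
  refine Emits.ite (T := 52) (by rw [e77]) (fun _ => ?_) fun _ => Emits.exec rfl rfl (by decide)
  rw [← ite_not]
  refine Emits.ite (T := 51) (by rw [e78]) (fun h0 => ?_) fun _ => Emits.exec rfl rfl (by decide)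
  obtain ⟨y, hy⟩ := Nat.exists_eq_succ_of_ne_zero h0
  rw [hy] at e78 ⊢
  have hyN : y < t.N := by
    have := hs x h.lt_N a ha
    omega
  obtain ⟨e75, e1, e2⟩ := reg_buildAfter h h55 e78
  refine (Emits.seq_exec (T := 41) rfl rfl fun hF => ?_).mono (by decide)
  obtain ⟨h, h55, h72⟩ := key h h55 h72 hF (by decide +kernel)
  set σ₁ := buildAfter.exec (buildStep.exec σ)
  by_cases h79 : σ₁.reg 79 = 0
  · rw [e1 h79]
    -- The outcome of the test is known here, so the conditional is instantiated with a constant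
    -- proposition and only one branch matters.
    have := Emits.ite (D := t.D) (σ := σ₁) (x := 79) (p := link (addrB 72) (addrT 76 61 75) 61)
      (q := .const 79 0) (T := 40) (E₁ := []) (E₂ := []) (c := False) (by simp [h79])
      (fun h => h.elim) fun _ => Emits.exec rfl rfl (by decide)
    simpa using this
  · have hafter := e2 h79
    rw [hafter]
    have := Emits.ite (D := t.D) (σ := σ₁) (x := 79) (p := link (addrB 72) (addrT 76 61 75) 61)
      (q := .const 79 0) (T := 40) (E₂ := []) (c := True) (by simp [h79])
      (fun _ => emits_link (h.addrB h72 hv) (h.addrT rfl h.r61 e75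
        ⟨Tab.after_le hafter hv.le, by norm_num, hyN⟩) h.r61 (by decide) le_rfl) fun h => (h
            trivial).elim
    simpa using this

theorem emits_buildU (hs : ∀ x < t.N, ∀ a < t.α, t.succ x a ≤ t.N) (h : EnvX t j s i x σ)
    {a : ℕ} (h56 : σ.reg 56 = a) (ha : a < t.α) :
    Emits t.D buildU σ 90 (t.uEdges j s i x a) := by
  have key : ∀ {p σ σ'}, EnvX t j s i x σ → σ.reg 75 = t.succ x a - 1 → Framed p σ σ' →
      p.keeps (regsX ++ [75]) arrsBase = true → EnvX t j s i x σ' ∧ σ'.reg 75 = t.succ x a - 1 :=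
    fun h h75 hF hk => ⟨h.framed hF (keeps_of_subset hk (by decide) (by decide)),
      (hF.reg_eq hk (by decide)).trans h75⟩
  refine (Emits.seq_exec (T := 83) rfl rfl fun hF => ?_).mono (by decide)
  obtain ⟨e77, e78⟩ := reg_buildStep h h56 ha
  have h := h.framed hF (by decide +kernel)
  unfold Tab.uEdges
  rw [← ite_not]
  refine Emits.ite (T := 82) (by rw [e77]) (fun _ => Emits.exec rfl rfl (by decide)) fun _ => ?_
  rw [← ite_not]
  refine Emits.ite (T := 81) (by rw [e78]) (fun h0 => ?_) fun _ => Emits.exec rfl rfl (by decide)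
  have hyN : t.succ x a - 1 < t.N := by
    have := hs x h.lt_N a ha
    omega
  have e75 : ((Prog.sub 75 78 61).exec (buildStep.exec σ)).reg 75 = t.succ x a - 1 := by
    simp [Prog.exec, e78, h.r61]
  refine Emits.seq_exec (T := 80) rfl rfl fun hF => ?_
  have h := h.framed hF (by decide +kernel)
  have hT : ∀ {σ}, EnvX t j s i x σ → σ.reg 75 = t.succ x a - 1 →
      addrVal σ (addrT 65 60 75) = (Nd.T j s i t.P 0 (t.succ x a - 1)).code t.D :=
    fun h h75 => h.addrT h.r65 h.r60 h75 ⟨le_rfl, by norm_num, hyN⟩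
  refine Emits.seq (T₁ := 40) (T₂ := 40) (emits_link h.addrW (hT h e75) h.r60 (by decide)
    (by norm_num)) fun σ₁ hF => ?_
  obtain ⟨h, e75⟩ := key h e75 hF (by decide +kernel)
  exact emits_link h.addrW (hT h e75) h.r61 (by decide) le_rfl

theorem emits_buildV (hs : ∀ x < t.N, ∀ a < t.α, t.succ x a ≤ t.N) (h : EnvB t j s i x b σ)
    (h55 : σ.reg 55 = v) (hv : v < t.P) :
    Emits t.D buildV σ (64 * (t.α + 1)) (t.vEdges j s i x b v) := by
  refine (Emits.seq_exec (T := 40 + (t.α * (60 + 4) + 3)) rfl rfl fun hF => ?_).mono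
    (by simp only [cost]; omega)
  have e72 : ((Prog.add 72 55 61).exec σ).reg 72 = v + 1 := by simp [Prog.exec, h55, h.r61]
  have e55 := (hF.1 55 rfl).trans h55
  have h := h.framed hF (by decide +kernel)
  refine Emits.seq (emits_link (h.addrB e72 hv) h.addrW h.r73 (by decide)
    (by split_ifs <;> norm_num)) fun σ₁ hF => ?_
  have e72 := (hF.1 72 (by decide +kernel)).trans e72
  have e55 := (hF.1 55 (by decide +kernel)).trans e55
  have h := h.framed hF (by decide +kernel)
  exact Emits.forLoop h.r1 (by decide +kernel) fun a ha σ₂ hF h56 => emits_buildC hs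
    (h.framed hF (by decide +kernel)) ((hF.1 55 (by decide +kernel)).trans e55)
    ((hF.1 72 (by decide +kernel)).trans e72) hv h56 ha

/-- The loops over the counter `v` have length about `2 N`, and each round of the second one scans
all actions. The loops over `x` and `s` contribute two more factors `N`, which makes the cube. -/
theorem emits_buildB (hs : ∀ x < t.N, ∀ a < t.α, t.succ x a ≤ t.N) (h : EnvB t j s i x b σ) :
    Emits t.D buildB σ (900 * ((t.α + 1) * t.N)) (t.bEdges j s i x b) := by
  have hN : 1 ≤ t.N := by have := h.lt_N; omega
  refine (Emits.seq (T₂ := (t.P + 1) * (230 + 4) + 3 + (t.P * (64 * (t.α + 1) + 4) + 3))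
    (emits_link (h.addrY h.r50 h.r71 h.r54 h.r53 ⟨h.le_m, h.lt_P, h.lt_two, h.lt_N⟩)
    (h.addrB h.r65 le_rfl) h.r61 (by decide) le_rfl) fun σ₁ hF => ?_).mono ?_
  · have h := h.framed hF (by decide +kernel)
    refine Emits.seq (Emits.forLoop h.r66 (by decide +kernel) fun v hv σ₂ hF h55 =>
      emits_buildT (h.framed hF (by decide +kernel)) h55 (Nat.le_of_lt_succ hv)) fun σ₂ hF => ?_
    have h := h.framed hF (by decide +kernel)
    exact Emits.forLoop h.r65 (by decide +kernel) fun v hv σ₂ hF h55 =>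
      emits_buildV hs (h.framed hF (by decide +kernel)) h55 hv
  · have : t.P = 2 * t.N := rfl
    rw [this]
    nlinarith [Nat.zero_le (t.α * t.N)]

theorem emits_buildX (hs : ∀ x < t.N, ∀ a < t.α, t.succ x a ≤ t.N) (h : EnvX t j s i x σ) :
    Emits t.D buildX σ (2000 * ((t.α + 1) * t.N)) (t.xEdges j s i x) := by
  have hN : 1 ≤ t.N := by have := h.lt_N; omega
  refine (Emits.seq (T₂ := t.α * (90 + 4) + 3 + (2 * (900 * ((t.α + 1) * t.N) + 4) + 3))
    (emits_link h.addrW rfl h.r61 (by decide) le_rfl) fun σ₁ hF => ?_).mono ?_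
  · have h := h.framed hF (by decide +kernel)
    refine Emits.seq (Emits.forLoop h.r1 (by decide +kernel) fun a ha σ₂ hF h56 =>
      emits_buildU hs (h.framed hF (by decide +kernel)) h56 ha) fun σ₂ hF => ?_
    have h := h.framed hF (by decide +kernel)
    exact Emits.forLoop h.r62 (by decide +kernel) fun b hb σ₂ hF h54 =>
      emits_buildB hs ⟨h.framed hF (by decide +kernel), hb, h54⟩
  · nlinarith [Nat.mul_le_mul_left t.α hN]

theorem emits_buildI (hs : ∀ x < t.N, ∀ a < t.α, t.succ x a ≤ t.N) (h : EnvS t j s σ)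
    (h52 : σ.reg 52 = i) (hi : i ≤ t.n) :
    Emits t.D buildI σ (2020 * ((t.α + 1) * t.N ^ 2))
      ((List.range t.N).flatMap (t.xEdges j s i)) := by
  have hN : 1 ≤ t.N := by have := h.lt_P; simp only [Tab.P] at this; omega
  refine (Emits.seq_exec rfl rfl fun hF => Emits.forLoop (N := t.N)
    (T := 2000 * ((t.α + 1) * t.N)) ?_ (by decide +kernel) ?_).mono ?_
  · exact (hF.1 24 rfl).trans h.r24
  · have h' : EnvI t j s i _ := ⟨h.framed hF (by decide +kernel), hi, (hF.1 52 rfl).trans h52,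
      by simp [Prog.exec, h52, h.r61]; split_ifs <;> simp, by
        by_cases hi' : i < t.n
        · have : t.n - i ≠ 0 := by omega
          simp [Prog.exec, h52, h.r3, this, hi']
        · have : t.n - i = 0 := by omega
          simp [Prog.exec, h52, h.r3, this, hi']⟩
    exact fun x hx σ₂ hF h53 => emits_buildX hs ⟨h'.framed hF (by decide +kernel), hx, h53⟩
  · simp only [cost]
    norm_num
    nlinarith [Nat.mul_le_mul_left t.N hN, Nat.zero_le (t.α * t.N ^ 2)]

theorem emits_buildS (hs : ∀ x < t.N, ∀ a < t.α, t.succ x a ≤ t.N) (h : EnvJ t j σ)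
    (h51 : σ.reg 51 = s) (hlt : s < t.P) :
    Emits t.D buildS σ (2200 * ((t.n + 1) * ((t.α + 1) * t.N ^ 2))) (t.sEdges j s) := by
  have hN : 1 ≤ t.N := by simp only [Tab.P] at hlt; omega
  refine (Emits.seq_exec (T := 2 * (t.N * (40 + 4) + 3 + 4) + 3 +
    ((t.n + 1) * (2020 * ((t.α + 1) * t.N ^ 2) + 4) + 3)) rfl rfl fun hF => ?_).mono ?_
  · have h : EnvS t j s _ := ⟨h.framed hF (by decide +kernel), hlt, (hF.1 51 rfl).trans h51,
      by simp [Prog.exec, h51, h.r61]⟩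
    refine Emits.seq (Emits.forLoop h.r62 (by decide +kernel) fun b hb σ₂ hF h54 => ?_)
      fun σ₂ hF => ?_
    · have h := h.framed hF (by decide +kernel)
      refine Emits.forLoop h.r24 (by decide +kernel) fun x hx σ₂ hF h53 => ?_
      have h54 := (hF.1 54 (by decide +kernel)).trans h54
      have h := h.framed hF (by decide +kernel)
      exact emits_link (h.addrY h.r50 h.r71 h54 h53 ⟨h.le_m, h.lt_P, hb, hx⟩)
        (h.addrY h.r50 h.r51 h54 h53 ⟨h.le_m, h.lt_P.le, hb, hx⟩) h.r61 (by decide) le_rfl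
    · have h := h.framed hF (by decide +kernel)
      exact Emits.forLoop h.r67 (by decide +kernel) fun i hi σ₂ hF h52 =>
        emits_buildI hs (h.framed hF (by decide +kernel)) h52 (Nat.le_of_lt_succ hi)
  · simp only [cost]
    have h1 : t.N ≤ t.N ^ 2 := by nlinarith
    have h2 : t.N ^ 2 ≤ (t.α + 1) * t.N ^ 2 := Nat.le_mul_of_pos_left _ (Nat.succ_pos _)
    nlinarith [Nat.zero_le (t.n * ((t.α + 1) * t.N ^ 2)), Nat.mul_le_mul_left t.n (hN.trans
        (h1.trans h2))]

theorem emits_buildJ (hs : ∀ x < t.N, ∀ a < t.α, t.succ x a ≤ t.N) (hN : 1 ≤ t.N) (h : Base t σ)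
    (h50 : σ.reg 50 = j) (hj : j ≤ t.m) :
    Emits t.D buildJ σ (4600 * ((t.n + 1) * ((t.α + 1) * t.N ^ 3))) (t.jEdges j) := by
  refine (Emits.seq_exec (T := 2 * (t.N * (40 + 4) + 3 + 4) + 3 +
    (t.P * (2200 * ((t.n + 1) * ((t.α + 1) * t.N ^ 2)) + 4) + 3)) rfl rfl fun hF => ?_).mono ?_
  · have h : EnvJ t j _ := ⟨h.framed hF (by decide +kernel), hj, (hF.1 50 rfl).trans h50,
      by simp [Prog.exec, h50, h.r67]; split_ifs <;> simp, by
        by_cases hj' : j < t.m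
        · have : t.m - j ≠ 0 := by omega
          simp [Prog.exec, h50, h.r4, this, hj', Tab.nxt, h.r61]
        · have : t.m - j = 0 := by omega
          simp [Prog.exec, h50, h.r4, this, hj', Tab.nxt]⟩
    refine Emits.seq (Emits.forLoop h.r62 (by decide +kernel) fun b hb σ₂ hF h54 => ?_)
      fun σ₂ hF => ?_
    · have h := h.framed hF (by decide +kernel)
      refine Emits.forLoop h.r24 (by decide +kernel) fun x hx σ₂ hF h53 => ?_
      have h54 := (hF.1 54 (by decide +kernel)).trans h54
      have h := h.framed hF (by decide +kernel)
      exact emits_link (h.addrY h.r50 h.r60 h54 h53 ⟨h.le_m, Nat.zero_le _, hb, hx⟩)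
        rfl h.r61 (by decide) le_rfl
    · have h := h.framed hF (by decide +kernel)
      exact Emits.forLoop h.r65 (by decide +kernel) fun s hlt σ₂ hF h51 =>
        emits_buildS hs (h.framed hF (by decide +kernel)) h51 hlt
  · simp only [cost, Tab.P]
    have h1 : t.N ≤ t.N ^ 3 := Nat.le_self_pow (by norm_num) _
    have h2 : t.N ^ 3 ≤ (t.n + 1) * ((t.α + 1) * t.N ^ 3) :=
      (Nat.le_mul_of_pos_left _ (Nat.succ_pos t.α)).trans (Nat.le_mul_of_pos_left _ (Nat.succ_pos
          _))
    have h3 : t.N * ((t.n + 1) * ((t.α + 1) * t.N ^ 2)) = (t.n + 1) * ((t.α + 1) * t.N ^ 3) := by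
      ring
    norm_num
    nlinarith

/-- The program builds the graph of an arena. -/
theorem emits_build (hs : ∀ x < t.N, ∀ a < t.α, t.succ x a ≤ t.N) (hN : 1 ≤ t.N) (h : Base t σ) :
    Emits t.D build σ (4610 * ((t.m + 1) * ((t.n + 1) * ((t.α + 1) * t.N ^ 3)))) t.edges := by
  refine (Emits.forLoop h.r68 (by decide +kernel) fun j hj σ₂ hF h50 =>
    emits_buildJ hs hN (h.framed hF (by decide +kernel)) h50 (Nat.le_of_lt_succ hj)).mono ?_
  have h1 : 1 ≤ t.N ^ 3 := Nat.one_le_pow _ _ hN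
  have h2 : 1 ≤ (t.n + 1) * ((t.α + 1) * t.N ^ 3) :=
    Nat.mul_pos (Nat.succ_pos _) (Nat.mul_pos (Nat.succ_pos _) h1)
  nlinarith [Nat.mul_le_mul_left (t.m + 1) h2]

end RTC

/-! ### Evaluation of the formulas and the tables of the arena. -/

namespace RTC

open Prog

/-! ### Evaluation of formulas -/

/-- The array `M` holds the list from the position `p` on. -/
def Reads (M : ℕ → ℕ) : ℕ → List ℕ → Prop
  | _, [] => True
  | p, a :: l => M p = a ∧ Reads M (p + 1) l

theorem reads_append {M : ℕ → ℕ} {p : ℕ} {l l' : List ℕ} :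
    Reads M p (l ++ l') ↔ Reads M p l ∧ Reads M (p + l.length) l' := by
  induction l generalizing p with
  | nil => simp [Reads]
  | cons a l ih =>
    simp only [List.cons_append, Reads, ih, List.length_cons, and_assoc]
    rw [Nat.add_assoc, Nat.add_comm 1]

theorem reads_getD (l l' : List ℕ) : Reads (fun i => (l ++ l').getD i 0) l.length l' := by
  induction l' generalizing l with
  | nil => trivial
  | cons a l' ih =>
    refine ⟨by simp [List.getD_eq_getElem?_getD], ?_⟩
    have := ih (l ++ [a])
    simpa using this

/-- The value of a Boolean combination as a number. -/
def BoolComb.num {k : ℕ} (bits : ℕ → ℕ) : BoolComb k → ℕ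
  | var f => bits f
  | neg b => 1 - b.num bits
  -- Subtracting from one twice clips the sum of two digits at one.
  | or b c => 1 - (1 - (b.num bits + c.num bits))

theorem BoolComb.num_ne_zero_iff {k : ℕ} {bits : ℕ → ℕ} {v : Fin k → Prop}
    (h : ∀ f : Fin k, bits f ≤ 1 ∧ (bits f ≠ 0 ↔ v f)) (b : BoolComb k) :
    b.num bits ≤ 1 ∧ (b.num bits ≠ 0 ↔ b.eval v) := by
  induction b with
  | var f => exact h f
  | neg b ih =>
    refine ⟨Nat.sub_le _ _, ?_⟩
    simp only [num, eval, ← ih.2]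
    omega
  | or b c ihb ihc =>
    refine ⟨Nat.sub_le _ _, ?_⟩
    simp only [num, eval, ← ihb.2, ← ihc.2]
    omega

/-- Process a token. -/
def evalTok : Prog :=
  .seq (.seq (.sub 74 73 61) (.ite 74 (.seq (.sub 75 73 62) (.ite 75
      (.block [.sub 76 73 63, .add 76 71 76, .load 77 12 76, .store 15 72 77, .add 72 72 61])
      (.block [.sub 76 72 61, .load 77 15 76, .sub 76 76 61, .load 78 15 76, .add 77 77 78,
        .sub 77 61 77, .sub 77 61 77, .store 15 76 77, .sub 72 72 61])))
    (.block [.sub 76 72 61, .load 77 15 76, .sub 77 61 77, .store 15 76 77])))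
  (.seq (.add 70 70 61) (.load 73 4 70))

/-- `σ'` arises from `σ` by pushing a value onto the stack, with `n` tokens consumed. -/
structure Pushed (val n : ℕ) (σ σ' : Store) : Prop where
  framed : Framed evalTok σ σ'
  ptr : σ'.reg 70 = σ.reg 70 + n
  tok : σ'.reg 73 = σ'.mem 4 (σ'.reg 70)
  height : σ'.reg 72 = σ.reg 72 + 1
  top : σ'.mem 15 (σ.reg 72) = val
  below : ∀ p < σ.reg 72, σ'.mem 15 p = σ.mem 15 p

/-- The registers hold constants. -/
def Consts (σ : Store) : Prop := σ.reg 61 = 1 ∧ σ.reg 62 = 2 ∧ σ.reg 63 = 3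

theorem Consts.framed {σ σ' : Store} (h : Consts σ) (hF : Framed evalTok σ σ') : Consts σ' :=
  ⟨(hF.1 61 rfl).trans h.1, (hF.1 62 rfl).trans h.2.1, (hF.1 63 rfl).trans h.2.2⟩

theorem run_evalTok {σ : Store} (h73 : σ.reg 73 ≠ 0) :
    ∃ t ≤ 16, ∀ t' σ', Run (.loop 73 evalTok) (evalTok.exec σ) t' σ' →
      Run (.loop 73 evalTok) σ (t + t') σ' := by
  obtain ⟨t, ht, hr⟩ := Run.exec (p := evalTok) rfl σ
  refine ⟨t + 1, Nat.succ_le_succ (ht.trans (by decide)), fun t' σ' h => ?_⟩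
  have := Run.loop_pos h73 hr h
  rwa [show t + 1 + t' = t + t' + 1 by omega]

/-- The machine loop runs until a `0` token, whereas a subformula takes up only some of its rounds.
The claim is therefore stated with a continuation: every run from the store after the subformula
extends to a run from the store before it. Each token costs at most 16 steps. -/
theorem run_evalLoop {k : ℕ} {bits : ℕ → ℕ} (b : BoolComb k) (σ : Store) (hc : Consts σ)
    (hr : Reads (σ.mem 4) (σ.reg 70) b.code) (h73 : σ.reg 73 = σ.mem 4 (σ.reg 70))
    (hb : ∀ f < k, σ.mem 12 (σ.reg 71 + f) = bits f) :
    ∃ t ≤ 16 * b.size, ∃ σ', Pushed (b.num bits) b.code.length σ σ' ∧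
      ∀ t' σ'', Run (.loop 73 evalTok) σ' t' σ'' → Run (.loop 73 evalTok) σ (t + t') σ'' := by
  induction b generalizing σ with
  | var f =>
    obtain ⟨c1, c2, c3⟩ := hc
    have hv := hb f f.2
    rw [hr.1] at h73
    obtain ⟨t, ht, hrun⟩ := run_evalTok (σ := σ) (by omega)
    refine ⟨t, ht, evalTok.exec σ, ⟨Framed.exec rfl σ, ?_, ?_, ?_, ?_, ?_⟩, hrun⟩
    · simp [evalTok, block, Prog.exec, c1, c2, c3, h73, BoolComb.code]
    · simp [evalTok, block, Prog.exec, c1, c2, c3, h73]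
    · simp [evalTok, block, Prog.exec, c1, c2, c3, h73]
    · simp [evalTok, block, Prog.exec, c1, c2, c3, h73, BoolComb.num, hv]
    · intro p hp
      have : p ≠ σ.reg 72 := hp.ne
      simp [evalTok, block, Prog.exec, c1, c2, c3, h73, this]
  | neg b ih =>
    obtain ⟨hr1, hr2⟩ := reads_append.1 hr
    obtain ⟨t, ht, σ₁, hP, hrun⟩ := ih σ hc hr1 h73 hb
    obtain ⟨c1, c2, c3⟩ := hc.framed hP.framed
    have e4 : σ₁.mem 4 = σ.mem 4 := hP.framed.2 4 rfl
    have h73' : σ₁.reg 73 = 1 := by rw [hP.tok, hP.ptr, e4]; exact hr2.1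
    obtain ⟨t₁, ht₁, hrun₁⟩ := run_evalTok (σ := σ₁) (by omega)
    refine ⟨t + t₁, by simp only [BoolComb.size]; omega, evalTok.exec σ₁,
      ⟨hP.framed.trans (Framed.exec rfl σ₁), ?_, ?_, ?_, ?_, ?_⟩, fun t' σ'' h => ?_⟩
    · simp [evalTok, block, Prog.exec, c1, h73', hP.ptr, BoolComb.code, Nat.add_assoc]
    · simp [evalTok, block, Prog.exec, c1, h73']
    · simp [evalTok, block, Prog.exec, c1, h73', hP.height]
    · simp [evalTok, block, Prog.exec, c1, h73', hP.height, hP.top, BoolComb.num]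
    · intro p hp
      have : p ≠ σ.reg 72 := hp.ne
      simp [evalTok, block, Prog.exec, c1, h73', hP.height, this, hP.below p hp]
    · rw [Nat.add_assoc]
      exact hrun _ _ (hrun₁ _ _ h)
  | or b c ihb ihc =>
    obtain ⟨hr12, hr3⟩ := reads_append.1 hr
    obtain ⟨hr1, hr2⟩ := reads_append.1 hr12
    obtain ⟨t, ht, σ₁, hP, hrun⟩ := ihb σ hc hr1 h73 hb
    have hc₁ := hc.framed hP.framed
    have e4 : σ₁.mem 4 = σ.mem 4 := hP.framed.2 4 rfl
    obtain ⟨t₁, ht₁, σ₂, hP₁, hrun₁⟩ := ihc σ₁ hc₁ (by rw [hP.ptr, e4]; exact hr2) hP.tok (by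
      rw [hP.framed.1 71 rfl, hP.framed.2 12 rfl]; exact hb)
    obtain ⟨c1, c2, c3⟩ := hc₁.framed hP₁.framed
    have e4' : σ₂.mem 4 = σ.mem 4 := (hP₁.framed.2 4 rfl).trans e4
    have h73' : σ₂.reg 73 = 2 := by
      rw [hP₁.tok, hP₁.ptr, hP.ptr, e4', Nat.add_assoc, ← List.length_append]; exact hr3.1
    obtain ⟨t₂, ht₂, hrun₂⟩ := run_evalTok (σ := σ₂) (by omega)
    have htop : σ₂.mem 15 (σ.reg 72) = b.num bits := by
      rw [hP₁.below _ (by rw [hP.height]; omega), hP.top]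
    have htop' : σ₂.mem 15 (σ.reg 72 + 1) = c.num bits := by
      rw [← hP.height]; exact hP₁.top
    have hh : σ₂.reg 72 = σ.reg 72 + 2 := by rw [hP₁.height, hP.height]
    refine ⟨t + (t₁ + t₂), by simp only [BoolComb.size]; omega, evalTok.exec σ₂,
      ⟨(hP.framed.trans hP₁.framed).trans (Framed.exec rfl σ₂), ?_, ?_, ?_, ?_, ?_⟩,
      fun t' σ'' h => ?_⟩
    · simp [evalTok, block, Prog.exec, c1, c2, h73', hP.ptr, hP₁.ptr, BoolComb.code, Nat.add_assoc]
    · simp [evalTok, block, Prog.exec, c1, c2, h73']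
    · simp [evalTok, block, Prog.exec, c1, c2, h73', hh]
    · simp [evalTok, block, Prog.exec, c1, c2, h73', hh, htop, htop', BoolComb.num,
        Nat.add_comm (c.num bits)]
    · intro p hp
      have : p ≠ σ.reg 72 := hp.ne
      simp [evalTok, block, Prog.exec, c1, c2, h73', hh, this]
      rw [hP₁.below p (by rw [hP.height]; omega), hP.below p hp]
    · rw [Nat.add_assoc, Nat.add_assoc]
      exact hrun _ _ (hrun₁ _ _ (hrun₂ _ _ h))

/-! ### The tables of an instance -/

namespace RTCInstance

variable {I : RTCInstance}

/-- The formulas of the goal. -/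
def formulas (I : RTCInstance) : List (BoolComb I.k) :=
  [I.rho] ++ List.ofFn I.assume ++ List.ofFn I.guar

open Classical in
/-- The tables for a list of configurations. -/
noncomputable def tab (I : RTCInstance) (cs : List I.BConf) : Tab where
  α := I.α
  n := I.n
  m := I.m
  N := cs.length
  succ x a := if h : x < cs.length ∧ a < I.α then succIdx cs cs[x] ⟨a, h.2⟩ else 0
  ctl := I.input.mem 1
  loud x := if ∃ (h : x < cs.length) (a : Fin I.α), a ∉ I.ctrl ∧ succIdx cs cs[x] a ≠ 0
    then 1 else 0
  val r x := if h : x < cs.length then (I.formulas[r]?).elim 0 (BoolComb.num cs[x].bit) else 0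

end RTCInstance

/-- Set up constants. -/
def setConsts : Prog :=
  .block [.const 60 0, .const 61 1, .const 62 2, .const 63 3, .const 64 4, .add 65 24 24,
    .add 66 65 61, .add 67 3 61, .add 68 4 61, .add 69 68 3, .add 43 69 65, .add 43 43 64]

/-- Tables of the multiples of the first `k` powers of the number in register `43`. -/
def powers : ℕ → Prog
  | 0 => .const 44 1
  | k + 1 => .seq (powers k) (.seq (.seq (.const 41 0) (.forLoop 42 43
      (.seq (.store (30 + k) 42 41) (.add 41 41 44)))) (.add 44 41 60))

/-- Tables of multiples. -/
def setRows : Prog :=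
  .seq (.seq (.const 41 0) (.const 40 0)) (.forLoop 42 24
    (.block [.store 18 42 41, .add 41 41 1, .store 19 42 40, .add 40 40 2]))

/-- Find the configurations where uncontrollable actions are enabled. -/
def setLoud : Prog :=
  .forLoop 53 24 (.seq (.const 41 0) (.seq (.forLoop 56 1 (.seq buildStep
    (.ite 77 (.const 79 0) (.ite 78 (.const 41 1) (.const 79 0))))) (.store 17 53 41)))

/-- Evaluate the formulas. -/
def setVals : Prog :=
  .forLoop 53 24 (.seq (.seq (.const 70 0) (.load 71 19 53)) (.forLoop 57 69
    (.seq (.seq (.const 72 0) (.load 73 4 70)) (.seq (.loop 73 evalTok)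
      (.block [.add 70 70 61, .const 72 0, .load 74 15 72, .load 75 31 57, .add 75 75 53,
        .store 16 75 74])))))

/-- The program grows with `k`, so for variable `k` its frame is not found by evaluation and needs
an induction. -/
theorem powers_keeps (k : ℕ) : (∀ y, y ∉ [6, 7, 41, 42, 44] → (powers k).modR y = false) ∧
    ∀ b, b < 30 ∨ 30 + k ≤ b → (powers k).modM b = false := by
  induction k with
  | zero =>
    refine ⟨fun y hy => ?_, fun _ _ => rfl⟩
    simp only [List.mem_cons, List.not_mem_nil, or_false, not_or] at hy
    simp [powers, modR, Ne.symm hy.2.2.2.2]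
  | succ k ih =>
    constructor
    · intro y hy
      have := ih.1 y hy
      simp only [List.mem_cons, List.not_mem_nil, or_false, not_or] at hy
      simp [powers, modR, Prog.forLoop, this, Ne.symm hy.1, Ne.symm hy.2.1, Ne.symm hy.2.2.1,
          Ne.symm hy.2.2.2.1,
        Ne.symm hy.2.2.2.2]
    · intro b hb
      have := ih.2 b (by omega)
      have hne : 30 + k ≠ b := by omega
      simp [powers, modM, Prog.forLoop, this, hne]

/-- After filling the table of the multiples of `D ^ k` by repeated addition, the accumulator holds
`D * D ^ k`, the next power. -/
theorem tri_powers {σ : Store} {D : ℕ} (h43 : σ.reg 43 = D) (h60 : σ.reg 60 = 0) (k : ℕ) :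
    Tri (powers k) σ (k * (D * 6 + 5) + 1) fun σ' =>
      σ'.reg 44 = D ^ k ∧ ∀ i < k, ∀ d < D, σ'.mem (30 + i) d = d * D ^ i := by
  induction k with
  | zero => exact Tri.exec rfl (by simp [powers, cost]) (by simp [powers, Prog.exec])
  | succ k ih =>
    refine (Tri.seq (T₂ := D * 6 + 5) (ih.mono le_rfl fun σ₁ hF hQ => ?_)).mono
      (by rw [Nat.succ_mul]; omega) fun _ _ h => h
    obtain ⟨q1, q2⟩ := hQ
    have f43 := (hF.1 43 ((powers_keeps k).1 43 (by decide))).trans h43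
    have f60 := (hF.1 60 ((powers_keeps k).1 60 (by decide))).trans h60
    refine Tri.seq (T₁ := D * 6 + 4) (T₂ := 1) (Tri.seq_exec (T₂ := D * (2 + 4) + 3) rfl
      ((Tri.forLoop_framed (T := 2) (fun i σ' => σ'.reg 41 = i * D ^ k ∧ (∀ d < i,
          σ'.mem (30 + k) d =
        d * D ^ k)) (by simpa [Prog.exec] using f43) ⟨rfl, rfl, by decide⟩
        (by simp [Prog.exec]) ?_).mono le_rfl fun σ₂ hF₂ hQ₂ => ?_) (by simp only [cost]; omega))
    · rintro i σ' hi ⟨i1, i2⟩ hr hF'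
      have g44 : σ'.reg 44 = D ^ k := (hF'.1 44 rfl).trans (by simpa [Prog.exec] using q1)
      refine Tri.exec rfl le_rfl ⟨by simp [Prog.exec, i1, g44, Nat.succ_mul], fun d hd => ?_⟩
      simp only [Prog.exec, Store.mem_setReg, Store.mem_setMem, hr, i1, if_true, Store.reg_setMem]
      rcases Nat.lt_succ_iff_lt_or_eq.1 hd with hd | rfl
      · rw [Function.update_of_ne hd.ne, i2 d hd]
      · rw [Function.update_self]
    · obtain ⟨r1, r2⟩ := hQ₂
      have g60 : σ₂.reg 60 = 0 := (hF₂.1 60 rfl).trans (by simpa [Prog.exec] using f60)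
      refine Tri.exec rfl le_rfl ⟨by simp [Prog.exec, r1, g60, pow_succ, Nat.mul_comm],
        fun i hi d hd => ?_⟩
      rcases Nat.lt_succ_iff_lt_or_eq.1 hi with hi | rfl
      · have : (Prog.forLoop 42 43 (.seq (.store (30 + k) 42 41) (.add 41 41 44))).modM (30 + i) =
            false := by
          have : k ≠ i := by omega
          simp [Prog.forLoop, modM, this]
        have e := hF₂.2 _ this
        have := q2 i hi d hd
        simp only [Prog.exec, Store.mem_setReg] at e ⊢
        rw [e, this]
      · simpa [Prog.exec] using r2 d hd

namespace RTCInstance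

variable {I : RTCInstance} {cs : List I.BConf} {σ : Store}

/-- The configurations have been enumerated and the constants are set. -/
structure Ready (I : RTCInstance) (cs : List I.BConf) (σ : Store) : Prop where
  input : I.InputOn σ
  bits : ∀ x (h : x < cs.length), ∀ f < I.k, σ.mem 12 (x * I.k + f) = (cs[x]).bit f
  succ : ∀ x < cs.length, ∀ a < I.α, σ.mem 14 (x * I.α + a) = (I.tab cs).succ x a
  r24 : σ.reg 24 = cs.length
  r43 : σ.reg 43 = (I.tab cs).D
  r60 : σ.reg 60 = 0
  r61 : σ.reg 61 = 1
  r62 : σ.reg 62 = 2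
  r63 : σ.reg 63 = 3
  r64 : σ.reg 64 = 4
  r65 : σ.reg 65 = (I.tab cs).P
  r66 : σ.reg 66 = (I.tab cs).P + 1
  r67 : σ.reg 67 = I.n + 1
  r68 : σ.reg 68 = I.m + 1
  r69 : σ.reg 69 = I.n + I.m + 1

theorem Ready.framed {σ' : Store} {p : Prog} (h : I.Ready cs σ) (hF : Framed p σ σ')
    (hk : p.keeps [0, 1, 2, 3, 4, 5, 24, 43, 60, 61, 62, 63, 64, 65, 66, 67, 68, 69]
      [0, 1, 2, 3, 4, 12, 14] = true) : I.Ready cs σ' where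
  input := ⟨fun r hr => (hF.reg_eq hk (by interval_cases r <;> decide)).trans (h.input.1 r hr),
    fun b hb => (hF.mem_eq hk (by interval_cases b <;> decide)).trans (h.input.2 b hb)⟩
  bits := by rw [hF.mem_eq hk (b := 12) (by decide)]; exact h.bits
  succ := by rw [hF.mem_eq hk (b := 14) (by decide)]; exact h.succ
  r24 := (hF.reg_eq hk (by decide)).trans h.r24
  r43 := (hF.reg_eq hk (by decide)).trans h.r43
  r60 := (hF.reg_eq hk (by decide)).trans h.r60
  r61 := (hF.reg_eq hk (by decide)).trans h.r61
  r62 := (hF.reg_eq hk (by decide)).trans h.r62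
  r63 := (hF.reg_eq hk (by decide)).trans h.r63
  r64 := (hF.reg_eq hk (by decide)).trans h.r64
  r65 := (hF.reg_eq hk (by decide)).trans h.r65
  r66 := (hF.reg_eq hk (by decide)).trans h.r66
  r67 := (hF.reg_eq hk (by decide)).trans h.r67
  r68 := (hF.reg_eq hk (by decide)).trans h.r68
  r69 := (hF.reg_eq hk (by decide)).trans h.r69

theorem tab_succ {x a : ℕ} (hx : x < cs.length) (ha : a < I.α) :
    (I.tab cs).succ x a = succIdx cs cs[x] ⟨a, ha⟩ := dif_pos ⟨hx, ha⟩

theorem ready_setConsts (h : Enumerating I cs cs.length (cs.length * I.α) σ) :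
    I.Ready cs (setConsts.exec σ) := by
  have e24 := h.conf.nc_eq
  have e3 : σ.reg 3 = I.n := h.input.1 3 (by norm_num)
  have e4 : σ.reg 4 = I.m := h.input.1 4 (by norm_num)
  have hP : (I.tab cs).P = cs.length + cs.length := two_mul _
  have hD : (I.tab cs).D = I.n + I.m + 2 * cs.length + 5 := rfl
  have hF := Framed.exec (p := setConsts) rfl σ
  constructor
  · exact ⟨fun r hr => (hF.1 r (by interval_cases r <;> rfl)).trans (h.input.1 r hr),
      fun b hb => (hF.2 b (by interval_cases b <;> rfl)).trans (h.input.2 b hb)⟩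
  · rw [hF.2 12 rfl]; exact h.conf.cv_eq
  · rw [hF.2 14 rfl]
    intro x hx a ha
    have hlt : x * I.α + a < cs.length * I.α :=
      lt_of_lt_of_le (Nat.add_lt_add_left ha _)
        (by rw [← Nat.succ_mul]; exact Nat.mul_le_mul_right _ hx)
    rw [(h.succ x hx ⟨a, ha⟩ hlt).1, tab_succ hx ha]
  all_goals simp [setConsts, block, Prog.exec, e24, e3, e4, hP, hD]
  all_goals omega

theorem tri_setRows (h : I.Ready cs σ) :
    Tri setRows σ (cs.length * 8 + 5) fun σ' =>
      (∀ x < cs.length, σ'.mem 18 x = x * I.α) ∧ ∀ x < cs.length, σ'.mem 19 x = x * I.k := by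
  have h1 : σ.reg 1 = I.α := h.input.1 1 (by norm_num)
  have h2 : σ.reg 2 = I.k := h.input.1 2 (by norm_num)
  have h24 := h.r24
  refine Tri.seq_exec (T₂ := cs.length * (4 + 4) + 3) rfl ?_ (by simp only [cost]; omega)
  refine (Tri.forLoop_framed (T := 4) (fun i σ' => σ'.reg 41 = i * I.α ∧ σ'.reg 40 = i * I.k ∧
    (∀ x < i, σ'.mem 18 x = x * I.α) ∧ ∀ x < i, σ'.mem 19 x = x * I.k)
    (by simpa [Prog.exec] using h24) (by decide)
    (by simp [Prog.exec]) ?_).mono le_rfl fun σ' _ h => h.2.2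
  rintro i σ' hi ⟨i1, i2, i3, i4⟩ hr hF
  have g1 : σ'.reg 1 = I.α := (hF.1 1 rfl).trans (by simpa [Prog.exec] using h1)
  have g2 : σ'.reg 2 = I.k := (hF.1 2 rfl).trans (by simpa [Prog.exec] using h2)
  have upd : ∀ {M : ℕ → ℕ} {c : ℕ}, (∀ x < i, M x = x * c) →
      ∀ x < i + 1, Function.update M i (i * c) x = x * c := by
    intro M c hM x hx
    rcases Nat.lt_succ_iff_lt_or_eq.1 hx with hx | rfl
    · rw [Function.update_of_ne hx.ne, hM x hx]
    · rw [Function.update_self]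
  refine Tri.exec rfl le_rfl ⟨by simp [block, Prog.exec, i1, g1, Nat.succ_mul],
    by simp [block, Prog.exec, i2, g2, Nat.succ_mul], ?_, ?_⟩
  · simpa [block, Prog.exec, hr, i1] using upd i3
  · simpa [block, Prog.exec, hr, i2] using upd i4

theorem input_mem_one_ne_zero {a : Fin I.α} : I.input.mem 1 a ≠ 0 ↔ a ∈ I.ctrl := by
  classical
  have : I.input.mem 1 = fun i =>
    (List.ofFn fun a : Fin I.α => if a ∈ I.ctrl then 1 else 0).getD i 0 := by
    unfold input
    simp only
  rw [this]
  simp [List.getD_eq_getElem?_getD]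

theorem tri_setLoud (h : I.Ready cs σ) (hrow : ∀ x < cs.length, σ.mem 18 x = x * I.α) :
    Tri setLoud σ (cs.length * (I.α * 11 + 9) + 3) fun σ' =>
      ∀ x < cs.length, σ'.mem 17 x = (I.tab cs).loud x := by
  refine (Tri.forLoop_framed (T := I.α * 11 + 5) (fun i σ' => ∀ x < i, σ'.mem 17 x =
    (I.tab cs).loud x) h.r24 (by decide) (by simp) ?_).mono le_rfl fun _ _ h => h
  intro x σ₁ hx hI hr hF
  have h := h.framed hF (by decide +kernel)
  have h1 : σ₁.reg 1 = I.α := h.input.1 1 (by norm_num)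
  have hrow' : σ₁.mem 18 x = x * I.α := by rw [hF.2 18 (by decide +kernel)]; exact hrow x hx
  refine Tri.seq_exec (T₂ := I.α * (7 + 4) + 3 + 1) rfl (Tri.seq ((Tri.forLoop_framed (T := 7)
    (fun i σ' => σ'.reg 41 = if ∃ a < i, I.input.mem 1 a = 0 ∧ (I.tab cs).succ x a ≠ 0 then 1 else
        0)
    (by simpa [Prog.exec] using h1) (by decide +kernel) (by simp [Prog.exec]) ?_).mono le_rfl
    fun σ₂ hF₂ hQ₂ => ?_)) (by simp only [cost]; omega)
  · intro a σ₂ ha hI₂ hr₂ hF₂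
    have e53 : σ₂.reg 53 = x := (hF₂.1 53 (by decide +kernel)).trans (by simpa [Prog.exec] using hr)
    have e1 : σ₂.mem 1 = I.input.mem 1 :=
      (hF₂.2 1 (by decide +kernel)).trans (by simpa [Prog.exec] using h.input.2 1 (by norm_num))
    have e18 : σ₂.mem 18 x = x * I.α := by
      rw [hF₂.2 18 (by decide +kernel)]; simpa [Prog.exec] using hrow'
    have e14 : σ₂.mem 14 (x * I.α + a) = (I.tab cs).succ x a := by
      rw [hF₂.2 14 (by decide +kernel)]; simpa [Prog.exec] using h.succ x hx a ha
    refine Tri.exec rfl (by decide) ?_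
    by_cases hc : I.input.mem 1 a = 0
    · by_cases hs : (I.tab cs).succ x a = 0
      · have : (∃ a' < a + 1, I.input.mem 1 a' = 0 ∧ (I.tab cs).succ x a' ≠ 0) ↔
            ∃ a' < a, I.input.mem 1 a' = 0 ∧ (I.tab cs).succ x a' ≠ 0 := by
          constructor
          · rintro ⟨a', h1, h2, h3⟩
            rcases Nat.lt_succ_iff_lt_or_eq.1 h1 with h1 | rfl
            · exact ⟨a', h1, h2, h3⟩
            · exact absurd hs h3
          · rintro ⟨a', h1, h2⟩
            exact ⟨a', by omega, h2⟩
        simp only [this]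
        simp [buildStep, block, Prog.exec, e53, e1, e18, e14, hr₂, hc, hs, hI₂]
      · have : ∃ a' < a + 1, I.input.mem 1 a' = 0 ∧ (I.tab cs).succ x a' ≠ 0 :=
          ⟨a, by omega, hc, hs⟩
        rw [if_pos this]
        simp [buildStep, block, Prog.exec, e53, e1, e18, e14, hr₂, hc, hs]
    · have : (∃ a' < a + 1, I.input.mem 1 a' = 0 ∧ (I.tab cs).succ x a' ≠ 0) ↔
          ∃ a' < a, I.input.mem 1 a' = 0 ∧ (I.tab cs).succ x a' ≠ 0 := by
        constructor
        · rintro ⟨a', h1, h2, h3⟩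
          rcases Nat.lt_succ_iff_lt_or_eq.1 h1 with h1 | rfl
          · exact ⟨a', h1, h2, h3⟩
          · exact absurd h2 hc
        · rintro ⟨a', h1, h2⟩
          exact ⟨a', by omega, h2⟩
      simp only [this]
      simp [buildStep, block, Prog.exec, e1, hr₂, hc, hI₂]
  · have e53 : σ₂.reg 53 = x := (hF₂.1 53 (by decide +kernel)).trans (by simpa [Prog.exec] using hr)
    have e17 : σ₂.mem 17 = σ₁.mem 17 :=
      (hF₂.2 17 (by decide +kernel)).trans (by simp [Prog.exec])
    have hloud : σ₂.reg 41 = (I.tab cs).loud x := by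
      rw [hQ₂]
      simp only [tab]
      congr 1
      simp only [eq_iff_iff]
      constructor
      · rintro ⟨a, ha, h1, h2⟩
        rw [dif_pos ⟨hx, ha⟩] at h2
        refine ⟨hx, ⟨a, ha⟩, fun hc => input_mem_one_ne_zero.2 hc h1, h2⟩
      · rintro ⟨_, a, h1, h2⟩
        refine ⟨a, a.2, ?_, by rw [dif_pos ⟨hx, a.2⟩]; exact h2⟩
        by_contra hcon
        exact h1 (input_mem_one_ne_zero.1 hcon)
    refine Tri.exec rfl le_rfl ?_
    intro x' hx'
    simp only [Prog.exec, Store.mem_setReg, Store.mem_setMem, if_true, e53, e17, hloud]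
    rcases Nat.lt_succ_iff_lt_or_eq.1 hx' with hx' | rfl
    · rw [Function.update_of_ne hx'.ne, hI x' hx']
    · rw [Function.update_self]

theorem reads_input (I : RTCInstance) :
    Reads (I.input.mem 4) 0 (I.formulas.flatMap fun b : BoolComb I.k => b.code ++ [0]) := by
  have : I.input.mem 4 = fun i => ([] ++ I.formulas.flatMap fun b : BoolComb I.k => b.code ++
      [0]).getD i 0 := rfl
  rw [this]
  exact reads_getD [] _

theorem length_formulas (I : RTCInstance) : I.formulas.length = I.n + I.m + 1 := by
  simp [formulas]

theorem size_le_of_mem_formulas {L : ℕ} (hL : I.SizeLe L) {b : BoolComb I.k}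
    (hb : b ∈ I.formulas) : b.size ≤ L := by
  simp only [formulas, List.mem_append, List.mem_singleton, List.mem_ofFn] at hb
  obtain (rfl | ⟨i, rfl⟩) | ⟨i, rfl⟩ := hb
  · exact hL.1
  · exact hL.2.1 i
  · exact hL.2.2 i

theorem tri_setVals {L : ℕ} (hL : I.SizeLe L) (h : I.Ready cs σ)
    (hrow : ∀ x < cs.length, σ.mem 19 x = x * I.k)
    (hpow : ∀ d < (I.tab cs).D, σ.mem 31 d = d * (I.tab cs).D) :
    Tri setVals σ (cs.length * ((I.n + I.m + 1) * (16 * L + 13) + 9) + 3) fun σ' =>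
      ∀ x < cs.length, ∀ r < I.n + I.m + 1,
        σ'.mem 16 (r * (I.tab cs).D + x) = (I.tab cs).val r x := by
  set D := (I.tab cs).D with hD
  have hDle : I.n + I.m + 1 < D ∧ cs.length < D := by
    rw [hD]; simp only [Tab.D, tab]; omega
  -- The rows of the value table have length `D`, which exceeds the number of configurations, so
  -- they do not overlap.
  have hinj : ∀ {r r' x x' : ℕ}, x < cs.length → x' < cs.length → r * D + x = r' * D + x' →
      x = x' ∧ r = r' := fun hx hx' e => add_mul_inj (D := D) (hx.trans hDle.2) (hx'.trans hDle.2)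
    (by rw [Nat.mul_comm D, Nat.mul_comm D, Nat.add_comm, e, Nat.add_comm])
  refine (Tri.forLoop_framed (T := (I.n + I.m + 1) * (16 * L + 13) + 5) (fun i σ' => ∀ x < i,
    ∀ r < I.n + I.m + 1, σ'.mem 16 (r * D + x) = (I.tab cs).val r x) h.r24 (by decide +kernel)
    (by simp) ?_).mono le_rfl fun _ _ h => h
  intro x σ₁ hx hI hr hF
  have h := h.framed hF (by decide +kernel)
  have hrow' : σ₁.mem 19 x = x * I.k := by rw [hF.2 19 (by decide +kernel)]; exact hrow x hx
  have hpow' : ∀ d < D, σ₁.mem 31 d = d * D := by rw [hF.2 31 (by decide +kernel)]; exact hpow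
  have h4 : σ₁.mem 4 = I.input.mem 4 := h.input.2 4 (by norm_num)
  have hr69 := h.r69
  -- The read pointer is not reset between formulas: before formula `r` it stands at the codes of
  -- the formulas from `r` on, each ended by `0`.
  refine Tri.seq_exec (T₂ := (I.n + I.m + 1) * (16 * L + 13) + 3) rfl ((Tri.forLoop_framed
    (T := 16 * L + 9) (fun r σ' => Reads (I.input.mem 4) (σ'.reg 70)
      ((I.formulas.drop r).flatMap fun b => b.code ++ [0]) ∧
      (∀ x' < x, ∀ r < I.n + I.m + 1, σ'.mem 16 (r * D + x') = (I.tab cs).val r x') ∧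
      ∀ r' < r, σ'.mem 16 (r' * D + x) = (I.tab cs).val r' x)
    (by simpa [Prog.exec] using hr69) (by decide +kernel) ?_ ?_).mono le_rfl fun σ₂ _ hQ => ?_)
    (by simp only [cost]; omega)
  · exact ⟨by simpa [Prog.exec] using I.reads_input, by simpa [Prog.exec] using hI, by simp⟩
  · rintro r σ₂ hlt ⟨i1, i2, i3⟩ hr₂ hF₂
    have hlen : r < I.formulas.length := by rw [length_formulas]; exact hlt
    rw [List.drop_eq_getElem_cons hlen, List.flatMap_cons] at i1
    obtain ⟨j1, j2⟩ := reads_append.1 i1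
    obtain ⟨j0, j1'⟩ := reads_append.1 j1
    set b := I.formulas[r] with hb
    have e4 : σ₂.mem 4 = I.input.mem 4 := (hF₂.2 4 (by decide +kernel)).trans h4
    have e12 : σ₂.mem 12 = σ₁.mem 12 := hF₂.2 12 (by decide +kernel)
    have e71 : σ₂.reg 71 = x * I.k := (hF₂.1 71 (by decide +kernel)).trans
      (by simp [Prog.exec, hr, hrow'])
    have e53 : σ₂.reg 53 = x := (hF₂.1 53 (by decide +kernel)).trans (by simpa [Prog.exec] using hr)
    have e31 : ∀ d < D, σ₂.mem 31 d = d * D := by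
      rw [hF₂.2 31 (by decide +kernel)]; simpa [Prog.exec] using hpow'
    have e61 : σ₂.reg 61 = 1 := (hF₂.1 61 (by decide +kernel)).trans h.r61
    have e62 : σ₂.reg 62 = 2 := (hF₂.1 62 (by decide +kernel)).trans h.r62
    have e63 : σ₂.reg 63 = 3 := (hF₂.1 63 (by decide +kernel)).trans h.r63
    refine Tri.seq_exec (T₂ := 16 * L + 1 + 6) rfl ?_ (by simp only [cost]; omega)
    obtain ⟨t, ht, σ₃, hP, hrun⟩ := run_evalLoop (bits := (cs[x]).bit) b
      (((Prog.const 72 0).seq (.load 73 4 70)).exec σ₂) ⟨by simp [Prog.exec, e61],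
        by simp [Prog.exec, e62], by simp [Prog.exec, e63]⟩ (by simpa [Prog.exec, e4] using j0)
        (by simp [Prog.exec]) (fun f hf => by
          have := h.bits x hx f hf
          simpa [Prog.exec, e71, e12] using this)
    have k70 : σ₃.reg 70 = σ₂.reg 70 + b.code.length := by
      rw [hP.ptr]; simp [Prog.exec]
    have k4 : σ₃.mem 4 = I.input.mem 4 :=
      (hP.framed.2 4 rfl).trans (by simpa [Prog.exec] using e4)
    have k73 : σ₃.reg 73 = 0 := by rw [hP.tok, k4, k70]; exact j1'.1
    have kv : σ₃.mem 15 0 = (I.tab cs).val r x := by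
      have := hP.top
      simp only [Prog.exec, Store.reg_setReg, Store.mem_setReg] at this
      norm_num at this
      rw [this]
      simp only [tab]
      rw [dif_pos hx, List.getElem?_eq_getElem hlen]
      rfl
    have k16 : σ₃.mem 16 = σ₂.mem 16 := (hP.framed.2 16 rfl).trans (by simp [Prog.exec])
    have k53 : σ₃.reg 53 = x := (hP.framed.1 53 rfl).trans (by simpa [Prog.exec] using e53)
    have k57 : σ₃.reg 57 = r := (hP.framed.1 57 rfl).trans (by simpa [Prog.exec] using hr₂)
    have k61 : σ₃.reg 61 = 1 := (hP.framed.1 61 rfl).trans (by simpa [Prog.exec] using e61)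
    have k31 : σ₃.mem 31 r = r * D := by
      rw [hP.framed.2 31 rfl]; simpa [Prog.exec] using e31 r (by omega)
    refine Tri.seq ⟨t + 1, σ₃, hrun _ _ (.loop_zero k73), ?_, Tri.exec rfl le_rfl ⟨?_, ?_, ?_⟩⟩
    · have : b.size ≤ L := size_le_of_mem_formulas hL (List.getElem_mem hlen)
      omega
    · simp only [List.length_append, List.length_singleton] at j2
      simpa [block, Prog.exec, k70, k61, Nat.add_assoc] using j2
    · intro x' hx' r' hr'
      have hne : r' * D + x' ≠ r * D + x := fun e =>
        absurd (hinj (hx'.trans hx) hx e).1 hx'.ne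
      simp [block, Prog.exec, k57, k53, k31, k16, hne, i2 x' hx' r' hr']
    · intro r' hr'
      rcases Nat.lt_succ_iff_lt_or_eq.1 hr' with hr' | rfl
      · have hD0 : D ≠ 0 := by omega
        simp [block, Prog.exec, k57, k53, k31, k16, hr'.ne, hD0, i3 r' hr']
      · simp [block, Prog.exec, k57, k53, k31, kv]
  · obtain ⟨-, q2, q3⟩ := hQ
    intro x' hx'
    rcases Nat.lt_succ_iff_lt_or_eq.1 hx' with hx' | rfl
    · simpa using q2 x' hx'
    · simpa using q3

/-- Compute the tables of the arena. -/
def _root_.RTC.prepare : Prog :=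
  .seq setConsts (.seq (powers 7) (.seq setRows (.seq setLoud setVals)))

theorem tri_prepare {L : ℕ} (hL : I.SizeLe L)
    (h : Enumerating I cs cs.length (cs.length * I.α) σ) :
    Tri prepare σ (7 * ((I.n + I.m + 2 * cs.length + 5) * 6 + 5) + 24 + cs.length * (I.α * 11 + 17)
        +
      cs.length * ((I.n + I.m + 1) * (16 * L + 13) + 9)) (Base (I.tab cs)) := by
  have hR := ready_setConsts h
  refine (Tri.seq_exec (T := 12 + (7 * ((I.tab cs).D * 6 + 5) + 1 + (cs.length * 8 + 5 +
    (cs.length * (I.α * 11 + 9) + 3 + (cs.length * ((I.n + I.m + 1) * (16 * L + 13) + 9) + 3)))))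
    rfl (Tri.seq ((tri_powers hR.r43 hR.r60 7).mono le_rfl fun σ₁ hF₁ hQ₁ => ?_)) le_rfl).mono
    (le_of_eq (by have : (I.tab cs).D = I.n + I.m + 2 * cs.length + 5 := rfl
                  rw [this]; ring)) fun _ _ h => h
  have hR := hR.framed hF₁ (by decide +kernel)
  refine Tri.seq ((tri_setRows hR).mono le_rfl fun σ₂ hF₂ hQ₂ => ?_)
  have hR := hR.framed hF₂ (by decide +kernel)
  refine Tri.seq ((tri_setLoud hR hQ₂.1).mono le_rfl fun σ₃ hF₃ hQ₃ => ?_)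
  have hR := hR.framed hF₃ (by decide +kernel)
  have hpow : ∀ k < 7, ∀ d < (I.tab cs).D, σ₃.mem (30 + k) d = d * (I.tab cs).D ^ k := by
    intro k hk
    rw [hF₃.2 (30 + k) (by interval_cases k <;> decide +kernel),
      hF₂.2 (30 + k) (by interval_cases k <;> decide +kernel)]
    exact hQ₁.2 k hk
  refine (tri_setVals hL hR (by rw [hF₃.2 19 (by decide +kernel)]; exact hQ₂.2)
    (by have := hpow 1 (by norm_num); norm_num at this; exact this)).mono le_rfl
    fun σ₄ hF₄ hQ₄ => ?_
  have hR := hR.framed hF₄ (by decide +kernel)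
  refine ⟨fun k hk => ?_, ?_, hR.succ, ?_, ?_, fun r hr x hx => hQ₄ x hx r hr,
      hR.input.1 1 (by norm_num),
    hR.input.1 3 (by norm_num), hR.input.1 4 (by norm_num), hR.r24, hR.r60, hR.r61, hR.r62, hR.r63,
    hR.r64, hR.r65, hR.r66, hR.r67, hR.r68⟩
  · rw [hF₄.2 (30 + k) (by interval_cases k <;> decide +kernel)]
    exact hpow k hk
  · rw [hF₄.2 18 (by decide +kernel), hF₃.2 18 (by decide +kernel)]
    exact hQ₂.1
  · intro a _
    rw [hR.input.2 1 (by norm_num)]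
    rfl
  · rw [hF₄.2 17 (by decide +kernel)]
    exact hQ₃

end RTCInstance

end RTC

/-! ### Correctness and running time of the decision procedure. -/

namespace RTC

open Prog

/-! ### The decision procedure -/

namespace RTCInstance

variable {I : RTCInstance} {cs : List I.BConf}

theorem step_of_succIdx {x : I.BConf} {a : Fin I.α} (hcl : ∀ y, x.step a = some y → y ∈ cs) {y : ℕ}
    (h : succIdx cs x a = y + 1) : ∃ hy : y < cs.length, x.step a = some cs[y] := by
  unfold succIdx at h
  cases hs : x.step a with
  | none => simp [hs] at h
  | some z =>
    simp only [hs, Option.elim, Nat.add_right_cancel_iff] at h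
    have hz := hcl z hs
    subst h
    exact ⟨List.idxOf_lt_length_of_mem hz, by simp⟩

theorem succIdx_le {x : I.BConf} {a : Fin I.α} (hcl : ∀ y, x.step a = some y → y ∈ cs) :
    succIdx cs x a ≤ cs.length := by
  cases h : succIdx cs x a with
  | zero => exact Nat.zero_le _
  | succ y => exact (step_of_succIdx hcl h).1

/-- The transitions between the numbers of configurations. -/
noncomputable def stepIdx (cs : List I.BConf) (x : Fin cs.length) (a : Fin I.α) :
    Option (Fin cs.length) :=
  if h : succIdx cs cs[x] a ≠ 0 ∧ succIdx cs cs[x] a ≤ cs.length then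
    some ⟨succIdx cs cs[x] a - 1, by omega⟩ else none

theorem stepIdx_eq_some_iff {x y : Fin cs.length} {a : Fin I.α} :
    stepIdx cs x a = some y ↔ succIdx cs cs[x] a = y + 1 := by
  unfold stepIdx
  have := y.2
  split_ifs with h
  · simp only [Option.some.injEq, Fin.ext_iff]
    omega
  · simp only [false_iff]
    intro h'
    exact h ⟨by omega, by omega⟩

/-- The unfolding whose states are the numbers of the reachable configurations. -/
noncomputable def unfolding (cs : List I.BConf)
    (hcl : ∀ (x : Fin cs.length) a y, (cs[x]).step a = some y → y ∈ cs)
    (h0 : cs[0]? = some I.bInit) : I.Unfolding (Fin cs.length) where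
  conf x := ((cs[x]).1, fun f => (cs[x]).2 f = true)
  step := stepIdx cs
  x₀ := ⟨0, (List.getElem?_eq_some_iff.1 h0).1⟩
  conf_init := by
    obtain ⟨h, e⟩ := List.getElem?_eq_some_iff.1 h0
    simp [e, bInit]
  conf_step x a y h := by
    obtain ⟨_, hs⟩ := step_of_succIdx (hcl x a) (stepIdx_eq_some_iff.1 h)
    simp only [BConf.step, Option.map_eq_some_iff] at hs
    obtain ⟨q, hq, hy⟩ := hs
    simp only [Fin.getElem_fin]
    rw [← hy]
    exact ⟨hq, fun f => by simp⟩
  exists_step x a q h := by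
    have hs : ∃ z, (cs[x]).step a = some z := by
      simp only at h
      exact ⟨_, by rw [BConf.step, h, Option.map_some]⟩
    obtain ⟨z, hz⟩ := hs
    refine ⟨⟨cs.idxOf z, List.idxOf_lt_length_of_mem (hcl x a z hz)⟩, stepIdx_eq_some_iff.2 ?_⟩
    unfold succIdx
    rw [Fin.getElem_fin] at hz ⊢
    rw [hz]
    rfl

/-- The computed tables describe the arena of the unfolding by configuration numbers. The list is
closed under successors, so no table entry points outside. -/
theorem rep_unfolding (hcl : ∀ (x : Fin cs.length) a y, (cs[x]).step a = some y → y ∈ cs)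
    (h0 : cs[0]? = some I.bInit) : (I.tab cs).Rep (unfolding cs hcl h0).arena := by
  have hbit : ∀ (x : Fin cs.length) (f : Fin I.k), (cs[x]).bit f ≤ 1 ∧
      ((cs[x]).bit f ≠ 0 ↔ (cs[x]).2 f = true) := by
    intro x f
    refine ⟨BConf.bit_le _ _, ?_⟩
    simp only [BConf.bit, f.2, dif_pos]
    cases (cs[x]).2 f <;> simp
  have hval : ∀ (r : ℕ) (b : BoolComb I.k) (x : Fin cs.length), I.formulas[r]? = some b →
      ((I.tab cs).val r x ≠ 0 ↔ b.eval fun f => (cs[x]).2 f = true) := by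
    intro r b x hr
    have : (I.tab cs).val r x = b.num (cs[x]).bit := by
      simp [tab, hr]
    rw [this]
    exact (b.num_ne_zero_iff (hbit x)).2
  constructor
  · rfl
  · rfl
  · intro x a
    have e : (I.tab cs).succ x a = succIdx cs cs[x] a := tab_succ x.2 a.2
    have hle := succIdx_le (hcl x a)
    have : (unfolding cs hcl h0).arena.step x a = stepIdx cs x a := rfl
    rw [e, this]
    unfold stepIdx
    split_ifs with h
    · simp only [Option.elim]
      omega
    · simp only [Option.elim]
      by_contra hcon
      exact h ⟨hcon, hle⟩
  · intro a
    exact input_mem_one_ne_zero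
  · intro x
    have : (I.tab cs).loud x = 0 ↔ ∀ a : Fin I.α, a ∉ I.ctrl → succIdx cs cs[x] a = 0 := by
      simp only [tab]
      split_ifs with h
      · obtain ⟨_, a, h1, h2⟩ := h
        simp only [false_iff, not_forall]
        exact ⟨a, h1, h2⟩
      · simp only [true_iff]
        intro a ha
        by_contra hcon
        exact h ⟨x.2, a, ha, hcon⟩
    rw [this]
    constructor
    · intro h u y hu hs
      have h1 := h u hu
      have h2 := stepIdx_eq_some_iff.1 hs
      omega
    · intro h u hu
      by_contra hcon
      obtain ⟨y, hy⟩ := Nat.exists_eq_succ_of_ne_zero hcon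
      obtain ⟨hy', -⟩ := step_of_succIdx (hcl x u) hy
      exact h u ⟨y, hy'⟩ hu (stepIdx_eq_some_iff.2 hy)
  · intro x
    exact hval 0 I.rho x rfl
  · intro i hi x
    have hi : i < I.n := hi
    have hr : I.formulas[i + 1]? = some (I.assume ⟨i, hi⟩) := by
      simp [formulas, List.getElem?_append, hi]
    rw [hval _ _ x hr]
    exact ⟨fun h => ⟨hi, h⟩, fun ⟨_, h⟩ => h⟩
  · intro j hj x
    have hj : j < I.m := hj
    have hr : I.formulas[I.n + 1 + j]? = some (I.guar ⟨j, hj⟩) := by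
      rw [show I.n + 1 + j = I.n + j + 1 by omega]
      simp [formulas, hj]
    have e : (I.tab cs).n + 1 + j = I.n + 1 + j := rfl
    rw [e, hval _ _ x hr]
    exact ⟨fun h => ⟨hj, h⟩, fun ⟨_, h⟩ => h⟩

/-- The graph decides the control problem. -/
theorem exists_consistent_iff_controllable (hn : 1 ≤ I.n)
    (hcl : ∀ (x : Fin cs.length) a y, (cs[x]).step a = some y → y ∈ cs)
    (h0 : cs[0]? = some I.bInit) :
    (∃ B, Consistent (I.tab cs).graph B ∧
      B ((Nd.Y 0 (I.tab cs).P 1 0).code (I.tab cs).D)) ↔ I.Controllable := by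
  have hR := rep_unfolding hcl h0
  have key := Tab.exists_consistent_iff_family hR (unfolding cs hcl h0).x₀
  refine key.trans ⟨fun ⟨Y, B, F, h⟩ => Unfolding.controllable_of_family F h, fun h => ?_⟩
  obtain ⟨Y, B, F, h⟩ := Unfolding.exists_family_of_controllable (Un := unfolding cs hcl h0) hn h
  -- The bound from the game, the number of positions, is the bound built into the graph.
  have hcard : Nat.card (Bool × Fin cs.length) = (I.tab cs).P := by
    simp [Tab.P, tab]
  rw [hcard] at F h
  exact ⟨Y, B, F, h⟩

/-- The initial state of any composition is a reachable deadlock. -/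
theorem not_controllable_of_no_action (h : I.α = 0) : ¬ I.Controllable := by
  rintro ⟨Q, _, M, -, -, hdead, -⟩
  obtain ⟨a, -⟩ := hdead _ .init
  have := a.2
  omega

/-- Boolean combinations have no constants, so `ρ` contains a fluent. Hence the factor `α * k`
dominates `α`. -/
theorem pos_k (I : RTCInstance) : 1 ≤ I.k := by
  have : ∀ b : BoolComb I.k, 1 ≤ I.k := by
    intro b
    induction b with
    | var f => exact f.pos
    | neg b ih => exact ih
    | or b c ih _ => exact ih
  exact this I.rho

end RTCInstance

theorem BoolComb.size_pos {k : ℕ} (b : BoolComb k) : 1 ≤ b.size := by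
  cases b <;> simp [size]

/-- Look up the initial node. -/
def answer : Prog :=
  .seq (addr 45 (nodeAddr 61 60 65 60 60 61 60)) (.seq (.load 46 25 45) (.sub 0 61 46))

/-- Decide the control problem. -/
def decideProg : Prog :=
  .ite 1 (.seq enumerate (.seq prepare (.seq build (.seq solve answer)))) (.const 0 0)

/-- The bound for the number of steps. -/
theorem time_le {s α k n m N c L : ℕ} (hα : 1 ≤ α) (hk : 1 ≤ k) (hn : 1 ≤ n) (hm : 1 ≤ m)
    (hL : 1 ≤ L) (hs : s ≤ N) (hc : c ≤ N) (hc1 : 1 ≤ c) :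
    (s * 6 + k * 8 + 20 + N * (α * (k * 15 + 34) + 10)) +
      ((7 * ((n + m + 2 * c + 5) * 6 + 5) + 24 + c * (α * 11 + 17) +
        c * ((n + m + 1) * (16 * L + 13) + 9)) +
      (4610 * ((m + 1) * ((n + 1) * ((α + 1) * c ^ 3))) +
      (30 * (4610 * ((m + 1) * ((n + 1) * ((α + 1) * c ^ 3)))) + 20 + 17))) + 1 ≤
    600000 * (α * k + L) * (n * m * N ^ 3) := by
  have hN : 1 ≤ N := hc1.trans hc
  set A := α * k + L with hA
  set X := n * m * N ^ 3 with hX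
  have a1 : α * k ≤ A := Nat.le_add_right _ _
  have a2 : L ≤ A := Nat.le_add_left _ _
  have a3 : α + 1 ≤ A := Nat.add_le_add (Nat.le_mul_of_pos_right _ hk) hL
  have a4 : k ≤ A := (Nat.le_mul_of_pos_left _ hα).trans a1
  have hnm : 1 ≤ n * m := Nat.mul_pos hn hm
  have hN3 : N ≤ N ^ 3 := Nat.le_self_pow (by norm_num) _
  have x1 : N ≤ X := hN3.trans (Nat.le_mul_of_pos_left _ hnm)
  have x2 : n * m ≤ X := Nat.le_mul_of_pos_right _ (hN.trans hN3)
  have x3 : n ≤ n * m := Nat.le_mul_of_pos_right _ hm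
  have x4 : m ≤ n * m := Nat.le_mul_of_pos_left _ hn
  have x5 : N * (n * m) ≤ X := by
    rw [Nat.mul_comm]; exact Nat.mul_le_mul_left _ hN3
  have hA1 : 1 ≤ A := hL.trans a2
  have hX1 : 1 ≤ X := hN.trans x1
  have ax1 : A ≤ A * X := Nat.le_mul_of_pos_right _ hX1
  have ax2 : X ≤ A * X := Nat.le_mul_of_pos_left _ hA1
  have ax3 : N * A ≤ A * X := by rw [Nat.mul_comm]; exact Nat.mul_le_mul_left _ x1
  have t1 : N * (α * (k * 15 + 34) + 10) ≤ 60 * (A * X) := by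
    have : α * (k * 15 + 34) + 10 ≤ 60 * A := by nlinarith
    calc _ ≤ N * (60 * A) := Nat.mul_le_mul_left _ this
      _ = 60 * (N * A) := by ring
      _ ≤ _ := Nat.mul_le_mul_left _ ax3
  have t2 : c * (α * 11 + 17) ≤ 28 * (A * X) := by
    have : α * 11 + 17 ≤ 28 * A := by omega
    calc _ ≤ N * (28 * A) := Nat.mul_le_mul hc this
      _ = 28 * (N * A) := by ring
      _ ≤ _ := Nat.mul_le_mul_left _ ax3
  have t3 : c * ((n + m + 1) * (16 * L + 13) + 9) ≤ 96 * (A * X) := by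
    have h1 : (n + m + 1) * (16 * L + 13) ≤ (3 * (n * m)) * (29 * A) :=
      Nat.mul_le_mul (by omega) (by omega)
    have h2 : 1 ≤ n * m * A := Nat.mul_pos hnm hA1
    have h3 : (n + m + 1) * (16 * L + 13) + 9 ≤ 96 * (n * m * A) := by nlinarith
    calc _ ≤ N * (96 * (n * m * A)) := Nat.mul_le_mul hc h3
      _ = 96 * (A * (N * (n * m))) := by ring
      _ ≤ _ := Nat.mul_le_mul_left _ (Nat.mul_le_mul_left _ x5)
  have t4 : (m + 1) * ((n + 1) * ((α + 1) * c ^ 3)) ≤ 4 * (A * X) := by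
    -- The dominant term: the size of the graph. The positivity of `n` and `m` absorbs the
    -- additional phase and stage into factors `2`.
    calc _ ≤ (2 * m) * ((2 * n) * (A * N ^ 3)) :=
          Nat.mul_le_mul (by omega) (Nat.mul_le_mul (by omega)
            (Nat.mul_le_mul a3 (Nat.pow_le_pow_left hc 3)))
      _ = 4 * (A * X) := by rw [hX]; ring
  rw [Nat.mul_assoc]
  omega

open RTCInstance in
theorem run_decideProg {I : RTCInstance} {L : ℕ} (hn : 1 ≤ I.n) (hm : 1 ≤ I.m) (hL : I.SizeLe L) :
    Tri decideProg I.input (600000 * (I.α * I.k + L) * (I.n * I.m * I.numStates ^ 3)) fun σ =>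
      (I.Controllable ∧ σ.reg 0 = 1) ∨ (¬ I.Controllable ∧ σ.reg 0 = 0) := by
  have hL1 : 1 ≤ L := I.rho.size_pos.trans hL.1
  have hN : I.init.val < I.numStates := lt_of_lt_of_le I.init.2 (le_max_left _ _)
  -- Without actions, the factor `α * k + L` does not control the `k` steps needed to read the
  -- initial fluent values; the program answers at once instead.
  by_cases hα : I.α = 0
  · refine ⟨2, _, .ite_zero (by simpa [RTCInstance.input] using hα) (.const 0 0), ?_,
      Or.inr ⟨not_controllable_of_no_action hα, by simp⟩⟩
    have : 1 ≤ (I.α * I.k + L) * (I.n * I.m * I.numStates ^ 3) :=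
      Nat.mul_pos (by omega) (Nat.mul_pos (Nat.mul_pos hn hm) (Nat.pow_pos (by omega)))
    rw [Nat.mul_assoc]
    omega
  obtain ⟨t₁, σ₁, hr₁, ht₁, cs, hE⟩ := tri_enumerate I
  have hcl : ∀ (x : Fin cs.length) a y, (cs[x]).step a = some y → y ∈ cs := by
    intro x a y h
    refine (hE.succ x x.2 a ?_).2 y h
    have := Nat.mul_le_mul_right I.α (Nat.succ_le_of_lt x.2)
    rw [Nat.succ_mul] at this
    exact lt_of_lt_of_le (Nat.add_lt_add_left a.2 _) this
  have h0 := hE.conf.init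
  have hc1 : 1 ≤ cs.length := (List.getElem?_eq_some_iff.1 h0).1
  have hs : ∀ x < (I.tab cs).N, ∀ a < (I.tab cs).α, (I.tab cs).succ x a ≤ (I.tab cs).N :=
    fun x hx a ha => (rep_unfolding hcl h0).succ_le hx ha
  have hF₁ : Framed enumerate I.input σ₁ := hr₁.frame
  suffices h : Tri (.seq prepare (.seq build (.seq solve answer))) σ₁ _ fun σ =>
      (I.Controllable ∧ σ.reg 0 = 1) ∨ (¬ I.Controllable ∧ σ.reg 0 = 0) by
    obtain ⟨t₂, σ₂, hr₂, ht₂, hQ⟩ := h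
    refine ⟨_, σ₂, .ite_pos (by simpa [RTCInstance.input] using hα) (.seq hr₁ hr₂), ?_, hQ⟩
    exact (Nat.succ_le_succ (Nat.add_le_add ht₁ ht₂)).trans (time_le (Nat.pos_of_ne_zero hα) I.pos_k
      hn hm hL1 (le_max_left _ _) (length_le_numStates hE.conf.nodup hE.conf.reach) hc1)
  refine Tri.seq ((tri_prepare hL hE).mono le_rfl fun σ₂ hF₂ hB => ?_)
  -- The arrays of the graph have not been touched since the input, where they are zero, so they
  -- represent the graph without edges.
  have hz : ∀ b ∈ [20, 21, 22, 23, 24, 25], ∀ i, σ₂.mem b i = 0 := by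
    intro b hb i
    have k1 : enumerate.keeps [8] [20, 21, 22, 23, 24, 25] = true := by decide +kernel
    have k2 : prepare.keeps [8] [20, 21, 22, 23, 24, 25] = true := by decide +kernel
    rw [hF₂.mem_eq k2 hb, hF₁.mem_eq k1 hb]
    fin_cases hb <;> rfl
  have h8 : σ₂.reg 8 = 0 := by
    rw [hF₂.1 8 (by decide +kernel), hF₁.1 8 (by decide +kernel)]
    rfl
  have hG : GraphOn [] σ₂ := by
    refine ⟨h8, by simp, by simp, by simp, fun p => ⟨[], hz 23 (by decide) p, by simp⟩, fun q => ?_⟩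
    rw [hz 24 (by decide) q]
    rfl
  -- The number of edges is bounded by the time for building them, and so the propagation is bounded
  -- by a multiple of that time.
  obtain ⟨hlen, hbuild⟩ := emits_build hs hc1 hB
  refine Tri.seq ((hbuild [] hG).mono le_rfl fun σ₃ hF₃ hG₃ => ?_)
  have hG₃ : GraphOn (I.tab cs).graph σ₃ := hG₃
  have hB := hB.framed hF₃ (by decide +kernel)
  have h25 : ∀ q, σ₃.mem 25 q = 0 := by
    rw [hF₃.2 25 (by decide +kernel)]
    exact hz 25 (by decide)
  have hglen : (I.tab cs).graph.length = (I.tab cs).edges.length := List.length_map _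
  refine Tri.seq (T₁ := 30 * _ + 20) ((tri_solve hG₃ h25).mono
    (by rw [hglen]; exact Nat.add_le_add_right (Nat.mul_le_mul_left _ hlen) _)
    fun σ₄ hF₄ hQ => ?_)
  have hB := hB.framed hF₄ (by decide +kernel)
  obtain ⟨a1, a2, a3, a4, a5⟩ := addr_spec (d := 45) (by norm_num)
    (l := nodeAddr 61 60 65 60 60 61 60) (by decide) σ₄
  refine Tri.exec rfl (by decide) ?_
  -- The initial node: phase `0`, the top rank, no preceding uncontrollable action, and the initial
  -- configuration, which has number `0`. The answer is one minus its dead mark.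
  set g := (Nd.Y 0 (I.tab cs).P 1 0).code (I.tab cs).D with hg
  have hval : addrVal σ₄ (nodeAddr 61 60 65 60 60 61 60) = g :=
    addrVal_node hB hB.r61 hB.r60 hB.r65 hB.r60 hB.r60 hB.r61 hB.r60 (by norm_num)
      (by simp only [Tab.D, Tab.P]; omega)
  have h61 : ((addr 45 (nodeAddr 61 60 65 60 60 61 60)).exec σ₄).reg 61 = 1 :=
    (a5 61 (by norm_num) (by norm_num)).trans hB.r61
  have hans : (answer.exec σ₄).reg 0 = 1 - σ₄.mem 25 g := by
    simp only [answer, Prog.exec, Store.reg_setReg, a3, hval, a4, h61]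
    norm_num
  obtain ⟨q1, q2⟩ := hQ g
  rw [hans, ← exists_consistent_iff_controllable hn hcl h0, ← q1]
  omega

end RTC

theorem mainTheorem4 :
    ∃ (p : RTC.Prog) (K : ℕ), ∀ (I : RTC.RTCInstance) (L : ℕ),
      1 ≤ I.n → 1 ≤ I.m → I.SizeLe L →
        ∃ (t : ℕ) (σ : RTC.Store), RTC.Run p I.input t σ ∧
          t ≤ K * (I.α * I.k + L) * (I.n * I.m * I.numStates ^ 3) ∧
          ((I.Controllable ∧ σ.reg 0 = 1) ∨ (¬ I.Controllable ∧ σ.reg 0 = 0)) :=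
  ⟨RTC.decideProg, 600000, fun _ _ hn hm hL => RTC.run_decideProg hn hm hL⟩
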